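/- Let $M$ be a smooth manifold of dimension $n$ (Hausdorff and $\sigma$-compact), and let $E\subset TM$ be a smooth vector subbundle ("Heisenberg manifold"). The map $X\wedge Y\mapsto [X,Y]\bmod E$ on sections of $E$ induces a bundle map $\bigwedge^2E\to TM/E$, which makes each fibre of $\mathrm{gr}(TM)=E\oplus TM/E$ a graded Lie algebra with bracket $[(X,Z),(Y,T)]=(0,[X,Y]\bmod E)$; for $t>0$ let $\theta_t$ be its automorphism equal to $t$ on $E$ and to $t^2$ on $TM/E$. For a Riemannian metric $\gamma$ on $M$ let $\varphi_\gamma:\mathrm{gr}(TM)\to TM\to T^*M$ be the bundle isomorphism obtained by identifying $TM/E$ with $E^{\perp_\gamma}$ and then $TM$ with $T^*M$ by means of $\gamma$. Two metrics $\gamma_1,\gamma_2$ are called quasi-conformal if at each point $x\in M$ one has $\varphi_{\gamma_1}^{-1}\circ\varphi_{\gamma_2}=\mathrm{Ad}(X)\circ\theta_t$ on $\mathrm{gr}(TM)_x$ for some $X\in\mathrm{gr}(TM)_x$ and some $t>0$, where $\mathrm{Ad}(X)=\exp(\mathrm{ad}\,X)$. This is an equivalence relation, and a quasi-conformal structure on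 $(M,E)$ is an equivalence class. Given such a structure, each $T_x^*M$ carries the Lie algebra structure transported from $\mathrm{gr}(TM)_x$ by $\varphi_\gamma$, where $\gamma$ is any metric in the class (the result does not depend on $\gamma$). Let $$\delta:\textstyle\bigwedge^{k+1}T^*M\to\bigwedge^{k}T^*M ,\qquad \delta(\xi_0\wedge\dots\wedge\xi_k)=\sum_{i<j}(-1)^{i+j+1}[\xi_i,\xi_j]\wedge\xi_0\wedge\cdots\widehat{\xi_i}\cdots\widehat{\xi_j}\cdots\wedge\xi_k ,$$ be the bundle map which on each fibre is the boundary map of Lie algebra homology of $T^*_xM$ (with $\delta=0$ on $\bigwedge^1$ and $\bigwedge^0$). Assume that $\delta$ has locally constant rank in each degree, so that $\mathrm{im}\,\delta\subset\ker\delta\subset\bigwedge T^*M$ are vector subbundles. Let $(\Omega,d)$ be the de Rham complex of $M$ and let $\mathcal E=\bigoplus_k\mathcal E^k$, $$\mathcal E^k=\{\alpha\in\Omega^k(M)\;:\;\delta\alpha=0,\ \delta d\alpha=0\},$$ which is a subcomplex of $(\Omega,d)$. Let $\iota:\mathcal E^k\to\Gamma((\ker\delta/\mathrm{im}\,\delta)^k)$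 be the map that sends $\alpha$ to its class modulo $\mathrm{im}\,\delta$, where $\Gamma$ denotes smooth sections. **Theorem.** (1) The inclusion $(\mathcal E,d)\to(\Omega,d)$ induces an isomorphism in cohomology in every degree. (2) The map $\iota:\mathcal E^k\to\Gamma((\ker\delta/\mathrm{im}\,\delta)^k)$ is a linear isomorphism for every $k$. Consequently $D=\iota\, d\,\iota^{-1}:\Gamma((\ker\delta/\mathrm{im}\,\delta)^k)\to\Gamma((\ker\delta/\mathrm{im}\,\delta)^{k+1})$ is, for every $k$, a differential operator (of finite order), it satisfies $D^2=0$, and the morphism of complexes $\iota^{-1}:(\Gamma(\ker\delta/\mathrm{im}\,\delta),D)\to(\mathcal E,d)\subset(\Omega,d)$ induces an isomorphism in cohomology in every degree. In particular, the cohomology of the BGG–Rumin complex $(\Gamma(\ker\delta/\mathrm{im}\,\delta),D)$ is the de Rham cohomology of $M$. -/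

import Mathlib

open scoped Manifold ContDiff

set_option maxSynthPendingDepth 3

noncomputable section

namespace Heisenberg

/-- The model space `ℝⁿ`. -/
abbrev Model (n : ℕ) : Type := EuclideanSpace ℝ (Fin n)

section DifferentialForms

variable {n : ℕ} {M : Type*} [TopologicalSpace M] [ChartedSpace (Model n) M]

/-- The fibre at `x` of `Λᵏ T*M`: alternating `k`-linear forms on the tangent space. -/
abbrev FormFiber (n k : ℕ) {M : Type*} [TopologicalSpace M] [ChartedSpace (Model n) M]
    (x : M) : Type :=
  TangentSpace (𝓡 n) x [⋀^Fin k]→L[ℝ] ℝ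

/-- The fibre at `x` of `T*M`. -/
abbrev CotangentSpace (n : ℕ) {M : Type*} [TopologicalSpace M] [ChartedSpace (Model n) M]
    (x : M) : Type :=
  TangentSpace (𝓡 n) x →L[ℝ] ℝ

/-- The expression of a `k`-form in the preferred chart at `c`, i.e. its pullback along the inverse
of that chart (meaningful on the target of the chart). -/
def inChart {k : ℕ} (c : M) (α : ∀ x : M, FormFiber n k x) (y : Model n) :
    Model n [⋀^Fin k]→L[ℝ] ℝ :=
  (α ((extChartAt (𝓡 n) c).symm y)).compContinuousLinearMap
    (mfderiv 𝓘(ℝ, Model n) (𝓡 n) (extChartAt (𝓡 n) c).symm y)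

/-- A (rough) form is smooth if all its expressions in charts are smooth. -/
def IsSmoothForm {k : ℕ} (α : ∀ x : M, FormFiber n k x) : Prop :=
  ∀ c : M, ContDiffOn ℝ ∞ (inChart c α) (extChartAt (𝓡 n) c).target

/-- The exterior derivative at `x`, computed in the preferred chart at `x`. By `inChart_extD` any
other chart gives the same result. -/
def extD {k : ℕ} (α : ∀ x : M, FormFiber n k x) (x : M) : FormFiber n (k + 1) x :=
  (extDeriv (inChart x α) (extChartAt (𝓡 n) x x)).compContinuousLinearMap
    (mfderiv (𝓡 n) 𝓘(ℝ, Model n) (extChartAt (𝓡 n) x) x)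

theorem inChart_transition [IsManifold (𝓡 n) ∞ M] {k : ℕ} (α : ∀ x : M, FormFiber n k x)
    (c x : M) {z : Model n} (hz : z ∈ (extChartAt (𝓡 n) c).target)
    (hx : (extChartAt (𝓡 n) c).symm z ∈ (extChartAt (𝓡 n) x).source) :
    ContDiffAt ℝ ∞ (extChartAt (𝓡 n) x ∘ (extChartAt (𝓡 n) c).symm) z ∧
    fderiv ℝ (extChartAt (𝓡 n) x ∘ (extChartAt (𝓡 n) c).symm) z =
      (mfderiv (𝓡 n) 𝓘(ℝ, Model n) (extChartAt (𝓡 n) x) ((extChartAt (𝓡 n) c).symm z)).comp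
        (mfderiv 𝓘(ℝ, Model n) (𝓡 n) (extChartAt (𝓡 n) c).symm z) ∧
    inChart c α z =
      (inChart x α (extChartAt (𝓡 n) x ((extChartAt (𝓡 n) c).symm z))).compContinuousLinearMap
        (fderiv ℝ (extChartAt (𝓡 n) x ∘ (extChartAt (𝓡 n) c).symm) z) := by
  have : IsManifold (𝓡 n) 1 M := IsManifold.of_le (n := ∞) (by simp)
  have hsymm : ∀ (c : M) (z : Model n), z ∈ (extChartAt (𝓡 n) c).target →
      ContMDiffAt 𝓘(ℝ, Model n) (𝓡 n) ∞ (extChartAt (𝓡 n) c).symm z := fun c z hz =>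
    (contMDiffOn_extChartAt_symm c).contMDiffAt ((isOpen_extChartAt_target c).mem_nhds hz)
  have hch : ContMDiffAt (𝓡 n) 𝓘(ℝ, Model n) ∞ (extChartAt (𝓡 n) x)
      ((extChartAt (𝓡 n) c).symm z) :=
    contMDiffAt_extChartAt' (by simpa using hx)
  have hτ : ContMDiffAt 𝓘(ℝ, Model n) 𝓘(ℝ, Model n) ∞
      (extChartAt (𝓡 n) x ∘ (extChartAt (𝓡 n) c).symm) z := hch.comp z (hsymm c z hz)
  have hd : mfderiv 𝓘(ℝ, Model n) 𝓘(ℝ, Model n)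
        (extChartAt (𝓡 n) x ∘ (extChartAt (𝓡 n) c).symm) z =
      (mfderiv (𝓡 n) 𝓘(ℝ, Model n) (extChartAt (𝓡 n) x) ((extChartAt (𝓡 n) c).symm z)).comp
        (mfderiv 𝓘(ℝ, Model n) (𝓡 n) (extChartAt (𝓡 n) c).symm z) :=
    mfderiv_comp z (hch.mdifferentiableAt (by simp)) ((hsymm c z hz).mdifferentiableAt (by simp))
  refine ⟨contMDiffAt_iff_contDiffAt.1 hτ, ?_, ?_⟩
  · rw [← mfderiv_eq_fderiv]; exact hd
  · have hE : (extChartAt (𝓡 n) c).symm =ᶠ[nhds z]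
        (extChartAt (𝓡 n) x).symm ∘ (extChartAt (𝓡 n) x ∘ (extChartAt (𝓡 n) c).symm) := by
      have : ∀ᶠ w in nhds z, (extChartAt (𝓡 n) c).symm w ∈ (extChartAt (𝓡 n) x).source :=
        (hsymm c z hz).continuousAt.eventually_mem ((isOpen_extChartAt_source x).mem_nhds hx)
      filter_upwards [this] with w hw
      exact ((extChartAt (𝓡 n) x).left_inv hw).symm
    have h3 : mfderiv 𝓘(ℝ, Model n) (𝓡 n) (extChartAt (𝓡 n) c).symm z =
        (mfderiv 𝓘(ℝ, Model n) (𝓡 n) (extChartAt (𝓡 n) x).symm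
          (extChartAt (𝓡 n) x ((extChartAt (𝓡 n) c).symm z))).comp
        (fderiv ℝ (extChartAt (𝓡 n) x ∘ (extChartAt (𝓡 n) c).symm) z) := by
      have h5 := mfderiv_comp z
        ((hsymm x _ ((extChartAt (𝓡 n) x).map_source hx)).mdifferentiableAt (by simp))
        (hτ.mdifferentiableAt (by simp))
      rw [mfderiv_eq_fderiv] at h5
      exact hE.mfderiv_eq.trans h5
    have key : ∀ (p q : M), q = p → ∀ (A B : Model n →L[ℝ] Model n), A = B →
       (show Model n [⋀^Fin k]→L[ℝ] ℝ from α p).compContinuousLinearMap A =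
         (show Model n [⋀^Fin k]→L[ℝ] ℝ from α q).compContinuousLinearMap B := by
      rintro p q rfl A B rfl; rfl
    exact key _ _ ((extChartAt (𝓡 n) x).left_inv hx) _ _ h3

/-- The exterior derivative is computed by the usual formula in every chart. -/
theorem inChart_extD [IsManifold (𝓡 n) ∞ M] {k : ℕ} {α : ∀ x : M, FormFiber n k x}
    (hα : IsSmoothForm α) (c : M) {y : Model n} (hy : y ∈ (extChartAt (𝓡 n) c).target) :
    inChart c (extD α) y = extDeriv (inChart c α) y := by
  set x := (extChartAt (𝓡 n) c).symm y with hxdef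
  have hx : (extChartAt (𝓡 n) c).symm y ∈ (extChartAt (𝓡 n) x).source := mem_extChartAt_source x
  obtain ⟨h1, h2, -⟩ := inChart_transition α c x hy hx
  have hev : inChart c α =ᶠ[nhds y] fun z =>
      (inChart x α ((extChartAt (𝓡 n) x ∘ (extChartAt (𝓡 n) c).symm) z)).compContinuousLinearMap
        (fderiv ℝ (extChartAt (𝓡 n) x ∘ (extChartAt (𝓡 n) c).symm) z) := by
    have h4 : ∀ᶠ w in nhds y, (extChartAt (𝓡 n) c).symm w ∈ (extChartAt (𝓡 n) x).source :=
      (((contMDiffOn_extChartAt_symm (I := 𝓡 n) (n := ∞) c).contMDiffAt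
        ((isOpen_extChartAt_target c).mem_nhds hy)).continuousAt).eventually_mem
          ((isOpen_extChartAt_source x).mem_nhds hx)
    filter_upwards [h4, (isOpen_extChartAt_target c).mem_nhds hy] with z hz hz'
    exact (inChart_transition α c x hz' hz).2.2
  have hdiff : DifferentiableAt ℝ (inChart x α) (extChartAt (𝓡 n) x x) :=
    ((hα x).contDiffAt
      ((isOpen_extChartAt_target x).mem_nhds (mem_extChartAt_target x))).differentiableAt (by simp)
  have h6 := extDeriv_pullback (r := ∞) (f := extChartAt (𝓡 n) x ∘ (extChartAt (𝓡 n) c).symm)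
    (x := y) hdiff h1 (by simpa using ENat.LEInfty.out)
  rw [hev.extDeriv_eq, h6, h2]
  rfl

theorem IsSmoothForm.extD [IsManifold (𝓡 n) ∞ M] {k : ℕ} {α : ∀ x : M, FormFiber n k x}
    (hα : IsSmoothForm α) : IsSmoothForm (extD α) := by
  intro c
  have : ContDiffOn ℝ ∞ (extDeriv (inChart c α)) (extChartAt (𝓡 n) c).target := by
    have h := (hα c).fderiv_of_isOpen (m := ∞) (isOpen_extChartAt_target c) (by simp)
    exact (ContinuousAlternatingMap.alternatizeUncurryFinCLM ℝ (Model n) ℝ).contDiff.comp_contDiffOn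
      h
  exact this.congr fun y hy => inChart_extD hα c hy

theorem extD_extD [IsManifold (𝓡 n) ∞ M] {k : ℕ} {α : ∀ x : M, FormFiber n k x}
    (hα : IsSmoothForm α) (x : M) : Heisenberg.extD (Heisenberg.extD α) x = 0 := by
  have hev : inChart x (Heisenberg.extD α) =ᶠ[nhds (extChartAt (𝓡 n) x x)]
      extDeriv (inChart x α) := by
    filter_upwards [(isOpen_extChartAt_target x).mem_nhds (mem_extChartAt_target x)] with y hy
    exact inChart_extD hα x hy
  rw [Heisenberg.extD, hev.extDeriv_eq, extDeriv_extDeriv_apply (r := ∞) ((hα x).contDiffAt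
    ((isOpen_extChartAt_target x).mem_nhds (mem_extChartAt_target x)))
    (by simpa using ENat.LEInfty.out)]
  rfl

/-- The space `Ωᵏ(M)` of smooth differential `k`-forms. -/
def Form (n : ℕ) (M : Type*) [TopologicalSpace M] [ChartedSpace (Model n) M] (k : ℕ) :
    Submodule ℝ (∀ x : M, FormFiber n k x) where
  carrier := {α | IsSmoothForm α}
  zero_mem' := fun _ => contDiffOn_const (c := (0 : Model n [⋀^Fin k]→L[ℝ] ℝ))
  add_mem' := fun ha hb c => (ha c).add (hb c)
  smul_mem' := fun t _ ha c => (ha c).const_smul t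

variable [IsManifold (𝓡 n) ∞ M]

/-- The exterior derivative `d : Ωᵏ(M) → Ωᵏ⁺¹(M)`. -/
def d (k : ℕ) : Form n M k →ₗ[ℝ] Form n M (k + 1) where
  toFun α := ⟨extD α.1, IsSmoothForm.extD α.2⟩
  map_add' α β := by
    ext1; funext x
    have hd (γ : Form n M k) : DifferentiableAt ℝ (inChart x γ.1) (extChartAt (𝓡 n) x x) :=
      ((γ.2 x).contDiffAt ((isOpen_extChartAt_target x).mem_nhds
        (mem_extChartAt_target x))).differentiableAt (by simp)
    exact congrArg (fun (A : Model n [⋀^Fin (k + 1)]→L[ℝ] ℝ) => A.compContinuousLinearMap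
      (mfderiv (𝓡 n) 𝓘(ℝ, Model n) (extChartAt (𝓡 n) x) x)) (extDeriv_add (hd α) (hd β))
  map_smul' t α := by
    ext1; funext x
    exact congrArg (fun (A : Model n [⋀^Fin (k + 1)]→L[ℝ] ℝ) => A.compContinuousLinearMap
      (mfderiv (𝓡 n) 𝓘(ℝ, Model n) (extChartAt (𝓡 n) x) x)) (extDeriv_smul t (inChart x α.1))

theorem d_d (k : ℕ) (α : Form n M k) : d (k + 1) (d k α) = 0 := by
  ext1; funext x; exact extD_extD α.2 x

/-- Multiplication of a form by a smooth function. -/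
def Form.mul (k : ℕ) (f : C^∞⟮𝓡 n, M; ℝ⟯) : Form n M k →ₗ[ℝ] Form n M k where
  toFun α := ⟨fun x => f x • α.1 x, fun c =>
    (contMDiffOn_iff_contDiffOn.1
      (f.contMDiff.comp_contMDiffOn (contMDiffOn_extChartAt_symm c))).smul (α.2 c)⟩
  map_add' α β := by ext1; funext x; exact smul_add _ _ _
  map_smul' t α := by ext1; funext x; exact smul_comm (f x) t (α.1 x)

variable (n M) in
/-- The de Rham complex `(Ω(M), d)`. -/
def deRham : CochainComplex (ModuleCat ℝ) ℕ :=
  CochainComplex.of (fun k => ModuleCat.of ℝ (Form n M k)) (fun k => ModuleCat.ofHom (d k))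
    (fun k => by ext α : 2; exact d_d k α)

theorem deRham_d (k : ℕ) : (deRham n M).d k (k + 1) = ModuleCat.ofHom (d k) :=
  CochainComplex.of_d (fun k => ModuleCat.of ℝ (Form n M k)) (fun k => ModuleCat.ofHom (d k)) k

end DifferentialForms
section Filtration

variable {n : ℕ} {M : Type*} [TopologicalSpace M] [ChartedSpace (Model n) M]

/-- A smooth vector subbundle `E` of the tangent bundle: a family of subspaces of the tangent
spaces which is locally spanned by a smooth frame. -/
structure Subbundle (n : ℕ) (M : Type*) [TopologicalSpace M] [ChartedSpace (Model n) M]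
    [IsManifold (𝓡 n) ∞ M] where
  fiber : ∀ x : M, Submodule ℝ (TangentSpace (𝓡 n) x)
  exists_frame : ∀ x : M, ∃ (r : ℕ) (s : Fin r → ∀ y : M, TangentSpace (𝓡 n) y) (U : Set M),
    IsOpen U ∧ x ∈ U ∧
    (∀ i, ContMDiffOn (𝓡 n) (𝓡 n).tangent ∞
      (fun y => (⟨y, s i y⟩ : TangentBundle (𝓡 n) M)) U) ∧
    ∀ y ∈ U, LinearIndependent ℝ (fun i => s i y) ∧
      Submodule.span ℝ (Set.range fun i => s i y) = fiber y

variable [IsManifold (𝓡 n) ∞ M] (E : Subbundle n M)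

namespace Subbundle

/-- The rank of a local frame of `E` around `x`. -/
def frameRank (x : M) : ℕ := (E.exists_frame x).choose

/-- A local frame of `E` around `x`. -/
def frame (x : M) : Fin (E.frameRank x) → ∀ y : M, TangentSpace (𝓡 n) y :=
  (E.exists_frame x).choose_spec.choose

theorem frame_spec (x : M) : ∃ U : Set M,
    IsOpen U ∧ x ∈ U ∧
    (∀ i, ContMDiffOn (𝓡 n) (𝓡 n).tangent ∞
      (fun y => (⟨y, E.frame x i y⟩ : TangentBundle (𝓡 n) M)) U) ∧
    ∀ y ∈ U, LinearIndependent ℝ (fun i => E.frame x i y) ∧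
      Submodule.span ℝ (Set.range fun i => E.frame x i y) = E.fiber y :=
  (E.exists_frame x).choose_spec.choose_spec

theorem frame_linearIndependent (x : M) : LinearIndependent ℝ (fun i => E.frame x i x) := by
  obtain ⟨U, -, hx, -, h⟩ := E.frame_spec x
  exact (h x hx).1

theorem span_frame (x : M) :
    Submodule.span ℝ (Set.range fun i => E.frame x i x) = E.fiber x := by
  obtain ⟨U, -, hx, -, h⟩ := E.frame_spec x
  exact (h x hx).2

/-- The basis of `E x` given by the local frame. -/
def basis (x : M) : Module.Basis (Fin (E.frameRank x)) ℝ (E.fiber x) :=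
  (Module.Basis.span (E.frame_linearIndependent x)).map (LinearEquiv.ofEq _ _ (E.span_frame x))

theorem basis_apply (x : M) (i) : (E.basis x i : TangentSpace (𝓡 n) x) = E.frame x i x := by
  simp [basis, Module.Basis.span_apply]

/-- The bundle map `Λ²E → TM/E`, `X ∧ Y ↦ [X, Y] mod E`. It is the bilinear map which has the
prescribed value on pairs of elements of a local frame; `levi_eq` says that its value on any two
local sections of `E` is their Lie bracket modulo `E`. -/
def levi (x : M) : E.fiber x →ₗ[ℝ] E.fiber x →ₗ[ℝ] (TangentSpace (𝓡 n) x ⧸ E.fiber x) :=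
  (E.basis x).constr ℝ fun i => (E.basis x).constr ℝ fun j =>
    (E.fiber x).mkQ (VectorField.mlieBracket (𝓡 n) (E.frame x i) (E.frame x j) x)

theorem levi_basis (x : M) (i j) : E.levi x (E.basis x i) (E.basis x j) =
    (E.fiber x).mkQ (VectorField.mlieBracket (𝓡 n) (E.frame x i) (E.frame x j) x) := by
  simp [levi]

theorem frame_mdifferentiableAt (x : M) (i) : MDifferentiableAt (𝓡 n) (𝓡 n).tangent
    (fun y => (⟨y, E.frame x i y⟩ : TangentBundle (𝓡 n) M)) x := by
  obtain ⟨U, hU, hx, h, -⟩ := E.frame_spec x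
  exact ((h i).contMDiffAt (hU.mem_nhds hx)).mdifferentiableAt (by simp)

/-- A differentiable local section of `E` has differentiable coefficients in a local frame. -/
theorem exists_coeff (x : M) (X : ∀ y : M, TangentSpace (𝓡 n) y)
    (hX : MDifferentiableAt (𝓡 n) (𝓡 n).tangent
      (fun y => (⟨y, X y⟩ : TangentBundle (𝓡 n) M)) x)
    (hXE : ∀ᶠ y in nhds x, X y ∈ E.fiber y) :
    ∃ f : Fin (E.frameRank x) → M → ℝ, (∀ i, MDifferentiableAt (𝓡 n) 𝓘(ℝ) (f i) x) ∧
      ∀ᶠ y in nhds x, X y = ∑ i, f i y • E.frame x i y := by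
  classical
  have : IsManifold (𝓡 n) 1 M := IsManifold.of_le (n := ∞) (by simp)
  obtain ⟨U, hU, hxU, -, hUE⟩ := E.frame_spec x
  let e := trivializationAt (Model n) (TangentSpace (𝓡 n) : M → Type) x
  let hat (Z : ∀ y : M, TangentSpace (𝓡 n) y) (y : M) : Model n := e.linearMapAt ℝ y (Z y)
  have hbase : ∀ᶠ y in nhds x, y ∈ e.baseSet :=
    e.open_baseSet.mem_nhds (FiberBundle.mem_baseSet_trivializationAt' x)
  have hhat : ∀ Z : ∀ y : M, TangentSpace (𝓡 n) y, MDifferentiableAt (𝓡 n) (𝓡 n).tangent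
      (fun y => (⟨y, Z y⟩ : TangentBundle (𝓡 n) M)) x →
      MDifferentiableAt (𝓡 n) 𝓘(ℝ, Model n) (hat Z) x := by
    intro Z hZ
    refine ((mdifferentiableAt_section (𝓡 n) Z).1 hZ).congr_of_eventuallyEq ?_
    filter_upwards [hbase] with y hy
    exact (Bundle.Trivialization.linearMapAt_apply (R := ℝ) e _).trans (if_pos hy)
  let S (y : M) : (Fin (E.frameRank x) → ℝ) →L[ℝ] Model n :=
    ∑ i, (ContinuousLinearMap.proj (R := ℝ) (φ := fun _ => ℝ) i).smulRight (hat (E.frame x i) y)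
  have hS (y : M) (c) : S y c = e.linearMapAt ℝ y (∑ i, c i • E.frame x i y) := by
    simp [S, hat, map_sum]
  have hSd : MDifferentiableAt (𝓡 n) 𝓘(ℝ, (Fin (E.frameRank x) → ℝ) →L[ℝ] Model n) S x := by
    have h1 : ∀ i, MDifferentiableAt (𝓡 n) 𝓘(ℝ, (Fin (E.frameRank x) → ℝ) →L[ℝ] Model n)
        (fun y => (ContinuousLinearMap.proj (R := ℝ) (φ := fun _ => ℝ) i).smulRight
          (hat (E.frame x i) y)) x := fun i =>
      (ContinuousLinearMap.smulRightL ℝ (Fin (E.frameRank x) → ℝ) (Model n)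
        (ContinuousLinearMap.proj i)).differentiableAt.comp_mdifferentiableAt
          (hhat _ (E.frame_mdifferentiableAt x i))
    have h2 := MDifferentiableAt.sum (t := Finset.univ) (fun i _ => h1 i)
    exact h2.congr_of_eventuallyEq (Filter.Eventually.of_forall fun y => by simp [S])
  have hinj : Function.Injective (S x) := by
    rw [injective_iff_map_eq_zero]
    intro c hc
    rw [hS] at hc
    have hx0 : x ∈ e.baseSet := FiberBundle.mem_baseSet_trivializationAt' x
    have h0 : ∑ i, c i • E.frame x i x = 0 := by
      have := e.symmₗ_linearMapAt (R := ℝ) hx0 (∑ i, c i • E.frame x i x)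
      rw [hc, map_zero] at this
      exact this.symm
    funext i
    exact Fintype.linearIndependent_iff.1 (E.frame_linearIndependent x) c h0 i
  obtain ⟨P', hP'⟩ := LinearMap.exists_leftInverse_of_injective (S x).toLinearMap
    (LinearMap.ker_eq_bot.2 hinj)
  let P : Model n →L[ℝ] (Fin (E.frameRank x) → ℝ) := LinearMap.toContinuousLinearMap P'
  let G (y : M) : (Fin (E.frameRank x) → ℝ) →L[ℝ] (Fin (E.frameRank x) → ℝ) := P.comp (S y)
  have hGx : G x = (ContinuousLinearEquiv.refl ℝ (Fin (E.frameRank x) → ℝ) :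
      (Fin (E.frameRank x) → ℝ) →L[ℝ] (Fin (E.frameRank x) → ℝ)) := by
    ext1 c
    exact LinearMap.congr_fun hP' c
  have hGd : MDifferentiableAt (𝓡 n)
      𝓘(ℝ, (Fin (E.frameRank x) → ℝ) →L[ℝ] (Fin (E.frameRank x) → ℝ)) G x :=
    (ContinuousLinearMap.compL ℝ (Fin (E.frameRank x) → ℝ) (Model n) (Fin (E.frameRank x) → ℝ)
      P).differentiableAt.comp_mdifferentiableAt hSd
  have hF : MDifferentiableAt (𝓡 n) 𝓘(ℝ, Fin (E.frameRank x) → ℝ)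
      (fun y => (G y).inverse (P (hat X y))) x := by
    refine MDifferentiableAt.clm_apply ?_ (P.differentiableAt.comp_mdifferentiableAt (hhat X hX))
    refine DifferentiableAt.comp_mdifferentiableAt (g := ContinuousLinearMap.inverse) ?_ hGd
    rw [hGx]
    exact (contDiffAt_map_inverse (n := 1) _).differentiableAt (by simp)
  refine ⟨fun i y => (G y).inverse (P (hat X y)) i, fun i =>
    ((ContinuousLinearMap.proj (R := ℝ) (φ := fun _ : Fin (E.frameRank x) => ℝ)
      i).differentiableAt.comp_mdifferentiableAt hF), ?_⟩
  have hGinv : ∀ᶠ y in nhds x, ∃ A : (Fin (E.frameRank x) → ℝ) ≃L[ℝ] (Fin (E.frameRank x) → ℝ),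
      (A : (Fin (E.frameRank x) → ℝ) →L[ℝ] (Fin (E.frameRank x) → ℝ)) = G y := by
    have h := ContinuousLinearEquiv.nhds (𝕜 := ℝ)
      (ContinuousLinearEquiv.refl ℝ (Fin (E.frameRank x) → ℝ))
    rw [← hGx] at h
    exact hGd.continuousAt.eventually h
  filter_upwards [hGinv, hXE, hU.mem_nhds hxU] with y ⟨A, hA⟩ hy hyU
  rw [← (hUE y hyU).2] at hy
  obtain ⟨c, hc⟩ := (Submodule.mem_span_range_iff_exists_fun ℝ).1 hy
  have h1 : P (hat X y) = G y c := by
    change P (e.linearMapAt ℝ y (X y)) = P (S y c)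
    rw [hS, hc]
  have h2 : (G y).inverse (P (hat X y)) = c := by
    rw [h1, ← hA, ContinuousLinearMap.inverse_equiv]; simp
  simp only [h2]
  exact hc.symm

theorem levi_aux (x : M) {r : ℕ} (X : Fin r → ∀ y : M, TangentSpace (𝓡 n) y)
    (f : Fin r → M → ℝ) (Y : ∀ y : M, TangentSpace (𝓡 n) y)
    (hX : ∀ i, MDifferentiableAt (𝓡 n) (𝓡 n).tangent
      (fun y => (⟨y, X i y⟩ : TangentBundle (𝓡 n) M)) x) (hXE : ∀ i, X i x ∈ E.fiber x)
    (hf : ∀ i, MDifferentiableAt (𝓡 n) 𝓘(ℝ) (f i) x) (t : Finset (Fin r)) :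
    MDifferentiableAt (𝓡 n) (𝓡 n).tangent
      (fun y => (⟨y, ∑ i ∈ t, f i y • X i y⟩ : TangentBundle (𝓡 n) M)) x ∧
    (E.fiber x).mkQ (VectorField.mlieBracket (𝓡 n) (fun y => ∑ i ∈ t, f i y • X i y) Y x) =
      ∑ i ∈ t, f i x • (E.fiber x).mkQ (VectorField.mlieBracket (𝓡 n) (X i) Y x) := by
  classical
  have : IsManifold (𝓡 n) 1 M := IsManifold.of_le (n := ∞) (by simp)
  have : IsManifold (𝓡 n) 2 M := IsManifold.of_le (n := ∞) ENat.LEInfty.out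
  induction t using Finset.induction_on with
  | empty =>
    simp only [Finset.sum_empty]
    refine ⟨Bundle.mdifferentiableAt_zeroSection (IB := 𝓡 n) (𝕜 := ℝ) (F := Model n) (TangentSpace (𝓡 n) : M → Type), ?_⟩
    exact (congrArg _ (congrFun VectorField.mlieBracket_zero_left x)).trans (map_zero _)
  | insert a t ha ih =>
    obtain ⟨ih1, ih2⟩ := ih
    have hs : MDifferentiableAt (𝓡 n) (𝓡 n).tangent
      (fun y => (⟨y, (f a • X a) y⟩ : TangentBundle (𝓡 n) M)) x :=
      (hf a).smul_section (hX a)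
    simp only [Finset.sum_insert ha]
    refine ⟨mdifferentiableAt_add_section hs ih1, ?_⟩
    have h1 := VectorField.mlieBracket_add_left (I := 𝓡 n) (W := Y) hs ih1
    refine (congrArg _ h1).trans ?_
    rw [map_add, ih2, VectorField.mlieBracket_smul_left (hf a) (hX a), map_add, map_smul, map_smul,
      show (E.fiber x).mkQ (X a x) = 0 from (Submodule.Quotient.mk_eq_zero _).2 (hXE a), smul_zero,
      zero_add]

/-- The bundle map `levi` is induced by the Lie bracket of sections of `E`. -/
theorem levi_eq (x : M) (X Y : ∀ y : M, TangentSpace (𝓡 n) y)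
    (hX : MDifferentiableAt (𝓡 n) (𝓡 n).tangent
      (fun y => (⟨y, X y⟩ : TangentBundle (𝓡 n) M)) x)
    (hY : MDifferentiableAt (𝓡 n) (𝓡 n).tangent
      (fun y => (⟨y, Y y⟩ : TangentBundle (𝓡 n) M)) x)
    (hXE : ∀ᶠ y in nhds x, X y ∈ E.fiber y) (hYE : ∀ᶠ y in nhds x, Y y ∈ E.fiber y) :
    E.levi x ⟨X x, hXE.self_of_nhds⟩ ⟨Y x, hYE.self_of_nhds⟩ =
      (E.fiber x).mkQ (VectorField.mlieBracket (𝓡 n) X Y x) := by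
  obtain ⟨f, hf, hXf⟩ := E.exists_coeff x X hX hXE
  obtain ⟨g, hg, hYg⟩ := E.exists_coeff x Y hY hYE
  have hmem : ∀ i, E.frame x i x ∈ E.fiber x := fun i => by
    rw [← E.basis_apply]; exact (E.basis x i).2
  have hX' : (⟨X x, hXE.self_of_nhds⟩ : E.fiber x) = ∑ i, f i x • E.basis x i := by
    ext1; simpa [E.basis_apply] using hXf.self_of_nhds
  have hY' : (⟨Y x, hYE.self_of_nhds⟩ : E.fiber x) = ∑ i, g i x • E.basis x i := by
    ext1; simpa [E.basis_apply] using hYg.self_of_nhds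
  have hbr : VectorField.mlieBracket (𝓡 n) X Y x = VectorField.mlieBracket (𝓡 n)
      (fun y => ∑ i, f i y • E.frame x i y) (fun y => ∑ i, g i y • E.frame x i y) x :=
    Filter.EventuallyEq.mlieBracket_vectorField_eq hXf hYg
  rw [hX', hY', hbr,
    (levi_aux E x (E.frame x) f _ (E.frame_mdifferentiableAt x) hmem hf Finset.univ).2]
  simp only [map_sum, map_smul, LinearMap.sum_apply, LinearMap.smul_apply, levi_basis]
  simp only [Finset.smul_sum]
  rw [Finset.sum_comm]
  refine Finset.sum_congr rfl fun i _ => ?_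
  simp only [smul_comm _ (f i x)]
  rw [← Finset.smul_sum]
  congr 1
  rw [VectorField.mlieBracket_swap_apply, map_neg,
    (levi_aux E x (E.frame x) g _ (E.frame_mdifferentiableAt x) hmem hg Finset.univ).2,
    ← Finset.sum_neg_distrib]
  refine Finset.sum_congr rfl fun j _ => ?_
  rw [VectorField.mlieBracket_swap_apply, map_neg, smul_neg]

theorem levi_self (x : M) (u : E.fiber x) : E.levi x u u = 0 := by
  have h : E.levi x = -(E.levi x).flip := by
    refine (E.basis x).ext fun i => (E.basis x).ext fun j => ?_
    simp only [LinearMap.neg_apply, LinearMap.flip_apply, levi_basis]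
    rw [VectorField.mlieBracket_swap_apply, map_neg]
  have h2 : E.levi x u u = -E.levi x u u := by
    conv_lhs => rw [h]
    rfl
  have h3 : (2 : ℝ) • E.levi x u u = 0 := by
    rw [two_smul]; nth_rewrite 1 [h2]; exact neg_add_cancel _
  exact (smul_eq_zero.1 h3).resolve_left two_ne_zero

/-- The fibre at `x` of `gr(TM) = E ⊕ TM/E`. -/
abbrev Gr (x : M) : Type := E.fiber x × (TangentSpace (𝓡 n) x ⧸ E.fiber x)

/-- The Lie bracket `[(X, Z), (Y, T)] = (0, [X, Y] mod E)` of the graded Lie algebra `gr(TM)ₓ`. -/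
def grBracket (x : M) : E.Gr x →ₗ[ℝ] E.Gr x →ₗ[ℝ] E.Gr x :=
  ((E.levi x).compl₁₂ (LinearMap.fst ℝ _ _) (LinearMap.fst ℝ _ _)).compr₂ (LinearMap.inr ℝ _ _)

theorem grBracket_apply (x : M) (z w : E.Gr x) :
    E.grBracket x z w = (0, E.levi x z.1 w.1) := rfl

theorem grBracket_self (x : M) (z : E.Gr x) : E.grBracket x z z = 0 := by
  rw [grBracket_apply, levi_self]; rfl

/-- `gr(TM)ₓ` is nilpotent of step two; in particular the Jacobi identity holds. -/
theorem grBracket_grBracket (x : M) (z w u : E.Gr x) :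
    E.grBracket x z (E.grBracket x w u) = 0 := by
  simp only [grBracket_apply, map_zero]; rfl

/-- The dilation `θ_t` of `gr(TM)ₓ`: multiplication by `t` on `E` and by `t²` on `TM/E`. -/
def dilation (x : M) (t : ℝ) : E.Gr x →ₗ[ℝ] E.Gr x :=
  (t • LinearMap.id).prodMap (t ^ 2 • LinearMap.id)

/-- `Ad(X) = exp(ad X)`, which is `1 + ad X` because `(ad X)² = 0` (see `grBracket_grBracket`). -/
def Ad (x : M) (X : E.Gr x) : E.Gr x →ₗ[ℝ] E.Gr x := LinearMap.id + E.grBracket x X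

end Subbundle

/-- Smooth Riemannian metrics on `M`. -/
abbrev Metric (n : ℕ) (M : Type*) [TopologicalSpace M] [ChartedSpace (Model n) M]
    [IsManifold (𝓡 n) ∞ M] :=
  Bundle.ContMDiffRiemannianMetric (𝓡 n) ∞ (Model n) (TangentSpace (𝓡 n) : M → Type)

instance finiteDimensional_tangentSpace (x : M) : FiniteDimensional ℝ (TangentSpace (𝓡 n) x) :=
  inferInstanceAs (FiniteDimensional ℝ (Model n))

/-- The inner product at `x`, as a bilinear form. -/
def Metric.form (γ : Metric n M) (x : M) : LinearMap.BilinForm ℝ (TangentSpace (𝓡 n) x) :=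
  ContinuousLinearMap.coeLM ℝ ∘ₗ (γ.inner x).toLinearMap

/-- The orthogonal of `E` for a metric, at `x`. -/
def Metric.orthogonal (γ : Metric n M) (x : M) : Submodule ℝ (TangentSpace (𝓡 n) x) :=
  (γ.form x).orthogonal (E.fiber x)

theorem Metric.isCompl_orthogonal (γ : Metric n M) (x : M) :
    IsCompl (E.fiber x) (γ.orthogonal E x) := by
  have hrefl : (γ.form x).IsRefl := fun u v h => (γ.symm x v u).trans h
  refine (LinearMap.BilinForm.isCompl_orthogonal_iff_disjoint hrefl).2 ?_
  rw [Submodule.disjoint_def]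
  intro v hv hv'
  by_contra h0
  exact (γ.pos x v h0).ne' (hv' v hv)

/-- The isomorphism `TₓM ≃ T*ₓM` given by the metric. -/
def Metric.flat (γ : Metric n M) (x : M) : TangentSpace (𝓡 n) x ≃ₗ[ℝ] CotangentSpace n x :=
  LinearEquiv.ofBijective (γ.inner x).toLinearMap <| by
    have hinj : Function.Injective (γ.inner x).toLinearMap := by
      rw [injective_iff_map_eq_zero]
      intro v hv
      by_contra h0
      refine (γ.pos x v h0).ne' ?_
      have := DFunLike.congr_fun hv v
      exact this
    refine ⟨hinj, (LinearMap.injective_iff_surjective_of_finrank_eq_finrank ?_).1 hinj⟩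
    rw [← Subspace.dual_finrank_eq (K := ℝ) (V := TangentSpace (𝓡 n) x)]
    exact (LinearMap.toContinuousLinearMap (𝕜 := ℝ) (E := Model n) (F' := ℝ)).finrank_eq

/-- The isomorphism `φ_γ : gr(TM)ₓ ≃ T*ₓM`: identify `TM/E` with the orthogonal of `E`, hence
`gr(TM)` with `TM`, and then `TM` with `T*M` by means of the metric. -/
def Metric.phi (γ : Metric n M) (x : M) : E.Gr x ≃ₗ[ℝ] CotangentSpace n x :=
  ((LinearEquiv.refl ℝ (E.fiber x)).prodCongr
      (Submodule.quotientEquivOfIsCompl _ _ (γ.isCompl_orthogonal E x))).trans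
    ((Submodule.prodEquivOfIsCompl _ _ (γ.isCompl_orthogonal E x)).trans (γ.flat x))

/-- Two metrics are quasi-conformal if at every point `φ_{γ₁}⁻¹ ∘ φ_{γ₂} = Ad(X) ∘ θ_t` for some
`X ∈ gr(TM)` and some `t > 0`. -/
def QuasiConformal (γ₁ γ₂ : Metric n M) : Prop :=
  ∀ x : M, ∃ (X : E.Gr x) (t : ℝ), 0 < t ∧
    ((γ₁.phi E x).symm.toLinearMap ∘ₗ (γ₂.phi E x).toLinearMap) = E.Ad x X ∘ₗ E.dilation x t

theorem quasiConformal_iff (γ₁ γ₂ : Metric n M) : QuasiConformal E γ₁ γ₂ ↔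
    ∀ x : M, ∃ (X : E.Gr x) (t : ℝ), 0 < t ∧
      ∀ z, γ₂.phi E x z = γ₁.phi E x (E.Ad x X (E.dilation x t z)) := by
  refine forall_congr' fun x => exists_congr fun X => exists_congr fun t => and_congr_right' ?_
  rw [LinearMap.ext_iff]
  refine forall_congr' fun z => ?_
  exact (LinearEquiv.symm_apply_eq (γ₁.phi E x))

theorem Subbundle.Ad_dilation_apply (x : M) (X : E.Gr x) (t : ℝ) (z : E.Gr x) :
    E.Ad x X (E.dilation x t z) = (t • z.1, t ^ 2 • z.2 + t • E.levi x X.1 z.1) := by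
  simp [Subbundle.Ad, Subbundle.dilation, Subbundle.grBracket_apply]

/-- Quasi-conformality is an equivalence relation. -/
def quasiConformalSetoid : Setoid (Metric n M) where
  r := QuasiConformal E
  iseqv := by
    refine ⟨fun γ => ?_, fun {γ₁ γ₂} h => ?_, fun {γ₁ γ₂ γ₃} h h' => ?_⟩
    · rw [quasiConformal_iff]
      intro x
      refine ⟨0, 1, one_pos, fun z => ?_⟩
      simp [E.Ad_dilation_apply]
    · rw [quasiConformal_iff] at h ⊢
      intro x
      obtain ⟨X, t, ht, hz⟩ := h x
      refine ⟨(-t⁻¹) • X, t⁻¹, inv_pos.2 ht, fun z => ?_⟩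
      rw [hz, E.Ad_dilation_apply, E.Ad_dilation_apply]
      congr 1
      ext1
      · simp [smul_smul, ht.ne']
      · simp only [Prod.smul_fst, map_smul, LinearMap.smul_apply, smul_add, smul_smul]
        have h1 : t ^ 2 * t⁻¹ ^ 2 = 1 := by field_simp
        have h2 : t ^ 2 * (t⁻¹ * -t⁻¹) = -1 := by field_simp
        have h3 : t * t⁻¹ = 1 := by field_simp
        rw [h1, h2, h3]; simp
    · rw [quasiConformal_iff] at h h' ⊢
      intro x
      obtain ⟨X, t, ht, hz⟩ := h x
      obtain ⟨Y, s, hs, hw⟩ := h' x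
      refine ⟨X + t • Y, t * s, mul_pos ht hs, fun z => ?_⟩
      rw [hw, hz]
      simp only [E.Ad_dilation_apply]
      congr 1
      ext1
      · simp [smul_smul]
      · simp only [Prod.fst_add, Prod.smul_fst, map_add, map_smul, LinearMap.smul_apply,
          LinearMap.add_apply, smul_add, smul_smul]
        rw [show (t * s) ^ 2 = t ^ 2 * s ^ 2 by ring, show t * s * t = t ^ 2 * s by ring]
        abel

/-- A quasi-conformal structure on the Heisenberg manifold `(M, E)`: a quasi-conformality class of
Riemannian metrics. -/
def QuasiConformalStructure : Type _ := Quotient (quasiConformalSetoid E)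

/-- The Lie bracket on `T*ₓM` transported from `gr(TM)ₓ` by `φ_γ`. -/
def Metric.bracket (γ : Metric n M) (x : M) :
    CotangentSpace n x →ₗ[ℝ] CotangentSpace n x →ₗ[ℝ] CotangentSpace n x :=
  ((E.grBracket x).compl₁₂ (γ.phi E x).symm.toLinearMap (γ.phi E x).symm.toLinearMap).compr₂
    (γ.phi E x).toLinearMap

theorem Metric.bracket_apply (γ : Metric n M) (x : M) (ξ η : CotangentSpace n x) :
    γ.bracket E x ξ η =
      γ.phi E x (E.grBracket x ((γ.phi E x).symm ξ) ((γ.phi E x).symm η)) := rfl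

theorem Metric.bracket_eq_of_quasiConformal {γ₁ γ₂ : Metric n M} (h : QuasiConformal E γ₁ γ₂) :
    γ₁.bracket E = γ₂.bracket E := by
  funext x
  obtain ⟨X, t, ht, hz⟩ := (quasiConformal_iff E γ₁ γ₂).1 h x
  ext1 ξ; apply LinearMap.ext; intro η
  obtain ⟨z, rfl⟩ := (γ₂.phi E x).surjective ξ
  obtain ⟨w, rfl⟩ := (γ₂.phi E x).surjective η
  rw [Metric.bracket_apply, Metric.bracket_apply, LinearEquiv.symm_apply_apply,
    LinearEquiv.symm_apply_apply, hz, hz, hz, LinearEquiv.symm_apply_apply,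
    LinearEquiv.symm_apply_apply]
  congr 1
  simp only [E.Ad_dilation_apply, E.grBracket_apply]
  ext1
  · simp
  · simp [smul_smul, sq]

/-- The field of Lie algebra structures on `T*M` given by a quasi-conformal structure: it is
transported from `gr(TM)` by `φ_γ`, for any metric `γ` in the class. -/
def QuasiConformalStructure.bracket {E : Subbundle n M} (c : QuasiConformalStructure E) (x : M) :
    CotangentSpace n x →ₗ[ℝ] CotangentSpace n x →ₗ[ℝ] CotangentSpace n x :=
  Quotient.lift (fun γ : Metric n M => γ.bracket E)
    (fun _ _ h => Metric.bracket_eq_of_quasiConformal E h) c x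

end Filtration

section Boundary

/-- The boundary map `Λᵏ⁺¹V* → ΛᵏV*` of Lie algebra homology for a Lie bracket `B` on the dual `V*`
of `V = ℝⁿ`, where `ΛᵏV*` is the space of alternating `k`-forms on `V`.
With `e_a` the standard basis of `V` and `eᵃ` the dual basis of `V*`, it is
`δα = ½ ∑_{a,b} B(eᵃ, eᵇ) ∧ ι_{e_b} ι_{e_a} α`; on decomposable elements this is
`δ(ξ₁ ∧ ⋯ ∧ ξₖ) = ∑_{i<j} (-1)^{i+j+1} B(ξᵢ, ξⱼ) ∧ ξ₁ ∧ ⋯ ξ̂ᵢ ⋯ ξ̂ⱼ ⋯ ∧ ξₖ`. -/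
def lieBoundary {n : ℕ}
    (B : (Model n →L[ℝ] ℝ) →ₗ[ℝ] (Model n →L[ℝ] ℝ) →ₗ[ℝ] (Model n →L[ℝ] ℝ)) :
    ∀ k : ℕ, (Model n [⋀^Fin (k + 1)]→L[ℝ] ℝ) →ₗ[ℝ] (Model n [⋀^Fin k]→L[ℝ] ℝ)
  | 0 => 0
  | k + 1 =>
    { toFun := fun α => (1 / 2 : ℝ) • ∑ a : Fin n, ∑ b : Fin n,
        ContinuousAlternatingMap.alternatizeUncurryFin
          ((B (EuclideanSpace.proj a) (EuclideanSpace.proj b)).smulRight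
            ((α.curryLeft (EuclideanSpace.single a 1)).curryLeft (EuclideanSpace.single b 1)))
      map_add' := fun α β => by
        rw [← smul_add, ← Finset.sum_add_distrib]
        refine congrArg _ (Finset.sum_congr rfl fun a _ => ?_)
        rw [← Finset.sum_add_distrib]
        refine Finset.sum_congr rfl fun b _ => ?_
        ext v
        simp [ContinuousAlternatingMap.alternatizeUncurryFin_apply, Finset.sum_add_distrib]
      map_smul' := fun t α => by
        rw [RingHom.id_apply, smul_comm t]
        congr 1
        rw [Finset.smul_sum]
        refine Finset.sum_congr rfl fun a _ => ?_
        rw [Finset.smul_sum]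
        refine Finset.sum_congr rfl fun b _ => ?_
        ext v
        simp [ContinuousAlternatingMap.alternatizeUncurryFin_apply, Finset.mul_sum,
          mul_left_comm t] }

end Boundary

section Rumin

variable {n : ℕ} {M : Type*} [TopologicalSpace M] [ChartedSpace (Model n) M]
  [IsManifold (𝓡 n) ∞ M] {E : Subbundle n M}

/-- Linear differential operators of order at most `r` between two spaces `P`, `Q` of sections, on
which smooth functions `f` act by `mP f` and `mQ f`: order `0` means linear over the smooth
functions, and `T` has order at most `r + 1` if all its commutators with smooth functions have
order at most `r`. -/
def IsDiffOpOfOrderLE {C P Q : Type*} [AddCommGroup P] [Module ℝ P] [AddCommGroup Q] [Module ℝ Q]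
    (mP : C → P →ₗ[ℝ] P) (mQ : C → Q →ₗ[ℝ] Q) : ℕ → (P →ₗ[ℝ] Q) → Prop
  | 0, T => ∀ f, T ∘ₗ mP f - mQ f ∘ₗ T = 0
  | r + 1, T => ∀ f, IsDiffOpOfOrderLE mP mQ r (T ∘ₗ mP f - mQ f ∘ₗ T)

namespace QuasiConformalStructure

variable (c : QuasiConformalStructure E)

/-- The bundle map `δ : Λᵏ⁺¹T*M → ΛᵏT*M`, at `x`: the boundary map of Lie algebra homology of the
Lie algebra `T*ₓM`. -/
def delta (k : ℕ) (x : M) : FormFiber n (k + 1) x →ₗ[ℝ] FormFiber n k x :=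
  lieBoundary (c.bracket x) k

/-- The fibre of `ker δ` in degree `k` (in degree `0`, `δ` is zero). -/
def kerDelta : ∀ (k : ℕ) (x : M), Submodule ℝ (FormFiber n k x)
  | 0, _ => ⊤
  | k + 1, x => LinearMap.ker (c.delta k x)

/-- The fibre of `im δ` in degree `k`. -/
def imDelta (k : ℕ) (x : M) : Submodule ℝ (FormFiber n k x) := LinearMap.range (c.delta k x)

/-- The bundle map `δ` has locally constant rank in each degree, i.e. `im δ` and `ker δ` are vector
subbundles of `ΛT*M`. -/
def IsRegular : Prop :=
  ∀ k : ℕ, IsLocallyConstant fun x : M => Module.finrank ℝ (c.imDelta k x)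

/-- The fibre of the bundle `ker δ / im δ` in degree `k` (as `im δ ⊆ ker δ`, the intersection in
the denominator is `im δ`). -/
abbrev HomologyFiber (k : ℕ) (x : M) : Type :=
  c.kerDelta k x ⧸ (c.imDelta k x).submoduleOf (c.kerDelta k x)

/-- The smooth sections of the bundle `ker δ / im δ` in degree `k`: the families of classes that
are locally represented by smooth forms lying in `ker δ`. (Since `M` admits smooth bump functions,
a local representative may be taken to be the restriction of a global form.) -/
def HomologySection (k : ℕ) : Submodule ℝ (∀ x : M, c.HomologyFiber k x) where
  carrier := {σ | ∀ x : M, ∃ α : Form n M k, ∀ᶠ y in nhds x,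
    ∃ h : α.1 y ∈ c.kerDelta k y, σ y = Submodule.Quotient.mk ⟨α.1 y, h⟩}
  zero_mem' := fun x => ⟨0, Filter.Eventually.of_forall fun y =>
    ⟨Submodule.zero_mem _, rfl⟩⟩
  add_mem' := fun {σ τ} hσ hτ x => by
    obtain ⟨α, hα⟩ := hσ x
    obtain ⟨β, hβ⟩ := hτ x
    refine ⟨α + β, ?_⟩
    filter_upwards [hα, hβ] with y ⟨h, hy⟩ ⟨h', hy'⟩
    refine ⟨Submodule.add_mem _ h h', ?_⟩
    rw [Pi.add_apply, hy, hy']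
    rfl
  smul_mem' := fun t {σ} hσ x => by
    obtain ⟨α, hα⟩ := hσ x
    refine ⟨t • α, ?_⟩
    filter_upwards [hα] with y ⟨h, hy⟩
    refine ⟨Submodule.smul_mem _ t h, ?_⟩
    rw [Pi.smul_apply, hy]
    rfl

/-- Multiplication of a section of `ker δ / im δ` by a smooth function. -/
def HomologySection.mul (k : ℕ) (f : C^∞⟮𝓡 n, M; ℝ⟯) :
    c.HomologySection k →ₗ[ℝ] c.HomologySection k where
  toFun σ := ⟨fun x => f x • σ.1 x, fun x => by
    obtain ⟨α, hα⟩ := σ.2 x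
    refine ⟨Form.mul k f α, ?_⟩
    filter_upwards [hα] with y ⟨h, hy⟩
    refine ⟨Submodule.smul_mem _ (f y) h, ?_⟩
    rw [hy]
    rfl⟩
  map_add' σ τ := by ext1; funext x; exact smul_add _ _ _
  map_smul' t σ := by ext1; funext x; exact smul_comm (f x) t (σ.1 x)

/-- The space `𝓔ᵏ` of smooth `k`-forms `α` with `δα = 0` and `δdα = 0`. -/
def HarmonicForm (k : ℕ) : Submodule ℝ (Form n M k) where
  carrier := {α | (∀ x, α.1 x ∈ c.kerDelta k x) ∧ ∀ x, (d k α).1 x ∈ c.kerDelta (k + 1) x}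
  zero_mem' := ⟨fun _ => Submodule.zero_mem _, fun x => by
    rw [map_zero]; exact Submodule.zero_mem _⟩
  add_mem' := fun ha hb => ⟨fun x => Submodule.add_mem _ (ha.1 x) (hb.1 x), fun x => by
    rw [map_add]; exact Submodule.add_mem _ (ha.2 x) (hb.2 x)⟩
  smul_mem' := fun t _ ha => ⟨fun x => Submodule.smul_mem _ t (ha.1 x), fun x => by
    rw [map_smul]; exact Submodule.smul_mem _ t (ha.2 x)⟩

/-- The inclusion `𝓔ᵏ → Ωᵏ`. -/
def harmonicToForm (k : ℕ) : c.HarmonicForm k →ₗ[ℝ] Form n M k :=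
  (c.HarmonicForm k).subtype

/-- The restriction `d : 𝓔ᵏ → 𝓔ᵏ⁺¹` of the exterior derivative. -/
def dHarmonic (k : ℕ) : c.HarmonicForm k →ₗ[ℝ] c.HarmonicForm (k + 1) :=
  (d k).restrict fun α hα => ⟨hα.2, fun x => by
    rw [d_d]; exact Submodule.zero_mem _⟩

theorem dHarmonic_dHarmonic (k : ℕ) (α : c.HarmonicForm k) :
    c.dHarmonic (k + 1) (c.dHarmonic k α) = 0 :=
  Subtype.ext (d_d k α.1)

/-- The complex `(𝓔, d)`. -/
def harmonicComplex : CochainComplex (ModuleCat ℝ) ℕ :=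
  CochainComplex.of (fun k => ModuleCat.of ℝ (c.HarmonicForm k))
    (fun k => ModuleCat.ofHom (c.dHarmonic k))
    (fun k => by ext α : 2; exact c.dHarmonic_dHarmonic k α)

theorem harmonicComplex_d (k : ℕ) :
    c.harmonicComplex.d k (k + 1) = ModuleCat.ofHom (c.dHarmonic k) :=
  CochainComplex.of_d (fun k => ModuleCat.of ℝ (c.HarmonicForm k))
    (fun k => ModuleCat.ofHom (c.dHarmonic k)) k

/-- The inclusion of complexes `𝓔 → Ω`. -/
def inclusion : c.harmonicComplex ⟶ deRham n M :=
  CochainComplex.ofHom (fun k => ModuleCat.ofHom (c.harmonicToForm k))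
    (fun k => by
      rw [deRham_d, harmonicComplex_d]; rfl)

/-- The map `ι` from `𝓔` to the sections of `ker δ / im δ`. -/
def iota (k : ℕ) : c.HarmonicForm k →ₗ[ℝ] c.HomologySection k where
  toFun α := ⟨fun x => Submodule.Quotient.mk ⟨α.1.1 x, α.2.1 x⟩,
    fun _ => ⟨α.1, Filter.Eventually.of_forall fun y => ⟨α.2.1 y, rfl⟩⟩⟩
  map_add' _ _ := rfl
  map_smul' _ _ := rfl

variable (hι : ∀ k, Function.Bijective (c.iota k))

/-- The map `ι` as a linear isomorphism, once it is known to be bijective. -/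
def iotaEquiv (k : ℕ) : c.HarmonicForm k ≃ₗ[ℝ] c.HomologySection k :=
  LinearEquiv.ofBijective (c.iota k) (hι k)

/-- The operator `D = ι d ι⁻¹` on sections of `ker δ / im δ`. -/
def ruminD (k : ℕ) : c.HomologySection k →ₗ[ℝ] c.HomologySection (k + 1) :=
  c.iota (k + 1) ∘ₗ c.dHarmonic k ∘ₗ (c.iotaEquiv hι k).symm.toLinearMap

theorem ruminD_ruminD (k : ℕ) : c.ruminD hι (k + 1) ∘ₗ c.ruminD hι k = 0 := by
  ext1 σ
  have h : ∀ β, (c.iotaEquiv hι (k + 1)).symm (c.iota (k + 1) β) = β := fun β =>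
    (c.iotaEquiv hι (k + 1)).symm_apply_apply β
  simp only [ruminD, LinearMap.comp_apply, LinearEquiv.coe_coe, h, dHarmonic_dHarmonic, map_zero,
    LinearMap.zero_apply]

/-- The BGG–Rumin complex `(Γ(ker δ / im δ), D)`. -/
def ruminComplex : CochainComplex (ModuleCat ℝ) ℕ :=
  CochainComplex.of (fun k => ModuleCat.of ℝ (c.HomologySection k))
    (fun k => ModuleCat.ofHom (c.ruminD hι k))
    (fun k => by ext σ : 2; exact LinearMap.congr_fun (c.ruminD_ruminD hι k) σ)

theorem ruminComplex_d (k : ℕ) :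
    (c.ruminComplex hι).d k (k + 1) = ModuleCat.ofHom (c.ruminD hι k) :=
  CochainComplex.of_d (fun k => ModuleCat.of ℝ (c.HomologySection k))
    (fun k => ModuleCat.ofHom (c.ruminD hι k)) k

/-- The morphism of complexes `ι⁻¹ : (Γ(ker δ / im δ), D) → (𝓔, d) ⊆ (Ω, d)`. -/
def ruminToDeRham : c.ruminComplex hι ⟶ deRham n M :=
  CochainComplex.ofHom
    (fun k => ModuleCat.ofHom ((c.harmonicToForm k) ∘ₗ (c.iotaEquiv hι k).symm.toLinearMap))
    (fun k => by
      rw [deRham_d, ruminComplex_d]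
      ext σ : 2
      exact (congrArg Subtype.val ((c.iotaEquiv hι (k + 1)).symm_apply_apply
        (c.dHarmonic k ((c.iotaEquiv hι k).symm σ)))).symm)

/-- Linear differential operators of order at most `r` between sections of `ker δ / im δ`. -/
def IsDiffOp {k l : ℕ} (r : ℕ) (T : c.HomologySection k →ₗ[ℝ] c.HomologySection l) : Prop :=
  IsDiffOpOfOrderLE (P := c.HomologySection k) (Q := c.HomologySection l)
    (HomologySection.mul c k) (HomologySection.mul c l) r T

end QuasiConformalStructure

end Rumin

end Heisenberg

end

/-! Fix a metric `γ` in the class. It identifies `TₓM` with `gr(TM)ₓ`, so `TₓM` carries a two-step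
nilpotent bracket (`tangentBracket`) and `ΛT*ₓM` carries its Chevalley–Eilenberg differential `d₀`
(`coboundary`, with the sign opposite to that of the bracket terms in Cartan's formula for `d`).
Everything rests on inverting `δ d` on the sections of `im δ`.

Two facts make this possible. The first is algebraic: in an orthonormal basis `δ` is, up to a
positive factor, the adjoint of `d₀` (`formInner_lieBoundary`). Hence `δ d₀` is injective on `im δ`,
so bijective there on each fibre. Give the annihilator of `E` weight 2 and all of `T*M` weight 1;
then `δ` and `d₀` preserve the resulting filtration, and so does the inverse of `δ d₀`
(`Metric.exists_boundary_coboundary_eq`). The second is geometric: since the bracket of sections of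
`E` is their Lie bracket modulo `E`, Cartan's formula shows that `d + d₀` raises weight
(`extDField_add_coboundary_mem`).

So on `im δ` one has `δ d = -δ d₀ (1 - K)` with `K` raising weight. Weights of `k`-forms are at most
`2k`, so `K` is nilpotent and a finite geometric sum inverts `δ d` by a differential operator
(`Metric.exists_laplace_inverse`). The constant rank of `δ` enters here: it makes the fibrewise
inverse of `δ d₀` smooth (`exists_contDiffAt_projection`, `contDiffAt_of_apply_eq`).

Put `Q = (δ d)⁻¹ δ` (`exists_homotopy`). It has values in `im δ`, vanishes on sections of `ker δ`,
and satisfies `δ d Q = δ` everywhere and `Q d = 1` on `im δ`. Therefore `1 - dQ - Qd` is a chain map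
onto `𝓔` that restricts to the identity on `𝓔`, and `Q` is a homotopy from it to the identity of
`Ω`; this gives (1). If `α` is a section of `ker δ`, then `α - Q d α` lies in `𝓔` and has the same
class, so `ι` is surjective; if `α ∈ 𝓔` lies in `im δ`, then `α = Q d α = 0`, so `ι` is injective.
Finally `D` sends the class of `α` to the class of `d (α - Q d α)`, hence has finite order, and
`ι⁻¹` is a quasi-isomorphism because `ι` is an isomorphism of complexes. -/

noncomputable section

namespace Heisenberg

/-! ### Exterior algebra, boundary and coboundary of a bracket on a fixed vector space, and their
naturality. -/

section PointwiseAlgebra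

variable {n : ℕ}

/-- Alternating `k`-forms on the model space. -/
abbrev AltForm (n k : ℕ) : Type := Model n [⋀^Fin k]→L[ℝ] ℝ

instance finiteDimensional_altForm (k : ℕ) : FiniteDimensional ℝ (AltForm n k) := by
  let f : AltForm n k →ₗ[ℝ] MultilinearMap ℝ (fun _ : Fin k => Model n) ℝ :=
    { toFun := fun α => α.toMultilinearMap
      map_add' := fun _ _ => rfl
      map_smul' := fun _ _ => rfl }
  refine Module.Finite.of_injective f fun α β h => ?_
  ext v
  exact congrArg (fun g : MultilinearMap ℝ (fun _ : Fin k => Model n) ℝ => g v) h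

/-- The exterior product `ξ ∧ α` of a covector and a form. -/
def wedge {k : ℕ} (ξ : Model n →L[ℝ] ℝ) (α : AltForm n k) : AltForm n (k + 1) :=
  ContinuousAlternatingMap.alternatizeUncurryFin (ξ.smulRight α)

theorem wedge_apply {k : ℕ} (ξ : Model n →L[ℝ] ℝ) (α : AltForm n k) (v : Fin (k + 1) → Model n) :
    wedge ξ α v = ∑ i : Fin (k + 1), (-1) ^ (i : ℕ) * (ξ (v i) * α (i.removeNth v)) := by
  simp [wedge, ContinuousAlternatingMap.alternatizeUncurryFin_apply]

theorem wedge_add_left {k : ℕ} (ξ η : Model n →L[ℝ] ℝ) (α : AltForm n k) :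
    wedge (ξ + η) α = wedge ξ α + wedge η α := by
  ext v; simp [wedge_apply, add_mul, mul_add, Finset.sum_add_distrib]

theorem wedge_smul_left {k : ℕ} (t : ℝ) (ξ : Model n →L[ℝ] ℝ) (α : AltForm n k) :
    wedge (t • ξ) α = t • wedge ξ α := by
  ext v; simp [wedge_apply, Finset.mul_sum, mul_assoc, mul_left_comm]

theorem wedge_add_right {k : ℕ} (ξ : Model n →L[ℝ] ℝ) (α β : AltForm n k) :
    wedge ξ (α + β) = wedge ξ α + wedge ξ β := by
  ext v; simp [wedge_apply, mul_add, Finset.sum_add_distrib]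

theorem wedge_smul_right {k : ℕ} (t : ℝ) (ξ : Model n →L[ℝ] ℝ) (α : AltForm n k) :
    wedge ξ (t • α) = t • wedge ξ α := by
  ext v; simp [wedge_apply, Finset.mul_sum, mul_left_comm]

/-- The exterior product with a covector, as a bilinear map. -/
def wedgeLM (n k : ℕ) : (Model n →L[ℝ] ℝ) →ₗ[ℝ] AltForm n k →ₗ[ℝ] AltForm n (k + 1) :=
  LinearMap.mk₂ ℝ wedge wedge_add_left wedge_smul_left wedge_add_right wedge_smul_right

theorem wedgeLM_apply {k : ℕ} (ξ : Model n →L[ℝ] ℝ) (α : AltForm n k) :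
    wedgeLM n k ξ α = wedge ξ α := rfl

/-- The interior product, as a bilinear map. -/
def contractLM (n k : ℕ) : Model n →ₗ[ℝ] AltForm n (k + 1) →ₗ[ℝ] AltForm n k :=
  LinearMap.mk₂ ℝ (fun v α => α.curryLeft v) (fun v w α => map_add _ v w)
    (fun t v α => map_smul _ t v) (fun v α β => rfl) (fun t v α => rfl)

theorem contractLM_apply {k : ℕ} (v : Model n) (α : AltForm n (k + 1)) (w : Fin k → Model n) :
    contractLM n k v α w = α (Matrix.vecCons v w) := rfl

theorem lieBoundary_apply
    (B : (Model n →L[ℝ] ℝ) →ₗ[ℝ] (Model n →L[ℝ] ℝ) →ₗ[ℝ] (Model n →L[ℝ] ℝ)) (k : ℕ)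
    (α : AltForm n (k + 2)) :
    lieBoundary B (k + 1) α = (1 / 2 : ℝ) • ∑ a : Fin n, ∑ b : Fin n,
      wedgeLM n k (B (EuclideanSpace.proj a) (EuclideanSpace.proj b))
        (contractLM n k (EuclideanSpace.single b 1)
          (contractLM n (k + 1) (EuclideanSpace.single a 1) α)) := rfl

/-- The Chevalley–Eilenberg differential, up to sign, for a bracket `b` on `V = ℝⁿ`. -/
def lieCoboundary (b : Model n →ₗ[ℝ] Model n →ₗ[ℝ] Model n) :
    ∀ k : ℕ, AltForm n k →ₗ[ℝ] AltForm n (k + 1)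
  | 0 => 0
  | k + 1 => (1 / 2 : ℝ) • ∑ i : Fin n, ∑ j : Fin n,
      wedgeLM n (k + 1) (EuclideanSpace.proj i) ∘ₗ wedgeLM n k (EuclideanSpace.proj j) ∘ₗ
        contractLM n k (b (EuclideanSpace.single i 1) (EuclideanSpace.single j 1))

theorem sum_proj_smul_single (v : Model n) :
    ∑ i, v i • (EuclideanSpace.single i 1 : Model n) = v := by
  ext j
  simp [Pi.single_apply]

theorem sum_apply_single_smul_proj (ξ : Model n →L[ℝ] ℝ) :
    ∑ i, ξ (EuclideanSpace.single i 1) • (EuclideanSpace.proj i : Model n →L[ℝ] ℝ) = ξ := by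
  ext v
  conv_rhs => rw [← sum_proj_smul_single v]
  simp [mul_comm]

/-- The canonical element of `V* ⊗ V` is invariant under linear maps. -/
theorem sum_proj_comp_mul (A : Model n →L[ℝ] Model n) (F : (Model n →L[ℝ] ℝ) →ₗ[ℝ] ℝ)
    (φ : Model n →ₗ[ℝ] ℝ) :
    ∑ i, F ((EuclideanSpace.proj i : Model n →L[ℝ] ℝ).comp A) * φ (EuclideanSpace.single i 1) =
      ∑ i, F (EuclideanSpace.proj i) * φ (A (EuclideanSpace.single i 1)) := by
  have h1 (i : Fin n) : F ((EuclideanSpace.proj i : Model n →L[ℝ] ℝ).comp A) =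
      ∑ j, A (EuclideanSpace.single j 1) i * F (EuclideanSpace.proj j) := by
    conv_lhs => rw [← sum_apply_single_smul_proj ((EuclideanSpace.proj i : Model n →L[ℝ] ℝ).comp A)]
    simp
  have h2 (i : Fin n) : φ (A (EuclideanSpace.single i 1)) =
      ∑ j, A (EuclideanSpace.single i 1) j * φ (EuclideanSpace.single j 1) := by
    conv_lhs => rw [← sum_proj_smul_single (A (EuclideanSpace.single i 1))]
    simp
  simp only [h1, h2, Finset.sum_mul, Finset.mul_sum]
  rw [Finset.sum_comm]
  refine Finset.sum_congr rfl fun i _ => Finset.sum_congr rfl fun j _ => by ring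

variable (B : (Model n →L[ℝ] ℝ) →ₗ[ℝ] (Model n →L[ℝ] ℝ) →ₗ[ℝ] (Model n →L[ℝ] ℝ))
  (b : Model n →ₗ[ℝ] Model n →ₗ[ℝ] Model n)

theorem lieBoundary_apply_apply (k : ℕ) (α : AltForm n (k + 2)) (v : Fin (k + 1) → Model n) :
    lieBoundary B (k + 1) α v = 1 / 2 * ∑ l : Fin (k + 1), (-1) ^ (l : ℕ) * ∑ i : Fin n, ∑ j : Fin n,
      (B (EuclideanSpace.proj i) (EuclideanSpace.proj j) (v l) *
        α (Matrix.vecCons (EuclideanSpace.single i 1)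
          (Matrix.vecCons (EuclideanSpace.single j 1) (l.removeNth v)))) := by
  rw [lieBoundary_apply]
  simp only [ContinuousAlternatingMap.smul_apply, ContinuousAlternatingMap.sum_apply,
    wedgeLM_apply, wedge_apply, contractLM_apply, smul_eq_mul]
  congr 1
  simp only [Finset.mul_sum]
  rw [Finset.sum_congr rfl fun i _ => Finset.sum_comm, Finset.sum_comm]

/-- By bilinearity the sums over the basis collapse to brackets of the entries of `v`. This form is
free of bases, so naturality under isomorphisms can be read off from it. -/
theorem lieCoboundary_apply_apply (k : ℕ) (α : AltForm n (k + 1)) (v : Fin (k + 2) → Model n) :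
    lieCoboundary b (k + 1) α v = 1 / 2 * ∑ l : Fin (k + 2), ∑ m : Fin (k + 1),
      (-1) ^ (l + m : ℕ) * α (Matrix.vecCons (b (v l) (v (l.succAbove m)))
        (m.removeNth (l.removeNth v))) := by
  simp only [lieCoboundary, LinearMap.smul_apply, LinearMap.sum_apply, LinearMap.comp_apply,
    ContinuousAlternatingMap.smul_apply, ContinuousAlternatingMap.sum_apply,
    wedgeLM_apply, wedge_apply, contractLM_apply, smul_eq_mul]
  congr 1
  simp only [Finset.mul_sum]
  rw [Finset.sum_congr rfl fun i _ => Finset.sum_comm, Finset.sum_comm]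
  refine Finset.sum_congr rfl fun l _ => ?_
  rw [Finset.sum_congr rfl fun i _ => Finset.sum_comm, Finset.sum_comm]
  refine Finset.sum_congr rfl fun m _ => ?_
  have h : α (Matrix.vecCons (b (v l) (v (l.succAbove m))) (m.removeNth (l.removeNth v))) =
      ∑ i, ∑ j, v l i * (v (l.succAbove m) j * α (Matrix.vecCons
        (b (EuclideanSpace.single i 1) (EuclideanSpace.single j 1))
        (m.removeNth (l.removeNth v)))) := by
    conv_lhs => rw [← sum_proj_smul_single (v l), ← sum_proj_smul_single (v (l.succAbove m)),
      ← contractLM_apply]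
    simp only [map_sum, map_smul, LinearMap.sum_apply, LinearMap.smul_apply,
      ContinuousAlternatingMap.sum_apply, ContinuousAlternatingMap.smul_apply, smul_eq_mul,
      contractLM_apply, Finset.mul_sum]
    rw [Finset.sum_comm]
    refine Finset.sum_congr rfl fun i _ => Finset.sum_congr rfl fun j _ => by ring
  rw [h, Finset.mul_sum]
  refine Finset.sum_congr rfl fun i _ => ?_
  rw [Finset.mul_sum]
  refine Finset.sum_congr rfl fun j _ => ?_
  have hp (i : Fin n) (u : Model n) : (EuclideanSpace.proj i : Model n →L[ℝ] ℝ) u = u i := rfl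
  simp only [hp, pow_add, Fin.removeNth]
  ring

/-- For fixed `l` and `v`, the double sum in `lieBoundary_apply_apply` may be computed after
applying a linear map to the covectors instead of the vectors. -/
theorem sum_sum_comp_mul {k : ℕ} (A : Model n →L[ℝ] Model n) (α : AltForm n (k + 2))
    (u : Model n) (w : Fin k → Model n) :
    ∑ i : Fin n, ∑ j : Fin n,
      B ((EuclideanSpace.proj i : Model n →L[ℝ] ℝ).comp A)
        ((EuclideanSpace.proj j : Model n →L[ℝ] ℝ).comp A) u *
        α (Matrix.vecCons (EuclideanSpace.single i 1)
          (Matrix.vecCons (EuclideanSpace.single j 1) w)) =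
    ∑ i : Fin n, ∑ j : Fin n, B (EuclideanSpace.proj i) (EuclideanSpace.proj j) u *
        α (Matrix.vecCons (A (EuclideanSpace.single i 1))
          (Matrix.vecCons (A (EuclideanSpace.single j 1)) w)) := by
  let ev : (Model n →L[ℝ] ℝ) →ₗ[ℝ] ℝ :=
    { toFun := fun ξ => ξ u, map_add' := fun _ _ => rfl, map_smul' := fun _ _ => rfl }
  let evA : AltForm n k →ₗ[ℝ] ℝ :=
    { toFun := fun ξ => ξ w, map_add' := fun _ _ => rfl, map_smul' := fun _ _ => rfl }
  have h1 (i : Fin n) := sum_proj_comp_mul A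
    (ev ∘ₗ B ((EuclideanSpace.proj i : Model n →L[ℝ] ℝ).comp A))
    (evA ∘ₗ (contractLM n k).flip (contractLM n (k + 1) (EuclideanSpace.single i 1) α))
  have h2 (j : Fin n) := sum_proj_comp_mul A (ev ∘ₗ B.flip (EuclideanSpace.proj j))
    (evA ∘ₗ contractLM n k (A (EuclideanSpace.single j 1)) ∘ₗ (contractLM n (k + 1)).flip α)
  refine (Finset.sum_congr rfl fun i _ => h1 i).trans (Finset.sum_comm.trans ?_)
  exact (Finset.sum_congr rfl fun j _ => h2 j).trans Finset.sum_comm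

/-- The bracket on `V*` transported by `A : V ≃ V`. -/
def transportDual (A : Model n ≃L[ℝ] Model n) :
    (Model n →L[ℝ] ℝ) →ₗ[ℝ] (Model n →L[ℝ] ℝ) →ₗ[ℝ] (Model n →L[ℝ] ℝ) :=
  LinearMap.mk₂ ℝ (fun ξ η => (B (ξ.comp (A.symm : Model n →L[ℝ] Model n))
      (η.comp (A.symm : Model n →L[ℝ] Model n))).comp (A : Model n →L[ℝ] Model n))
    (fun ξ ξ' η => by simp [ContinuousLinearMap.add_comp])
    (fun t ξ η => by simp [ContinuousLinearMap.smul_comp])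
    (fun ξ η η' => by simp [ContinuousLinearMap.add_comp])
    (fun t ξ η => by simp [ContinuousLinearMap.smul_comp])

theorem transportDual_apply (A : Model n ≃L[ℝ] Model n) (ξ η : Model n →L[ℝ] ℝ) (v : Model n) :
    transportDual B A ξ η v = B (ξ.comp (A.symm : Model n →L[ℝ] Model n))
      (η.comp (A.symm : Model n →L[ℝ] Model n)) (A v) := rfl

/-- The bracket on `V` transported by `A : V ≃ V`. -/
def transport (A : Model n ≃L[ℝ] Model n) : Model n →ₗ[ℝ] Model n →ₗ[ℝ] Model n :=
  LinearMap.mk₂ ℝ (fun u v => A.symm (b (A u) (A v)))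
    (fun u u' v => by simp) (fun t u v => by simp) (fun u v v' => by simp) (fun t u v => by simp)

theorem transport_apply (A : Model n ≃L[ℝ] Model n) (u v : Model n) :
    transport b A u v = A.symm (b (A u) (A v)) := rfl

theorem removeNth_comp {X Y : Type*} (f : X → Y) {k : ℕ} (l : Fin (k + 1)) (v : Fin (k + 1) → X) :
    l.removeNth (f ∘ v) = f ∘ l.removeNth v := rfl

theorem vecCons_comp {X Y : Type*} (f : X → Y) {k : ℕ} (x : X) (v : Fin k → X) :
    f ∘ Matrix.vecCons x v = Matrix.vecCons (f x) (f ∘ v) := by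
  funext i; refine Fin.cases ?_ (fun j => ?_) i <;> simp

/-- The definition of `δ` involves the standard basis only through the canonical element of `V* ⊗
V`, which is invariant under linear maps; here the invariance is applied to `A⁻¹`. -/
theorem lieBoundary_compContinuousLinearMap (A : Model n ≃L[ℝ] Model n) (k : ℕ)
    (α : AltForm n (k + 1)) :
    (lieBoundary B k α).compContinuousLinearMap (A : Model n →L[ℝ] Model n) =
      lieBoundary (transportDual B A) k
        (α.compContinuousLinearMap (A : Model n →L[ℝ] Model n)) := by
  cases k with
  | zero => rfl
  | succ k =>
    ext v
    rw [ContinuousAlternatingMap.compContinuousLinearMap_apply, lieBoundary_apply_apply,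
      lieBoundary_apply_apply]
    congr 1
    refine Finset.sum_congr rfl fun l _ => ?_
    congr 1
    simp only [transportDual_apply, ContinuousAlternatingMap.compContinuousLinearMap_apply,
      vecCons_comp]
    have := sum_sum_comp_mul B (A.symm : Model n →L[ℝ] Model n)
      (α.compContinuousLinearMap (A : Model n →L[ℝ] Model n)) (A (v l)) (l.removeNth v)
    simp only [ContinuousAlternatingMap.compContinuousLinearMap_apply, vecCons_comp,
      ContinuousLinearEquiv.coe_coe, ContinuousLinearEquiv.apply_symm_apply] at this
    exact this.symm

theorem lieCoboundary_compContinuousLinearMap (A : Model n ≃L[ℝ] Model n) (k : ℕ)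
    (α : AltForm n k) :
    (lieCoboundary b k α).compContinuousLinearMap (A : Model n →L[ℝ] Model n) =
      lieCoboundary (transport b A) k
        (α.compContinuousLinearMap (A : Model n →L[ℝ] Model n)) := by
  cases k with
  | zero => rfl
  | succ k =>
    ext v
    rw [ContinuousAlternatingMap.compContinuousLinearMap_apply, lieCoboundary_apply_apply,
      lieCoboundary_apply_apply]
    simp only [transport_apply, ContinuousAlternatingMap.compContinuousLinearMap_apply,
      vecCons_comp, ContinuousLinearEquiv.coe_coe, ContinuousLinearEquiv.apply_symm_apply,
      Function.comp_apply, removeNth_comp]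

end PointwiseAlgebra

/-! ### Two-step nilpotent brackets on a Euclidean space: `δ² = 0`, weights, and adjointness of `δ`
and `d₀`. -/

section PointwiseHeisenberg

variable {n : ℕ}

/-- The twofold alternatization of something symmetric in its first two arguments vanishes. -/
theorem wedge_wedge_self {k : ℕ} (ξ : Model n →L[ℝ] ℝ) (α : AltForm n k) :
    wedge ξ (wedge ξ α) = 0 := by
  have h := ContinuousAlternatingMap.alternatizeUncurryFin_alternatizeUncurryFinCLM_comp_of_symmetric
    (f := ξ.smulRight (ξ.smulRight α)) (fun x y => by
      ext v; simp [mul_left_comm])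
  rw [← h]
  ext v
  rw [wedge_apply, ContinuousAlternatingMap.alternatizeUncurryFin_apply]
  refine Finset.sum_congr rfl fun i _ => ?_
  simp [wedge]

theorem wedge_wedge_swap {k : ℕ} (ξ η : Model n →L[ℝ] ℝ) (α : AltForm n k) :
    wedge ξ (wedge η α) = -wedge η (wedge ξ α) := by
  have h := wedge_wedge_self (ξ + η) α
  rw [wedge_add_left, wedge_add_left, wedge_add_right, wedge_add_right, wedge_wedge_self,
    wedge_wedge_self, zero_add, add_zero] at h
  exact eq_neg_of_add_eq_zero_left h

theorem contract_contract_self {k : ℕ} (v : Model n) (α : AltForm n (k + 2)) :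
    contractLM n k v (contractLM n (k + 1) v α) = 0 :=
  ContinuousAlternatingMap.curryLeft_same α v

theorem contract_contract_swap {k : ℕ} (u v : Model n) (α : AltForm n (k + 2)) :
    contractLM n k u (contractLM n (k + 1) v α) = -contractLM n k v (contractLM n (k + 1) u α) := by
  have h := contract_contract_self (u + v) α
  simp only [map_add, LinearMap.add_apply, contract_contract_self, zero_add, add_zero] at h
  exact eq_neg_of_add_eq_zero_left ((add_comm _ _).trans h)

theorem contract_wedge {k : ℕ} (v : Model n) (ξ : Model n →L[ℝ] ℝ) (α : AltForm n (k + 1)) :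
    contractLM n (k + 1) v (wedge ξ α) = ξ v • α - wedge ξ (contractLM n k v α) := by
  ext w
  rw [contractLM_apply, wedge_apply, Fin.sum_univ_succ, ContinuousAlternatingMap.sub_apply,
    wedge_apply, sub_eq_add_neg, ← Finset.sum_neg_distrib]
  congr 1
  · simp
  · refine Finset.sum_congr rfl fun i _ => ?_
    have : i.succ.removeNth (Matrix.vecCons v w) = Matrix.vecCons v (i.removeNth w) := by
      funext j
      refine Fin.cases ?_ (fun j => ?_) j <;> simp [Fin.removeNth]
    rw [this, contractLM_apply, Fin.val_succ, pow_succ, Matrix.cons_val_succ]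
    ring

theorem contract_contract_wedge {k : ℕ} (u v : Model n) (ξ : Model n →L[ℝ] ℝ)
    (α : AltForm n (k + 2)) :
    contractLM n (k + 1) u (contractLM n (k + 2) v (wedge ξ α)) =
      ξ v • contractLM n (k + 1) u α - ξ u • contractLM n (k + 1) v α +
        wedge ξ (contractLM n k u (contractLM n (k + 1) v α)) := by
  rw [contract_wedge, map_sub, map_smul, contract_wedge]
  abel

/-- Brackets on `V*` that vanish on the annihilator of `E` and have values in it. -/
structure IsAnnihilatorBracket (E : Submodule ℝ (Model n))
    (B : (Model n →L[ℝ] ℝ) →ₗ[ℝ] (Model n →L[ℝ] ℝ) →ₗ[ℝ] (Model n →L[ℝ] ℝ)) : Prop where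
  apply_mem : ∀ ξ η, ∀ e ∈ E, B ξ η e = 0
  left : ∀ ξ η, (∀ e ∈ E, ξ e = 0) → B ξ η = 0
  right : ∀ ξ η, (∀ e ∈ E, η e = 0) → B ξ η = 0

variable {E : Submodule ℝ (Model n)}
  {B : (Model n →L[ℝ] ℝ) →ₗ[ℝ] (Model n →L[ℝ] ℝ) →ₗ[ℝ] (Model n →L[ℝ] ℝ)}

theorem contract_wedge_zero (v : Model n) (ξ : Model n →L[ℝ] ℝ) (α : AltForm n 0) :
    contractLM n 0 v (wedge ξ α) = ξ v • α := by
  ext w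
  rw [contractLM_apply, wedge_apply, Fin.sum_univ_one,
    Subsingleton.elim ((0 : Fin 1).removeNth (Matrix.vecCons v w)) w]
  simp

/-- The sum over `i` reassembles `ξ` inside the bracket, and the annihilator of `E` is central. In
`δ²` this removes the terms where one contraction hits an earlier bracket. -/
theorem IsAnnihilatorBracket.sum_sum_left (hB : IsAnnihilatorBracket E B) {k : ℕ}
    {ξ : Model n →L[ℝ] ℝ} (hξ : ∀ e ∈ E, ξ e = 0) (β : Fin n → AltForm n k) :
    ∑ i, ∑ j, ξ (EuclideanSpace.single i 1) •
      wedgeLM n k (B (EuclideanSpace.proj i) (EuclideanSpace.proj j)) (β j) = 0 := by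
  rw [Finset.sum_comm]
  refine Finset.sum_eq_zero fun j _ => ?_
  have h : ∑ i, ξ (EuclideanSpace.single i 1) •
      wedgeLM n k (B (EuclideanSpace.proj i) (EuclideanSpace.proj j)) (β j) =
      wedgeLM n k (B (∑ i, ξ (EuclideanSpace.single i 1) • EuclideanSpace.proj i)
        (EuclideanSpace.proj j)) (β j) := by
    simp only [map_sum, map_smul, LinearMap.sum_apply, LinearMap.smul_apply]
  rw [h, sum_apply_single_smul_proj, hB.left ξ _ hξ, map_zero, LinearMap.zero_apply]

theorem IsAnnihilatorBracket.sum_sum_right (hB : IsAnnihilatorBracket E B) {k : ℕ}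
    {ξ : Model n →L[ℝ] ℝ} (hξ : ∀ e ∈ E, ξ e = 0) (β : Fin n → AltForm n k) :
    ∑ i, ∑ j, ξ (EuclideanSpace.single j 1) •
      wedgeLM n k (B (EuclideanSpace.proj i) (EuclideanSpace.proj j)) (β i) = 0 := by
  refine Finset.sum_eq_zero fun i _ => ?_
  have h : ∑ j, ξ (EuclideanSpace.single j 1) •
      wedgeLM n k (B (EuclideanSpace.proj i) (EuclideanSpace.proj j)) (β i) =
      wedgeLM n k (B (EuclideanSpace.proj i)
        (∑ j, ξ (EuclideanSpace.single j 1) • EuclideanSpace.proj j)) (β i) := by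
    simp only [map_sum, map_smul, LinearMap.sum_apply, LinearMap.smul_apply]
  rw [h, sum_apply_single_smul_proj, hB.right _ ξ hξ, map_zero, LinearMap.zero_apply]

/-- The boundary map of a two-step nilpotent Lie algebra has square zero. -/
theorem IsAnnihilatorBracket.lieBoundary_lieBoundary (hB : IsAnnihilatorBracket E B) (k : ℕ)
    (α : AltForm n (k + 2)) : lieBoundary B k (lieBoundary B (k + 1) α) = 0 := by
  obtain _ | k := k
  · rfl
  have key : ∑ i : Fin n, ∑ j : Fin n, ∑ p : Fin n, ∑ q : Fin n,
      wedgeLM n k (B (EuclideanSpace.proj p) (EuclideanSpace.proj q))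
        (contractLM n k (EuclideanSpace.single q 1) (contractLM n (k + 1)
          (EuclideanSpace.single p 1) (wedgeLM n (k + 1)
            (B (EuclideanSpace.proj i) (EuclideanSpace.proj j))
            (contractLM n (k + 1) (EuclideanSpace.single j 1)
              (contractLM n (k + 2) (EuclideanSpace.single i 1) α))))) = 0 := by
    obtain _ | k := k
    -- When `α` has degree 3, one of the two contractions always hits `B(eⁱ, eʲ)`, so only terms
    -- that vanish by centrality occur.
    · refine Finset.sum_eq_zero fun i _ => Finset.sum_eq_zero fun j _ => ?_
      simp only [wedgeLM_apply, contract_wedge, map_sub, map_smul, contract_wedge_zero]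
      simp only [← wedgeLM_apply, Finset.sum_sub_distrib]
      rw [hB.sum_sum_left (hB.apply_mem _ _) (fun q => contractLM n 0 (EuclideanSpace.single q 1)
          (contractLM n 1 (EuclideanSpace.single j 1)
            (contractLM n 2 (EuclideanSpace.single i 1) α))),
        hB.sum_sum_right (hB.apply_mem _ _) (fun q => contractLM n 0 (EuclideanSpace.single q 1)
          (contractLM n 1 (EuclideanSpace.single j 1)
            (contractLM n 2 (EuclideanSpace.single i 1) α))), sub_zero]
    · let X (i j p q : Fin n) : AltForm n (k + 2) :=
        wedge (B (EuclideanSpace.proj p) (EuclideanSpace.proj q))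
          (wedge (B (EuclideanSpace.proj i) (EuclideanSpace.proj j))
            (contractLM n k (EuclideanSpace.single q 1) (contractLM n (k + 1)
              (EuclideanSpace.single p 1) (contractLM n (k + 2) (EuclideanSpace.single j 1)
                (contractLM n (k + 3) (EuclideanSpace.single i 1) α)))))
      -- Exchanging the pairs `(i, j)` and `(p, q)` swaps two covectors, with sign `-1`, and moves
      -- two contractions past two others, with sign `+1`. The sum over all indices is therefore its
      -- own negative.
      have hX (i j p q : Fin n) : X i j p q = -X p q i j := by
        simp only [X]
        rw [wedge_wedge_swap]
        congr 3
        rw [contract_contract_swap (EuclideanSpace.single p 1), map_neg,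
          contract_contract_swap (EuclideanSpace.single q 1), neg_neg,
          contract_contract_swap (EuclideanSpace.single p 1) (EuclideanSpace.single i 1)]
        simp only [map_neg]
        rw [contract_contract_swap (EuclideanSpace.single q 1) (EuclideanSpace.single i 1)]
        simp only [map_neg, neg_neg]
      have h1 (i j : Fin n) : ∑ p : Fin n, ∑ q : Fin n,
          wedgeLM n (k + 1) (B (EuclideanSpace.proj p) (EuclideanSpace.proj q))
            (contractLM n (k + 1) (EuclideanSpace.single q 1) (contractLM n (k + 2)
              (EuclideanSpace.single p 1) (wedgeLM n (k + 2)
                (B (EuclideanSpace.proj i) (EuclideanSpace.proj j))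
                (contractLM n (k + 2) (EuclideanSpace.single j 1)
                  (contractLM n (k + 3) (EuclideanSpace.single i 1) α))))) =
          ∑ p, ∑ q, X i j p q := by
        simp only [wedgeLM_apply, contract_contract_wedge]
        simp only [← wedgeLM_apply, map_add, map_sub, map_smul, Finset.sum_sub_distrib,
          Finset.sum_add_distrib]
        rw [hB.sum_sum_left (hB.apply_mem _ _) (fun q => contractLM n (k + 1)
            (EuclideanSpace.single q 1) (contractLM n (k + 2) (EuclideanSpace.single j 1)
              (contractLM n (k + 3) (EuclideanSpace.single i 1) α))),
          hB.sum_sum_right (hB.apply_mem _ _) (fun q => contractLM n (k + 1)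
            (EuclideanSpace.single q 1) (contractLM n (k + 2) (EuclideanSpace.single j 1)
              (contractLM n (k + 3) (EuclideanSpace.single i 1) α))), sub_zero, zero_add]
        rfl
      simp only [h1]
      have h2 : ∑ i, ∑ j, ∑ p, ∑ q, X i j p q = -∑ i, ∑ j, ∑ p, ∑ q, X i j p q := by
        have h3 : ∑ i, ∑ j, ∑ p, ∑ q, X i j p q = ∑ i, ∑ j, ∑ p, ∑ q, X p q i j := by
          simp only [← Fintype.sum_prod_type']
          have := Finset.sum_comm (s := (Finset.univ : Finset (Fin n × Fin n)))
            (t := (Finset.univ : Finset (Fin n × Fin n)))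
            (f := fun x y => X x.1 x.2 y.1 y.2)
          simp only [Fintype.sum_prod_type] at this ⊢
          exact this
        conv_lhs => rw [h3]
        simp only [← Finset.sum_neg_distrib]
        refine Finset.sum_congr rfl fun i _ => Finset.sum_congr rfl fun j _ =>
          Finset.sum_congr rfl fun p _ => Finset.sum_congr rfl fun q _ => hX _ _ _ _
      rw [eq_neg_iff_add_eq_zero, ← two_smul ℝ] at h2
      exact (smul_eq_zero.1 h2).resolve_left two_ne_zero
  rw [lieBoundary_apply B k, lieBoundary_apply B (k + 1)]
  simp only [map_smul, map_sum, ← Finset.smul_sum]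
  refine (congrArg _ (congrArg _ ?_)).trans ((congrArg _ (smul_zero _)).trans (smul_zero _))
  rw [← key]
  rw [Finset.sum_congr rfl fun p _ => Finset.sum_comm, Finset.sum_comm]
  refine Finset.sum_congr rfl fun i _ => ?_
  rw [Finset.sum_congr rfl fun p _ => Finset.sum_comm, Finset.sum_comm]

/-- The number of entries of `v` that lie in `E`. -/
def countIn (E : Submodule ℝ (Model n)) {k : ℕ} (v : Fin k → Model n) : ℕ :=
  open Classical in ∑ i, if v i ∈ E then 1 else 0

theorem countIn_vecCons (E : Submodule ℝ (Model n)) {k : ℕ} (x : Model n) (v : Fin k → Model n) :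
    countIn E (Matrix.vecCons x v) = (open Classical in if x ∈ E then 1 else 0) + countIn E v := by
  rw [countIn, Fin.sum_univ_succ]; rfl

theorem countIn_removeNth (E : Submodule ℝ (Model n)) {k : ℕ} (l : Fin (k + 1))
    (v : Fin (k + 1) → Model n) :
    countIn E v = (open Classical in if v l ∈ E then 1 else 0) + countIn E (l.removeNth v) := by
  rw [countIn, Fin.sum_univ_succAbove _ l]; rfl

theorem countIn_le (E : Submodule ℝ (Model n)) {k : ℕ} (v : Fin k → Model n) :
    countIn E v ≤ k := by
  classical
  refine (Finset.sum_le_card_nsmul _ _ 1 fun i _ => ?_).trans (by simp)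
  split_ifs <;> simp

/-- The filtration of `ΛᵏV*` by weight, where the annihilator of `E` has weight `2` and `V*` has
weight `1`. -/
def weightFiltration (E : Submodule ℝ (Model n)) (w k : ℕ) : Submodule ℝ (AltForm n k) where
  carrier := {α | ∀ v, 2 * k < countIn E v + w → α v = 0}
  zero_mem' := fun _ _ => rfl
  add_mem' := fun ha hb v hv => by simp [ha v hv, hb v hv]
  smul_mem' := fun t α ha v hv => by simp [ha v hv]

theorem mem_weightFiltration_zero {k : ℕ} (α : AltForm n k) : α ∈ weightFiltration E 0 k := by
  intro v hv
  have := countIn_le E v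
  rcases k with _ | k <;> omega

theorem eq_zero_of_mem_weightFiltration {w k : ℕ} {α : AltForm n k}
    (hα : α ∈ weightFiltration E w k) (hw : 2 * k < w) : α = 0 := by
  ext v; exact hα v (by omega)

/-- A bracket depends only on restrictions to `E`, so covectors may be composed with a projection
`P` onto `E`. By invariance `P` moves to the vectors, and `α` is evaluated with two new entries in
`E`. A term with `v l ∈ E` vanishes because brackets annihilate `E`; in the others the two new
entries exactly offset the change of degree. -/
theorem IsAnnihilatorBracket.lieBoundary_mem (hB : IsAnnihilatorBracket E B) {w k : ℕ}
    {α : AltForm n (k + 1)} (hα : α ∈ weightFiltration E w (k + 1)) :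
    lieBoundary B k α ∈ weightFiltration E w k := by
  obtain _ | k := k
  · exact Submodule.zero_mem _
  intro v hv
  rw [lieBoundary_apply_apply]
  refine (congrArg _ (Finset.sum_eq_zero fun l _ => ?_)).trans (mul_zero _)
  refine (congrArg _ ?_).trans (mul_zero _)
  obtain ⟨F, hF⟩ := E.exists_isCompl
  let P : Model n →L[ℝ] Model n := LinearMap.toContinuousLinearMap (E.projection F hF)
  have hPE (u) : P u ∈ E := Submodule.projection_apply_mem hF u
  have hP (e) (he : e ∈ E) : P e = e := (Submodule.projection_eq_self_iff hF e).2 he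
  have hBP (ξ η : Model n →L[ℝ] ℝ) : B (ξ.comp P) (η.comp P) = B ξ η := by
    have h1 : B (ξ - ξ.comp P) (η.comp P) = 0 := hB.left _ _ fun e he => by simp [hP e he]
    have h2 : B ξ (η - η.comp P) = 0 := hB.right _ _ fun e he => by simp [hP e he]
    rw [map_sub, LinearMap.sub_apply, sub_eq_zero] at h1
    rw [map_sub, sub_eq_zero] at h2
    rw [h2, h1]
  have h := sum_sum_comp_mul B P α (v l) (l.removeNth v)
  simp only [hBP] at h
  rw [h]
  refine Finset.sum_eq_zero fun i _ => Finset.sum_eq_zero fun j _ => ?_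
  by_cases hl : v l ∈ E
  · rw [hB.apply_mem _ _ _ hl, zero_mul]
  · rw [hα, mul_zero]
    rw [countIn_vecCons, countIn_vecCons, if_pos (hPE _), if_pos (hPE _)]
    rw [countIn_removeNth E l, if_neg hl] at hv
    omega

/-- Removing two entries of `v` lowers `countIn` by at most two, which is what one degree
contributes to `2 * k`. Every bracket has this property: any 2-form has weight at least 2. -/
theorem lieCoboundary_mem (b : Model n →ₗ[ℝ] Model n →ₗ[ℝ] Model n) {w k : ℕ}
    {α : AltForm n k} (hα : α ∈ weightFiltration E w k) :
    lieCoboundary b k α ∈ weightFiltration E w (k + 1) := by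
  obtain _ | k := k
  · exact Submodule.zero_mem _
  intro v hv
  rw [lieCoboundary_apply_apply]
  refine (congrArg _ (Finset.sum_eq_zero fun l _ => ?_)).trans (mul_zero _)
  refine Finset.sum_eq_zero fun m _ => ?_
  rw [hα, mul_zero]
  rw [countIn_vecCons]
  rw [countIn_removeNth E l, countIn_removeNth E m] at hv
  split_ifs at hv <;> omega

/-- The inner product on `k`-forms, up to a factor, for which the standard basis is orthonormal. -/
def formInner (n k : ℕ) : AltForm n k →ₗ[ℝ] AltForm n k →ₗ[ℝ] ℝ :=
  LinearMap.mk₂ ℝ (fun α β => ∑ f : Fin k → Fin n,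
      α (fun i => EuclideanSpace.single (f i) 1) * β (fun i => EuclideanSpace.single (f i) 1))
    (fun α α' β => by simp [add_mul, Finset.sum_add_distrib])
    (fun t α β => by simp [Finset.mul_sum, mul_assoc])
    (fun α β β' => by simp [mul_add, Finset.sum_add_distrib])
    (fun t α β => by simp [Finset.mul_sum, mul_left_comm])

theorem formInner_apply {k : ℕ} (α β : AltForm n k) :
    formInner n k α β = ∑ f : Fin k → Fin n,
      α (fun i => EuclideanSpace.single (f i) 1) * β (fun i => EuclideanSpace.single (f i) 1) := rfl

theorem formInner_comm {k : ℕ} (α β : AltForm n k) : formInner n k α β = formInner n k β α := by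
  simp only [formInner_apply, mul_comm]

theorem eq_zero_of_formInner_self {k : ℕ} {α : AltForm n k} (h : formInner n k α α = 0) :
    α = 0 := by
  rw [formInner_apply, Finset.sum_eq_zero_iff_of_nonneg fun f _ => mul_self_nonneg _] at h
  have h1 : α.toAlternatingMap = 0 := by
    refine Module.Basis.ext_alternating (EuclideanSpace.basisFun (Fin n) ℝ).toBasis fun f _ => ?_
    have := h f (Finset.mem_univ _)
    simpa using this
  ext v
  exact congrArg (fun g : Model n [⋀^Fin k]→ₗ[ℝ] ℝ => g v) h1

/-- The exterior product with a covector is adjoint to contraction with the dual vector. Each of the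
`k + 1` summands of the product contributes equally, which gives the factor. -/
theorem formInner_wedge {k : ℕ} {ξ : Model n →L[ℝ] ℝ} {u : Model n}
    (h : ∀ i, ξ (EuclideanSpace.single i 1) = u i) (α : AltForm n k) (β : AltForm n (k + 1)) :
    formInner n (k + 1) (wedge ξ α) β = (k + 1) * formInner n k α (contractLM n k u β) := by
  have h1 (l : Fin (k + 1)) : ∑ f : Fin (k + 1) → Fin n,
      (-1) ^ (l : ℕ) * (ξ (EuclideanSpace.single (f l) 1) *
        α (l.removeNth fun i => EuclideanSpace.single (f i) 1)) *
        β (fun i => EuclideanSpace.single (f i) 1) =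
      formInner n k α (contractLM n k u β) := by
    -- Split off the `l`-th index of `f`. Moving that entry of `β` to the front costs `(-1)^l`,
    -- which cancels the sign in the exterior product.
    rw [← (Fin.insertNthEquiv (fun _ => Fin n) l).sum_comp, Fintype.sum_prod_type_right,
      formInner_apply]
    refine Finset.sum_congr rfl fun g _ => ?_
    have hu : contractLM n k u β (fun i => EuclideanSpace.single (g i) 1) =
        ∑ i, u i * β (Matrix.vecCons (EuclideanSpace.single i 1)
          (fun i => EuclideanSpace.single (g i) 1)) := by
      conv_lhs => rw [← sum_proj_smul_single u]
      simp only [map_sum, map_smul, LinearMap.sum_apply, LinearMap.smul_apply,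
        ContinuousAlternatingMap.sum_apply, ContinuousAlternatingMap.smul_apply, smul_eq_mul,
        contractLM_apply]
    rw [hu, Finset.mul_sum]
    refine Finset.sum_congr rfl fun i _ => ?_
    have h2 : (fun j => EuclideanSpace.single (Fin.insertNthEquiv (fun _ => Fin n) l (i, g) j) 1 :
        Fin (k + 1) → Model n) =
        l.insertNth (EuclideanSpace.single i 1) (fun j => EuclideanSpace.single (g j) 1) := by
      funext j
      refine Fin.succAboveCases l ?_ (fun j => ?_) j <;> simp
    rw [h2, ContinuousAlternatingMap.map_insertNth, Fin.removeNth_insertNth]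
    simp only [Fin.insertNthEquiv_apply, Fin.insertNth_apply_same, h]
    have h3 : ((-1 : ℝ) ^ (l : ℕ)) * (-1) ^ (l : ℕ) = 1 := by
      rw [← mul_pow]; simp
    linear_combination (u i * α (fun j => EuclideanSpace.single (g j) 1) *
      β (Matrix.vecCons (EuclideanSpace.single i 1)
        (fun i => EuclideanSpace.single (g i) 1))) * h3
  rw [formInner_apply]
  simp only [wedge_apply, Finset.sum_mul]
  rw [Finset.sum_comm, Finset.sum_congr rfl fun l _ => h1 l]
  simp

theorem formInner_contract {k : ℕ} (i : Fin n) (α : AltForm n (k + 1)) (β : AltForm n k) :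
    (k + 1) * formInner n k (contractLM n k (EuclideanSpace.single i 1) α) β =
      formInner n (k + 1) α (wedge (EuclideanSpace.proj i) β) := by
  rw [formInner_comm α, formInner_wedge (u := EuclideanSpace.single i 1), formInner_comm β]
  intro j
  simp [eq_comm]

/-- In an orthonormal basis the boundary map is the adjoint of the Chevalley–Eilenberg
differential. -/
theorem formInner_lieBoundary {b : Model n →ₗ[ℝ] Model n →ₗ[ℝ] Model n}
    (h : ∀ i j l, B (EuclideanSpace.proj i) (EuclideanSpace.proj j) (EuclideanSpace.single l 1) =
      b (EuclideanSpace.single i 1) (EuclideanSpace.single j 1) l)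
    (k : ℕ) (α : AltForm n (k + 1)) (β : AltForm n k) :
    (k + 1) * formInner n k (lieBoundary B k α) β =
      formInner n (k + 1) α (lieCoboundary b k β) := by
  obtain _ | k := k
  · simp [lieBoundary, lieCoboundary]
  rw [lieBoundary_apply]
  simp only [lieCoboundary, LinearMap.smul_apply, LinearMap.sum_apply, LinearMap.comp_apply,
    map_smul, map_sum, wedgeLM_apply, smul_eq_mul]
  rw [mul_left_comm, Finset.mul_sum]
  congr 1
  refine Finset.sum_congr rfl fun i _ => ?_
  rw [Finset.mul_sum]
  refine Finset.sum_congr rfl fun j _ => ?_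
  rw [formInner_wedge (h i j), ← formInner_contract, ← formInner_contract]

/-- Finite-dimensional Hodge theory: up to positive factors `‖d₀ δ α‖² = ⟨δ d₀ δ α, δ α⟩ = 0`, and
then `‖δ α‖² = ⟨α, d₀ δ α⟩ = 0`. -/
theorem lieBoundary_eq_zero_of_orthonormal {b : Model n →ₗ[ℝ] Model n →ₗ[ℝ] Model n}
    (h : ∀ i j l, B (EuclideanSpace.proj i) (EuclideanSpace.proj j) (EuclideanSpace.single l 1) =
      b (EuclideanSpace.single i 1) (EuclideanSpace.single j 1) l)
    {k : ℕ} {α : AltForm n (k + 1)}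
    (hα : lieBoundary B k (lieCoboundary b k (lieBoundary B k α)) = 0) :
    lieBoundary B k α = 0 := by
  have hk : (k + 1 : ℝ) ≠ 0 := by positivity
  have h1 : lieCoboundary b k (lieBoundary B k α) = 0 := by
    refine eq_zero_of_formInner_self ?_
    rw [← formInner_lieBoundary h, hα]
    simp
  refine eq_zero_of_formInner_self ?_
  have h2 := formInner_lieBoundary h k α (lieBoundary B k α)
  rw [h1, map_zero] at h2
  exact (mul_eq_zero.1 h2).resolve_left hk

/-- The bracket on `V*` that corresponds to a bracket on `V` under an isomorphism `V ≃ V*`. -/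
def dualBracket (G : Model n ≃ₗ[ℝ] (Model n →L[ℝ] ℝ))
    (b : Model n →ₗ[ℝ] Model n →ₗ[ℝ] Model n) :
    (Model n →L[ℝ] ℝ) →ₗ[ℝ] (Model n →L[ℝ] ℝ) →ₗ[ℝ] (Model n →L[ℝ] ℝ) :=
  (b.compl₁₂ G.symm.toLinearMap G.symm.toLinearMap).compr₂ G.toLinearMap

theorem dualBracket_apply (G : Model n ≃ₗ[ℝ] (Model n →L[ℝ] ℝ))
    (b : Model n →ₗ[ℝ] Model n →ₗ[ℝ] Model n) (ξ η : Model n →L[ℝ] ℝ) :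
    dualBracket G b ξ η = G (b (G.symm ξ) (G.symm η)) := rfl

/-- Diagonalise the symmetric form and rescale; `A` carries the standard basis to an orthonormal
one. -/
theorem exists_orthonormal (G : Model n ≃ₗ[ℝ] (Model n →L[ℝ] ℝ))
    (hs : ∀ u v, G u v = G v u) (hp : ∀ u, u ≠ 0 → 0 < G u u) :
    ∃ A : Model n ≃L[ℝ] Model n, ∀ u v, G (A u) (A v) = ∑ i, u i * v i := by
  let g : LinearMap.BilinForm ℝ (Model n) := ContinuousLinearMap.coeLM ℝ ∘ₗ G.toLinearMap
  have hg (u v) : g u v = G u v := rfl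
  obtain ⟨v', hv'⟩ := LinearMap.BilinForm.exists_orthogonal_basis (B := g) ⟨fun u v => hs u v⟩
  let v := v'.reindex (finCongr (finrank_euclideanSpace_fin (𝕜 := ℝ) (n := n)))
  have hv (i j) (hij : i ≠ j) : G (v i) (v j) = 0 := by
    have : g.IsOrthoᵢ v' := hv'
    simpa [v, Function.onFun, hg] using this (i := (finCongr (finrank_euclideanSpace_fin (𝕜 := ℝ) (n := n))).symm i)
      (j := (finCongr (finrank_euclideanSpace_fin (𝕜 := ℝ) (n := n))).symm j) (by simpa using hij)
  have hpos (i) : 0 < G (v i) (v i) := hp _ (v.ne_zero i)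
  let c (i : Fin n) : ℝ := (Real.sqrt (G (v i) (v i)))⁻¹
  have hc (i) : c i ≠ 0 := inv_ne_zero (Real.sqrt_ne_zero'.2 (hpos i))
  let w := v.isUnitSMul (fun i => (hc i).isUnit)
  have hw (i) : w i = c i • v i := Module.Basis.isUnitSMul_apply _ i
  have hww (i j) : G (w i) (w j) = if i = j then 1 else 0 := by
    rw [hw, hw]
    simp only [map_smul, smul_apply, smul_eq_mul]
    split_ifs with hij
    · subst hij
      have h1 := Real.mul_self_sqrt (hpos i).le
      have h2 := Real.sqrt_ne_zero'.2 (hpos i)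
      simp only [c]
      field_simp
      rw [sq, h1]
    · rw [hv i j hij]; simp
  let A := (EuclideanSpace.basisFun (Fin n) ℝ).toBasis.equiv w (Equiv.refl _)
  have hA (u : Model n) : A u = ∑ i, u i • w i := by
    conv_lhs => rw [← sum_proj_smul_single u]
    have h1 (i : Fin n) : A (EuclideanSpace.single i 1) = w i := by
      have := (EuclideanSpace.basisFun (Fin n) ℝ).toBasis.equiv_apply (b' := w) i (Equiv.refl _)
      simpa using this
    simp only [map_sum, map_smul, h1]
  refine ⟨A.toContinuousLinearEquiv, fun u v => ?_⟩
  change G (A u) (A v) = _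
  rw [hA, hA]
  simp [hww, mul_comm]

/-- Two-step nilpotent brackets `b` on a Euclidean space `V` that vanish on the orthogonal of `E`
and have values in it. -/
structure IsHeisenbergBracket (E : Submodule ℝ (Model n)) (G : Model n ≃ₗ[ℝ] (Model n →L[ℝ] ℝ))
    (b : Model n →ₗ[ℝ] Model n →ₗ[ℝ] Model n) : Prop where
  symm : ∀ u v, G u v = G v u
  pos : ∀ u, u ≠ 0 → 0 < G u u
  apply_mem : ∀ u v, ∀ e ∈ E, G (b u v) e = 0
  left : ∀ u v, (∀ e ∈ E, G u e = 0) → b u v = 0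
  right : ∀ u v, (∀ e ∈ E, G v e = 0) → b u v = 0
  swap : ∀ u v, b u v = -b v u

namespace IsHeisenbergBracket

variable {G : Model n ≃ₗ[ℝ] (Model n →L[ℝ] ℝ)} {b : Model n →ₗ[ℝ] Model n →ₗ[ℝ] Model n}

/-- Under `G` the orthogonal of `E` corresponds to the annihilator of `E`. -/
theorem isAnnihilatorBracket (h : IsHeisenbergBracket E G b) :
    IsAnnihilatorBracket E (dualBracket G b) where
  apply_mem ξ η := h.apply_mem _ _
  left ξ η hξ := by
    rw [dualBracket_apply, h.left _ _ (by simpa using hξ), map_zero]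
  right ξ η hη := by
    rw [dualBracket_apply, h.right _ _ (by simpa using hη), map_zero]

/-- The composition of the boundary map and the Chevalley–Eilenberg differential is injective on
the image of the boundary map. -/
theorem lieBoundary_eq_zero (h : IsHeisenbergBracket E G b) {k : ℕ} {α : AltForm n (k + 1)}
    (hα : lieBoundary (dualBracket G b) k (lieCoboundary b k
      (lieBoundary (dualBracket G b) k α)) = 0) :
    lieBoundary (dualBracket G b) k α = 0 := by
  obtain ⟨A, hA⟩ := exists_orthonormal G h.symm h.pos
  -- Everything is pulled back along `A`, after which the standard basis is orthonormal. This
  -- identity matches the structure constants of the two transported brackets, as the orthonormal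
  -- case requires.
  have hsymm (i : Fin n) : G.symm ((EuclideanSpace.proj i : Model n →L[ℝ] ℝ).comp
      (A.symm : Model n →L[ℝ] Model n)) = A (EuclideanSpace.single i 1) := by
    rw [LinearEquiv.symm_apply_eq]
    ext v
    have := hA (EuclideanSpace.single i 1) (A.symm v)
    rw [A.apply_symm_apply] at this
    rw [this]
    simp
  have h1 := congrArg (fun β : AltForm n k => β.compContinuousLinearMap
    (A : Model n →L[ℝ] Model n)) hα
  simp only [lieBoundary_compContinuousLinearMap, lieCoboundary_compContinuousLinearMap] at h1
  have h2 := lieBoundary_eq_zero_of_orthonormal (fun i j l => ?_) h1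
  · rw [← lieBoundary_compContinuousLinearMap] at h2
    ext v
    have h3 := congrArg (fun β : AltForm n k => β (A.symm ∘ v)) h2
    simpa [← Function.comp_assoc] using h3
  · rw [transportDual_apply, dualBracket_apply, hsymm, hsymm, transport_apply]
    have := hA (A.symm (b (A (EuclideanSpace.single i 1)) (A (EuclideanSpace.single j 1))))
      (EuclideanSpace.single l 1)
    rw [A.apply_symm_apply] at this
    rw [this]
    simp

end IsHeisenbergBracket

end PointwiseHeisenberg

/-! ### The bracket that a metric induces on the tangent spaces. -/

section MetricBracket

variable {n : ℕ} {M : Type*} [TopologicalSpace M] [ChartedSpace (Model n) M]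
  [IsManifold (𝓡 n) ∞ M]

namespace Metric

variable (γ : Metric n M) (E : Subbundle n M)

/-- The orthogonal projection `TₓM → Eₓ`. -/
def proj (x : M) : TangentSpace (𝓡 n) x →ₗ[ℝ] E.fiber x :=
  Submodule.projectionOnto _ _ (γ.isCompl_orthogonal E x)

/-- The lift `TₓM/Eₓ → TₓM` with values in the orthogonal of `E`. -/
def lift (x : M) : (TangentSpace (𝓡 n) x ⧸ E.fiber x) →ₗ[ℝ] TangentSpace (𝓡 n) x :=
  (γ.orthogonal E x).subtype ∘ₗ
    (Submodule.quotientEquivOfIsCompl _ _ (γ.isCompl_orthogonal E x)).toLinearMap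

theorem lift_mkQ (x : M) (v : TangentSpace (𝓡 n) x) :
    γ.lift E x ((E.fiber x).mkQ v) = v - γ.proj E x v := by
  have h := Submodule.quotientEquivOfIsCompl_apply_mk (γ.isCompl_orthogonal E x) v
  change ((Submodule.quotientEquivOfIsCompl _ _ (γ.isCompl_orthogonal E x)
    (Submodule.Quotient.mk v) : γ.orthogonal E x) : TangentSpace (𝓡 n) x) = _
  rw [h, Submodule.coe_projectionOnto_apply, Submodule.projection_eq_self_sub_projection]
  rfl

theorem inner_lift (x : M) (z) (e : TangentSpace (𝓡 n) x) (he : e ∈ E.fiber x) :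
    γ.inner x (γ.lift E x z) e = 0 := by
  rw [γ.symm]
  exact ((Submodule.quotientEquivOfIsCompl _ _ (γ.isCompl_orthogonal E x)) z).2 e he

theorem proj_eq_zero {x : M} {v : TangentSpace (𝓡 n) x}
    (h : ∀ e ∈ E.fiber x, γ.inner x v e = 0) : γ.proj E x v = 0 :=
  (Submodule.projectionOnto_apply_eq_zero_iff (γ.isCompl_orthogonal E x)).2 fun e he =>
    (γ.symm x e v).trans (h e he)

theorem proj_of_mem {x : M} {v : TangentSpace (𝓡 n) x} (h : v ∈ E.fiber x) :
    γ.proj E x v = ⟨v, h⟩ :=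
  Submodule.projectionOnto_apply_of_mem_left (γ.isCompl_orthogonal E x) h

/-- The bracket on `TₓM` that corresponds to the bracket of `gr(TM)ₓ` under the identification of
`TM/E` with the orthogonal of `E`. -/
def tangentBracket (x : M) :
    TangentSpace (𝓡 n) x →ₗ[ℝ] TangentSpace (𝓡 n) x →ₗ[ℝ] TangentSpace (𝓡 n) x :=
  ((E.levi x).compl₁₂ (γ.proj E x) (γ.proj E x)).compr₂ (γ.lift E x)

theorem tangentBracket_apply (x : M) (u v : TangentSpace (𝓡 n) x) :
    γ.tangentBracket E x u v = γ.lift E x (E.levi x (γ.proj E x u) (γ.proj E x v)) := rfl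

theorem phi_symm_fst (x : M) (ξ : CotangentSpace n x) :
    ((γ.phi E x).symm ξ).1 = γ.proj E x ((γ.flat x).symm ξ) := rfl

theorem phi_inr (x : M) (z) : γ.phi E x (0, z) = γ.flat x (γ.lift E x z) := by
  change γ.flat x (Submodule.prodEquivOfIsCompl _ _ (γ.isCompl_orthogonal E x) _) = _
  rw [Submodule.coe_prodEquivOfIsCompl']
  congr 1
  simp [lift]

theorem bracket_eq (x : M) (ξ η : CotangentSpace n x) : γ.bracket E x ξ η =
    γ.flat x (γ.tangentBracket E x ((γ.flat x).symm ξ) ((γ.flat x).symm η)) := by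
  rw [Metric.bracket_apply, Subbundle.grBracket_apply, phi_inr, phi_symm_fst, phi_symm_fst,
    tangentBracket_apply]

theorem _root_.Heisenberg.Subbundle.levi_swap (x : M) (u v : E.fiber x) :
    E.levi x u v = -E.levi x v u := by
  have h := E.levi_self x (u + v)
  simp only [map_add, LinearMap.add_apply, E.levi_self, zero_add, add_zero] at h
  exact eq_neg_of_add_eq_zero_left ((add_comm _ _).trans h)

/-- The fibre of `E` at `x`, as a subspace of the model space. -/
def _root_.Heisenberg.Subbundle.modelFiber (x : M) : Submodule ℝ (Model n) := E.fiber x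

/-- The inner product at `x`, on the model space. -/
def modelInner (x : M) : Model n →L[ℝ] Model n →L[ℝ] ℝ := γ.inner x

/-- The isomorphism `TₓM ≃ T*ₓM` given by the metric, on the model space. -/
def modelFlat (x : M) : Model n ≃ₗ[ℝ] (Model n →L[ℝ] ℝ) := γ.flat x

/-- The orthogonal projection to `Eₓ`, on the model space. -/
def modelProj (x : M) : Model n →ₗ[ℝ] Model n := (E.fiber x).subtype ∘ₗ γ.proj E x

/-- The bracket `tangentBracket`, on the model space. -/
def modelBracket (x : M) : Model n →ₗ[ℝ] Model n →ₗ[ℝ] Model n := γ.tangentBracket E x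

theorem modelFlat_apply (x : M) (u v : Model n) : γ.modelFlat x u v = γ.modelInner x u v := rfl

theorem modelInner_symm (x : M) (u v : Model n) : γ.modelInner x u v = γ.modelInner x v u :=
  γ.symm x u v

theorem modelInner_pos (x : M) {v : Model n} (hv : v ≠ 0) : 0 < γ.modelInner x v v :=
  γ.pos x v hv

theorem modelProj_mem (x : M) (v : Model n) : γ.modelProj E x v ∈ E.modelFiber x :=
  (γ.proj E x v).2

theorem modelProj_eq_zero {x : M} {v : Model n} (h : ∀ e ∈ E.modelFiber x, γ.modelInner x v e = 0) :
    γ.modelProj E x v = 0 := by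
  have h1 : γ.proj E x v = 0 := γ.proj_eq_zero E h
  exact congrArg Subtype.val h1

theorem modelProj_of_mem {x : M} {v : Model n} (h : v ∈ E.modelFiber x) :
    γ.modelProj E x v = v :=
  congrArg Subtype.val (γ.proj_of_mem E h)

theorem modelBracket_congr (x : M) {u u' v v' : Model n}
    (hu : γ.modelProj E x u = γ.modelProj E x u') (hv : γ.modelProj E x v = γ.modelProj E x v') :
    γ.modelBracket E x u v = γ.modelBracket E x u' v' := by
  have h1 : γ.proj E x u = γ.proj E x u' := Subtype.ext hu
  have h2 : γ.proj E x v = γ.proj E x v' := Subtype.ext hv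
  change γ.lift E x (E.levi x (γ.proj E x u) (γ.proj E x v)) =
    γ.lift E x (E.levi x (γ.proj E x u') (γ.proj E x v'))
  rw [h1, h2]

/-- The bracket of two sections of `E` is their Lie bracket modulo `E`. -/
theorem modelBracket_eq (x : M) {X Y : ∀ y : M, TangentSpace (𝓡 n) y}
    (hX : MDifferentiableAt (𝓡 n) (𝓡 n).tangent
      (fun y => (⟨y, X y⟩ : TangentBundle (𝓡 n) M)) x)
    (hY : MDifferentiableAt (𝓡 n) (𝓡 n).tangent
      (fun y => (⟨y, Y y⟩ : TangentBundle (𝓡 n) M)) x)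
    (hXE : ∀ᶠ y in nhds x, X y ∈ E.fiber y) (hYE : ∀ᶠ y in nhds x, Y y ∈ E.fiber y)
    {w : Model n} (hw : w = VectorField.mlieBracket (𝓡 n) X Y x) :
    γ.modelBracket E x (X x) (Y x) = w - γ.modelProj E x w := by
  subst hw
  change γ.lift E x (E.levi x (γ.proj E x (X x)) (γ.proj E x (Y x))) = _
  rw [γ.proj_of_mem E hXE.self_of_nhds, γ.proj_of_mem E hYE.self_of_nhds,
    E.levi_eq _ X Y hX hY hXE hYE]
  exact γ.lift_mkQ E x _

/-- The bracket factors through the orthogonal projection to `E` and takes values in the orthogonal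
of `E`. This is the bridge from the manifold to the algebra on a fixed space. -/
theorem isHeisenbergBracket (x : M) :
    IsHeisenbergBracket (E.modelFiber x) (γ.modelFlat x) (γ.modelBracket E x) where
  symm := γ.modelInner_symm x
  pos _ := γ.modelInner_pos x
  apply_mem u v e he := γ.inner_lift E x _ e he
  left u v hu := by
    have h : γ.modelProj E x u = γ.modelProj E x 0 := by
      rw [γ.modelProj_eq_zero E hu, map_zero]
    rw [γ.modelBracket_congr E x h rfl, map_zero, LinearMap.zero_apply]
  right u v hv := by
    have h : γ.modelProj E x v = γ.modelProj E x 0 := by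
      rw [γ.modelProj_eq_zero E hv, map_zero]
    rw [γ.modelBracket_congr E x rfl h, map_zero]
  swap u v := by
    change γ.lift E x (E.levi x (γ.proj E x u) (γ.proj E x v)) = _
    rw [E.levi_swap, map_neg]
    rfl

theorem bracket_eq_dualBracket (x : M) :
    γ.bracket E x = dualBracket (γ.modelFlat x) (γ.modelBracket E x) := by
  refine LinearMap.ext fun ξ => LinearMap.ext fun η => γ.bracket_eq E x ξ η

end Metric

/-! ### Tangent frames and the metric in a chart. -/

section Chart

/-- The differential of the inverse of the preferred chart at `c`. -/
def chartFrame (c : M) (y : Model n) : Model n →L[ℝ] Model n :=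
  mfderiv 𝓘(ℝ, Model n) (𝓡 n) (extChartAt (𝓡 n) c).symm y

theorem isInvertible_mfderiv_symm (c : M) {y : Model n} (hy : y ∈ (extChartAt (𝓡 n) c).target) :
    (mfderiv 𝓘(ℝ, Model n) (𝓡 n) (extChartAt (𝓡 n) c).symm y).IsInvertible := by
  have : IsManifold (𝓡 n) 1 M := IsManifold.of_le (n := ∞) (by simp)
  have h := isInvertible_mfderivWithin_extChartAt_symm (I := 𝓡 n) hy
  rwa [modelWithCornersSelf_coe, Set.range_id, mfderivWithin_univ] at h

/-- The differential of the inverse of the preferred chart at `c`, as an isomorphism. -/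
def chartEquiv (c : M) {y : Model n} (hy : y ∈ (extChartAt (𝓡 n) c).target) :
    Model n ≃L[ℝ] Model n :=
  (isInvertible_mfderiv_symm c hy).choose

theorem coe_chartEquiv (c : M) {y : Model n} (hy : y ∈ (extChartAt (𝓡 n) c).target) :
    (chartEquiv c hy : Model n →L[ℝ] Model n) = chartFrame c y :=
  (isInvertible_mfderiv_symm c hy).choose_spec

theorem inverse_chartFrame (c : M) {y : Model n} (hy : y ∈ (extChartAt (𝓡 n) c).target) :
    (chartFrame c y).inverse = ((chartEquiv c hy).symm : Model n →L[ℝ] Model n) := by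
  rw [← coe_chartEquiv c hy, ContinuousLinearMap.inverse_equiv]

theorem inverse_chartFrame_apply (c : M) {y : Model n} (hy : y ∈ (extChartAt (𝓡 n) c).target)
    (v : Model n) : (chartFrame c y).inverse (chartFrame c y v) = v := by
  rw [inverse_chartFrame c hy, ← coe_chartEquiv c hy]; simp

theorem chartFrame_inverse_apply (c : M) {y : Model n} (hy : y ∈ (extChartAt (𝓡 n) c).target)
    (v : Model n) : chartFrame c y ((chartFrame c y).inverse v) = v := by
  rw [inverse_chartFrame c hy, ← coe_chartEquiv c hy]; simp

/-- The metric in the preferred chart at `c`. -/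
def Metric.inChart (γ : Metric n M) (c : M) (y : Model n) : Model n →L[ℝ] Model n →L[ℝ] ℝ :=
  (γ.modelInner ((extChartAt (𝓡 n) c).symm y)).bilinearComp (chartFrame c y) (chartFrame c y)

theorem Metric.inChart_apply (γ : Metric n M) (c : M) (y u v : Model n) : γ.inChart c y u v =
    γ.modelInner ((extChartAt (𝓡 n) c).symm y) (chartFrame c y u) (chartFrame c y v) := rfl

theorem contMDiffOn_chartFrame (c : M) (v : Model n) :
    ContMDiffOn 𝓘(ℝ, Model n) (𝓡 n).tangent ∞ (fun y : Model n =>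
      (⟨(extChartAt (𝓡 n) c).symm y, chartFrame c y v⟩ : TangentBundle (𝓡 n) M))
      (extChartAt (𝓡 n) c).target := by
  have h1 := (contMDiffOn_extChartAt_symm (I := 𝓡 n) (n := ∞) c).contMDiffOn_tangentMapWithin
    (m := ∞) (by simp) (isOpen_extChartAt_target c).uniqueMDiffOn
  have h2 : ContMDiffOn 𝓘(ℝ, Model n) 𝓘(ℝ, Model n).tangent ∞ (fun y : Model n =>
      (⟨y, v⟩ : TangentBundle 𝓘(ℝ, Model n) (Model n))) (extChartAt (𝓡 n) c).target :=
    contMDiffOn_vectorSpace_iff_contDiffOn.2 contDiffOn_const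
  refine (h1.comp h2 fun y hy => hy).congr fun y hy => ?_
  simp only [Function.comp_apply, tangentMapWithin, mfderivWithin_of_isOpen
    (isOpen_extChartAt_target c) hy]
  rfl

/-- It suffices to test on constant vectors, which the inverse chart turns into smooth vector fields
along it (`contMDiffOn_chartFrame`). -/
theorem Metric.contDiffOn_inChart (γ : Metric n M) (c : M) :
    ContDiffOn ℝ ∞ (γ.inChart c) (extChartAt (𝓡 n) c).target := by
  refine contDiffOn_clm_apply.2 fun u => contDiffOn_clm_apply.2 fun v => ?_
  intro y hy
  have h : ContMDiffWithinAt 𝓘(ℝ, Model n) ((𝓡 n).prod 𝓘(ℝ)) ∞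
      (fun y ↦ Bundle.TotalSpace.mk' ℝ (E := Bundle.Trivial M ℝ) ((extChartAt (𝓡 n) c).symm y)
        (γ.inner ((extChartAt (𝓡 n) c).symm y) (chartFrame c y u) (chartFrame c y v)))
      (extChartAt (𝓡 n) c).target y := by
    apply ContMDiffWithinAt.clm_bundle_apply₂ (F₁ := Model n) (F₂ := Model n)
    · exact ContMDiffAt.comp_contMDiffWithinAt y γ.contMDiff.contMDiffAt
        (contMDiffOn_extChartAt_symm c y hy)
    · exact contMDiffOn_chartFrame c u y hy
    · exact contMDiffOn_chartFrame c v y hy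
  simp only [Bundle.contMDiffWithinAt_totalSpace] at h
  exact contMDiffWithinAt_iff_contDiffWithinAt.1 h.2

end Chart

end MetricBracket

/-! ### Smoothness of the tangent bracket in charts. -/

section ChartBracket

variable {n : ℕ} {M : Type*} [TopologicalSpace M] [ChartedSpace (Model n) M]
  [IsManifold (𝓡 n) ∞ M]

/-- A vector field in the preferred chart at `c`. -/
def fieldInChart (c : M) (X : ∀ x : M, TangentSpace (𝓡 n) x) (y : Model n) : Model n :=
  VectorField.mpullback 𝓘(ℝ, Model n) (𝓡 n) (extChartAt (𝓡 n) c).symm X y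

theorem contMDiffAt_symm (c : M) {y : Model n} (hy : y ∈ (extChartAt (𝓡 n) c).target) :
    ContMDiffAt 𝓘(ℝ, Model n) (𝓡 n) ∞ (extChartAt (𝓡 n) c).symm y :=
  (contMDiffOn_extChartAt_symm c).contMDiffAt ((isOpen_extChartAt_target c).mem_nhds hy)

theorem fieldInChart_eq (c : M) (X : ∀ x : M, TangentSpace (𝓡 n) x) (y : Model n) :
    fieldInChart c X y = (chartFrame c y).inverse (X ((extChartAt (𝓡 n) c).symm y)) := rfl

theorem chartFrame_fieldInChart (c : M) (X : ∀ x : M, TangentSpace (𝓡 n) x) {y : Model n}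
    (hy : y ∈ (extChartAt (𝓡 n) c).target) :
    chartFrame c y (fieldInChart c X y) = X ((extChartAt (𝓡 n) c).symm y) :=
  chartFrame_inverse_apply c hy _

theorem contDiffAt_fieldInChart (c : M) {X : ∀ x : M, TangentSpace (𝓡 n) x} {y : Model n}
    (hy : y ∈ (extChartAt (𝓡 n) c).target)
    (hX : ContMDiffAt (𝓡 n) (𝓡 n).tangent ∞ (fun x => (⟨x, X x⟩ : TangentBundle (𝓡 n) M))
      ((extChartAt (𝓡 n) c).symm y)) :
    ContDiffAt ℝ ∞ (fieldInChart c X) y := by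
  have : IsManifold (𝓡 n) 1 M := IsManifold.of_le (n := ∞) (by simp)
  exact contMDiffAt_vectorSpace_iff_contDiffAt.1
    (hX.mpullback_vectorField_preimage (contMDiffAt_symm c hy) (isInvertible_mfderiv_symm c hy)
      (by simp))

theorem chartFrame_lieBracket (c : M) {X Y : ∀ x : M, TangentSpace (𝓡 n) x} {y : Model n}
    (hy : y ∈ (extChartAt (𝓡 n) c).target)
    (hX : ContMDiffAt (𝓡 n) (𝓡 n).tangent ∞ (fun x => (⟨x, X x⟩ : TangentBundle (𝓡 n) M))
      ((extChartAt (𝓡 n) c).symm y))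
    (hY : ContMDiffAt (𝓡 n) (𝓡 n).tangent ∞ (fun x => (⟨x, Y x⟩ : TangentBundle (𝓡 n) M))
      ((extChartAt (𝓡 n) c).symm y)) :
    chartFrame c y (VectorField.lieBracket ℝ (fieldInChart c X) (fieldInChart c Y) y) =
      VectorField.mlieBracket (𝓡 n) X Y ((extChartAt (𝓡 n) c).symm y) := by
  have : IsManifold (𝓡 n) (minSmoothness ℝ 2) M :=
    IsManifold.of_le (n := ∞) (by simpa using ENat.LEInfty.out)
  have h := VectorField.mpullback_mlieBracket (n := ∞) (hX.mdifferentiableAt (by simp))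
    (hY.mdifferentiableAt (by simp)) (contMDiffAt_symm c hy) (by simpa using ENat.LEInfty.out)
  have h1 : VectorField.lieBracket ℝ (fieldInChart c X) (fieldInChart c Y) y =
      fieldInChart c (VectorField.mlieBracket (𝓡 n) X Y) y := by
    refine Eq.trans ?_ h.symm
    rw [← VectorField.lieBracketWithin_univ, ← VectorField.mlieBracketWithin_univ,
      VectorField.mlieBracketWithin_eq_lieBracketWithin]
    rfl
  rw [h1, chartFrame_fieldInChart c _ hy]

variable (γ : Metric n M) (E : Subbundle n M)

/-- The local frame of `E` around `x`, with values in the model space. -/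
def Subbundle.modelFrame (x : M) (i : Fin (E.frameRank x)) (y : M) : Model n := E.frame x i y

theorem chartFrame_frame (x c : M) {y : Model n} (hy : y ∈ (extChartAt (𝓡 n) c).target) (i) :
    chartFrame c y (fieldInChart c (E.frame x i) y) =
      E.modelFrame x i ((extChartAt (𝓡 n) c).symm y) :=
  chartFrame_fieldInChart c _ hy

/-- The definition of `levi` uses at each point a frame chosen for that point, so smoothness cannot
be seen from it. Here the frame chosen for the centre is kept fixed while `y` varies. -/
theorem Subbundle.eventually_frame (c : M) {y₀ : Model n}
    (hy₀ : y₀ ∈ (extChartAt (𝓡 n) c).target) :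
    ∀ᶠ y in nhds y₀, y ∈ (extChartAt (𝓡 n) c).target ∧
      (∀ i, ContMDiffAt (𝓡 n) (𝓡 n).tangent ∞
        (fun x => (⟨x, E.frame ((extChartAt (𝓡 n) c).symm y₀) i x⟩ : TangentBundle (𝓡 n) M))
        ((extChartAt (𝓡 n) c).symm y)) ∧
      (∀ᶠ x in nhds ((extChartAt (𝓡 n) c).symm y), ∀ i,
        E.frame ((extChartAt (𝓡 n) c).symm y₀) i x ∈ E.fiber x) ∧
      LinearIndependent ℝ (fun i => E.modelFrame ((extChartAt (𝓡 n) c).symm y₀) i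
        ((extChartAt (𝓡 n) c).symm y)) ∧
      Submodule.span ℝ (Set.range fun i => E.modelFrame ((extChartAt (𝓡 n) c).symm y₀) i
        ((extChartAt (𝓡 n) c).symm y)) = E.modelFiber ((extChartAt (𝓡 n) c).symm y) := by
  obtain ⟨U, hU, hx, h1, h2⟩ := E.frame_spec ((extChartAt (𝓡 n) c).symm y₀)
  have hU' : ∀ᶠ y in nhds y₀, (extChartAt (𝓡 n) c).symm y ∈ U :=
    (contMDiffAt_symm c hy₀).continuousAt.eventually_mem (hU.mem_nhds hx)
  filter_upwards [hU', (isOpen_extChartAt_target c).mem_nhds hy₀] with y hy hy'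
  refine ⟨hy', fun i => (h1 i).contMDiffAt (hU.mem_nhds hy), ?_, (h2 _ hy).1, (h2 _ hy).2⟩
  filter_upwards [hU.mem_nhds hy] with x hx i
  rw [← (h2 x hx).2]
  exact Submodule.subset_span (Set.mem_range_self i)

theorem isInvertible_of_injective {V : Type*} [NormedAddCommGroup V] [NormedSpace ℝ V]
    [FiniteDimensional ℝ V] (f : V →L[ℝ] V) (h : Function.Injective f) : f.IsInvertible :=
  ⟨(LinearEquiv.ofInjectiveEndo f.toLinearMap h).toContinuousLinearEquiv, by ext v; rfl⟩

theorem contDiffAt_inverse {V W : Type*} [NormedAddCommGroup V] [NormedSpace ℝ V]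
    [FiniteDimensional ℝ V] [NormedAddCommGroup W] [NormedSpace ℝ W]
    {f : W → V →L[ℝ] V} {y : W} (hf : ContDiffAt ℝ ∞ f y) (h : Function.Injective (f y)) :
    ContDiffAt ℝ ∞ (fun z => (f z).inverse) y := by
  obtain ⟨e, he⟩ := isInvertible_of_injective (f y) h
  have : CompleteSpace V := FiniteDimensional.complete ℝ V
  have h1 : ContDiffAt ℝ ∞ ContinuousLinearMap.inverse (f y) := by
    rw [← he]
    exact contDiffAt_map_inverse e
  exact h1.comp y hf

/-- The coefficients of the orthogonal projection to `E` in a local frame are smooth. -/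
theorem Metric.exists_proj_coeff (c : M) {y₀ : Model n}
    (hy₀ : y₀ ∈ (extChartAt (𝓡 n) c).target) :
    ∃ θ : Model n → Model n →L[ℝ] (Fin (E.frameRank ((extChartAt (𝓡 n) c).symm y₀)) → ℝ),
      ContDiffAt ℝ ∞ θ y₀ ∧ ∀ᶠ y in nhds y₀, ∀ u,
        γ.modelProj E ((extChartAt (𝓡 n) c).symm y) (chartFrame c y u) =
        ∑ i, θ y u i • E.modelFrame ((extChartAt (𝓡 n) c).symm y₀) i
          ((extChartAt (𝓡 n) c).symm y) := by
  set x₀ := (extChartAt (𝓡 n) c).symm y₀ with hx₀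
  let S (y : Model n) : (Fin (E.frameRank x₀) → ℝ) →L[ℝ] Model n :=
    ∑ i, (ContinuousLinearMap.proj (R := ℝ) (φ := fun _ => ℝ) i).smulRight
      (fieldInChart c (E.frame x₀ i) y)
  have hS (y : Model n) (a) : S y a = ∑ i, a i • fieldInChart c (E.frame x₀ i) y := by
    simp [S]
  let K (y : Model n) : Model n →L[ℝ] (Fin (E.frameRank x₀) → ℝ) :=
    ContinuousLinearMap.pi fun i => γ.inChart c y (fieldInChart c (E.frame x₀ i) y)
  have hK (y u : Model n) (i) : K y u i = γ.inChart c y (fieldInChart c (E.frame x₀ i) y) u := rfl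
  have hfs (i) : ContDiffAt ℝ ∞ (fieldInChart c (E.frame x₀ i)) y₀ :=
    contDiffAt_fieldInChart c hy₀ ((E.eventually_frame c hy₀).self_of_nhds.2.1 i)
  have hγ : ContDiffAt ℝ ∞ (γ.inChart c) y₀ :=
    (γ.contDiffOn_inChart c).contDiffAt ((isOpen_extChartAt_target c).mem_nhds hy₀)
  have hSd : ContDiffAt ℝ ∞ S y₀ := by
    refine ContDiffAt.sum fun i _ => ?_
    exact (ContinuousLinearMap.smulRightL ℝ (Fin (E.frameRank x₀) → ℝ) (Model n)
      (ContinuousLinearMap.proj i)).contDiff.contDiffAt.comp y₀ (hfs i)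
  have hKd : ContDiffAt ℝ ∞ K y₀ := by
    have h1 : ContDiffAt ℝ ∞ (fun y i => γ.inChart c y (fieldInChart c (E.frame x₀ i) y)) y₀ :=
      contDiffAt_pi.2 fun i => hγ.clm_apply (hfs i)
    exact (ContinuousLinearMap.piEquivL ℝ _ _).contDiff.contDiffAt.comp y₀ h1
  -- `S` combines the frame with given coefficients and `K` pairs with the frame, so `K ∘ S` is its
  -- Gram matrix. The coefficients of the projection solve the normal equations: `θ = (K ∘ S)⁻¹ ∘
  -- K`.
  have hGd : ContDiffAt ℝ ∞ (fun y => (K y).comp (S y)) y₀ := hKd.clm_comp hSd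
  have hSA (y : Model n) (hy : y ∈ (extChartAt (𝓡 n) c).target) (a) :
      chartFrame c y (S y a) = ∑ i, a i • E.modelFrame x₀ i ((extChartAt (𝓡 n) c).symm y) := by
    simp only [hS, map_sum, map_smul, chartFrame_frame E x₀ c hy]
  have hKA (y : Model n) (hy : y ∈ (extChartAt (𝓡 n) c).target) (u i) : K y u i =
      γ.modelInner ((extChartAt (𝓡 n) c).symm y)
        (E.modelFrame x₀ i ((extChartAt (𝓡 n) c).symm y)) (chartFrame c y u) := by
    rw [hK, γ.inChart_apply, chartFrame_frame E x₀ c hy]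
  have hperp (y : Model n) (hy : y ∈ (extChartAt (𝓡 n) c).target)
      (hspan : Submodule.span ℝ (Set.range fun i => E.modelFrame x₀ i
        ((extChartAt (𝓡 n) c).symm y)) = E.modelFiber ((extChartAt (𝓡 n) c).symm y)) (u)
      (hu : K y u = 0) : ∀ e ∈ E.modelFiber ((extChartAt (𝓡 n) c).symm y),
        γ.modelInner ((extChartAt (𝓡 n) c).symm y) (chartFrame c y u) e = 0 := by
    intro e he
    rw [← hspan] at he
    obtain ⟨a, rfl⟩ := (Submodule.mem_span_range_iff_exists_fun ℝ).1 he
    rw [map_sum]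
    refine Finset.sum_eq_zero fun i _ => ?_
    rw [map_smul, γ.modelInner_symm, ← hKA y hy, hu]
    simp
  have hmem (y : Model n) (hspan : Submodule.span ℝ (Set.range fun i => E.modelFrame x₀ i
        ((extChartAt (𝓡 n) c).symm y)) = E.modelFiber ((extChartAt (𝓡 n) c).symm y))
      (a : Fin (E.frameRank x₀) → ℝ) :
      ∑ i, a i • E.modelFrame x₀ i ((extChartAt (𝓡 n) c).symm y) ∈
        E.modelFiber ((extChartAt (𝓡 n) c).symm y) := by
    rw [← hspan]
    exact (Submodule.mem_span_range_iff_exists_fun ℝ).2 ⟨a, rfl⟩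
  have hinj : ∀ᶠ y in nhds y₀, Function.Injective ((K y).comp (S y)) := by
    filter_upwards [E.eventually_frame c hy₀] with y ⟨hy, _, _, hli, hspan⟩
    rw [injective_iff_map_eq_zero]
    intro a ha
    have h1 := hperp y hy hspan (S y a) ha _ (hmem y hspan a)
    rw [hSA y hy] at h1
    have h2 : ∑ i, a i • E.modelFrame x₀ i ((extChartAt (𝓡 n) c).symm y) = 0 := by
      by_contra h0
      exact (γ.modelInner_pos _ h0).ne' h1
    funext i
    exact Fintype.linearIndependent_iff.1 hli a h2 i
  refine ⟨fun y => ((K y).comp (S y)).inverse.comp (K y),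
    (contDiffAt_inverse hGd hinj.self_of_nhds).clm_comp hKd, ?_⟩
  filter_upwards [E.eventually_frame c hy₀, hinj] with y ⟨hy, _, _, hli, hspan⟩ hyi u
  obtain ⟨e, he⟩ := isInvertible_of_injective _ hyi
  set a := ((K y).comp (S y)).inverse.comp (K y) u with ha
  have h1 : K y (S y a) = K y u := by
    change ((K y).comp (S y)) a = _
    rw [ha, ← he, ContinuousLinearMap.inverse_equiv]
    simp
  have h2 : K y (u - S y a) = 0 := by rw [map_sub, h1, sub_self]
  have h3 := γ.modelProj_eq_zero E (hperp y hy hspan _ h2)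
  rw [map_sub, map_sub, sub_eq_zero, hSA y hy, γ.modelProj_of_mem E (hmem y hspan a)] at h3
  exact h3

/-- The bracket `tangentBracket` in the preferred chart at `c`. -/
def Metric.bracketInChart (c : M) (y : Model n) : Model n →ₗ[ℝ] Model n →ₗ[ℝ] Model n :=
  ((γ.modelBracket E ((extChartAt (𝓡 n) c).symm y)).compl₁₂
      (chartFrame c y).toLinearMap (chartFrame c y).toLinearMap).compr₂
        (chartFrame c y).inverse.toLinearMap

theorem Metric.bracketInChart_apply (c : M) (y u v : Model n) : γ.bracketInChart E c y u v =
    (chartFrame c y).inverse (γ.modelBracket E ((extChartAt (𝓡 n) c).symm y)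
      (chartFrame c y u) (chartFrame c y v)) := rfl

theorem Metric.bracketInChart_eq_transport (c : M) {y : Model n}
    (hy : y ∈ (extChartAt (𝓡 n) c).target) : γ.bracketInChart E c y =
      transport (γ.modelBracket E ((extChartAt (𝓡 n) c).symm y)) (chartEquiv c hy) := by
  refine LinearMap.ext fun u => LinearMap.ext fun v => ?_
  rw [bracketInChart_apply, transport_apply, inverse_chartFrame c hy, ← coe_chartEquiv c hy]
  rfl

/-- The bracket of two sections of `E` in a chart is their Lie bracket modulo `E`. -/
theorem Metric.bracketInChart_fieldInChart (c : M) {y : Model n}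
    (hy : y ∈ (extChartAt (𝓡 n) c).target) {X Y : ∀ x : M, TangentSpace (𝓡 n) x}
    (hX : ContMDiffAt (𝓡 n) (𝓡 n).tangent ∞ (fun x => (⟨x, X x⟩ : TangentBundle (𝓡 n) M))
      ((extChartAt (𝓡 n) c).symm y))
    (hY : ContMDiffAt (𝓡 n) (𝓡 n).tangent ∞ (fun x => (⟨x, Y x⟩ : TangentBundle (𝓡 n) M))
      ((extChartAt (𝓡 n) c).symm y))
    (hXE : ∀ᶠ x in nhds ((extChartAt (𝓡 n) c).symm y), X x ∈ E.fiber x)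
    (hYE : ∀ᶠ x in nhds ((extChartAt (𝓡 n) c).symm y), Y x ∈ E.fiber x) :
    γ.bracketInChart E c y (fieldInChart c X y) (fieldInChart c Y y) =
      VectorField.lieBracket ℝ (fieldInChart c X) (fieldInChart c Y) y -
      (chartFrame c y).inverse (γ.modelProj E ((extChartAt (𝓡 n) c).symm y) (chartFrame c y
        (VectorField.lieBracket ℝ (fieldInChart c X) (fieldInChart c Y) y))) := by
  rw [bracketInChart_apply, chartFrame_fieldInChart c _ hy, chartFrame_fieldInChart c _ hy,
    γ.modelBracket_eq E _ (hX.mdifferentiableAt (by simp)) (hY.mdifferentiableAt (by simp))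
      hXE hYE (chartFrame_lieBracket c hy hX hY), map_sub, inverse_chartFrame_apply c hy]

/-- Only the projections of `u` and `v` to `E` matter. Expanding them in a fixed frame gives smooth
coefficients times Lie brackets of frame fields minus their projections to `E`. -/
theorem Metric.contDiffOn_bracketInChart (c : M) (u v : Model n) :
    ContDiffOn ℝ ∞ (fun y => γ.bracketInChart E c y u v) (extChartAt (𝓡 n) c).target := by
  intro y₀ hy₀
  refine ContDiffAt.contDiffWithinAt ?_
  obtain ⟨θ, hθ, hθ'⟩ := γ.exists_proj_coeff E c hy₀
  let x₀ := (extChartAt (𝓡 n) c).symm y₀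
  let L (i j) (y : Model n) : Model n :=
    VectorField.lieBracket ℝ (fieldInChart c (E.frame x₀ i)) (fieldInChart c (E.frame x₀ j)) y
  have hfs (i) : ContDiffAt ℝ ∞ (fieldInChart c (E.frame x₀ i)) y₀ :=
    contDiffAt_fieldInChart c hy₀ ((E.eventually_frame c hy₀).self_of_nhds.2.1 i)
  have hL (i j) : ContDiffAt ℝ ∞ (L i j) y₀ :=
    (hfs i).lieBracket_vectorField (hfs j) (by simp)
  have hθi (f : Model n → Model n) (hf : ContDiffAt ℝ ∞ f y₀) (i) :
      ContDiffAt ℝ ∞ (fun y => θ y (f y) i) y₀ :=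
    contDiffAt_pi.1 (hθ.clm_apply hf) i
  have hmain : ContDiffAt ℝ ∞ (fun y => ∑ i, ∑ j, (θ y u i * θ y v j) •
      (L i j y - ∑ l, θ y (L i j y) l • fieldInChart c (E.frame x₀ l) y)) y₀ := by
    refine ContDiffAt.sum fun i _ => ContDiffAt.sum fun j _ => ContDiffAt.smul
      ((hθi _ contDiffAt_const i).mul (hθi _ contDiffAt_const j)) ((hL i j).sub
        (ContDiffAt.sum fun l _ => (hθi _ (hL i j) l).smul (hfs l)))
  refine hmain.congr_of_eventuallyEq ?_
  filter_upwards [E.eventually_frame c hy₀, hθ'] with y ⟨hy, hs, hsE, _, _⟩ hyθ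
  have hfield (w : Model n) : (chartFrame c y).inverse
      (γ.modelProj E ((extChartAt (𝓡 n) c).symm y) (chartFrame c y w)) =
      ∑ i, θ y w i • fieldInChart c (E.frame x₀ i) y := by
    rw [hyθ, map_sum]
    refine Finset.sum_congr rfl fun i _ => ?_
    rw [map_smul, fieldInChart_eq]
    rfl
  have hproj (w : Model n) : γ.modelProj E ((extChartAt (𝓡 n) c).symm y) (chartFrame c y w) =
      γ.modelProj E ((extChartAt (𝓡 n) c).symm y) (chartFrame c y
        (∑ i, θ y w i • fieldInChart c (E.frame x₀ i) y)) := by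
    rw [← hfield, chartFrame_inverse_apply c hy,
      γ.modelProj_of_mem E (γ.modelProj_mem E _ (chartFrame c y w))]
  rw [bracketInChart_apply, γ.modelBracket_congr E _ (hproj u) (hproj v), ← bracketInChart_apply]
  simp only [map_sum, map_smul, LinearMap.sum_apply, LinearMap.smul_apply, Finset.smul_sum]
  rw [Finset.sum_comm]
  refine Finset.sum_congr rfl fun i _ => Finset.sum_congr rfl fun j _ => ?_
  rw [γ.bracketInChart_fieldInChart E c hy (hs i) (hs j) (hsE.mono fun x hx => hx i)
    (hsE.mono fun x hx => hx j), smul_smul, mul_comm, ← hfield]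

end ChartBracket

/-! ### Families of linear maps of constant rank. -/

section ConstantRank

variable {V W X : Type*} [NormedAddCommGroup V] [NormedSpace ℝ V] [FiniteDimensional ℝ V]
  [NormedAddCommGroup W] [NormedSpace ℝ W] [FiniteDimensional ℝ W]
  [NormedAddCommGroup X] [NormedSpace ℝ X]

/-- Project onto the range along a complement, then apply a linear section of `D`. In particular `D
∘ C` is a projection onto the range of `D`. -/
theorem exists_pseudoInverse (D : V →L[ℝ] W) :
    ∃ C : W →L[ℝ] V, (∀ w, C (D (C w)) = C w) ∧ ∀ v, D (C (D v)) = D v := by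
  obtain ⟨s, hs⟩ := D.toLinearMap.rangeRestrict.exists_rightInverse_of_surjective
    (LinearMap.range_rangeRestrict _)
  obtain ⟨F, hF⟩ := (LinearMap.range D.toLinearMap).exists_isCompl
  have hs' (z : LinearMap.range D.toLinearMap) : D (s z) = z :=
    congrArg Subtype.val (LinearMap.congr_fun hs z)
  refine ⟨LinearMap.toContinuousLinearMap
    (s ∘ₗ (LinearMap.range D.toLinearMap).projectionOnto F hF), fun w => ?_, fun v => ?_⟩
  · simp [hs', Submodule.projectionOnto_projection]
  · have : (LinearMap.range D.toLinearMap).projectionOnto F hF (D v) = ⟨D v, ⟨v, rfl⟩⟩ :=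
      Submodule.projectionOnto_apply_of_mem_left _ _
    simp [hs', this]

/-- The image of a smooth family of linear maps of constant rank admits a smooth family of
projections. -/
theorem exists_contDiffAt_projection {D : X → V →L[ℝ] W} {y₀ : X} (hD : ContDiffAt ℝ ∞ D y₀)
    (hr : ∀ᶠ y in nhds y₀, Module.finrank ℝ (LinearMap.range (D y).toLinearMap) =
      Module.finrank ℝ (LinearMap.range (D y₀).toLinearMap)) :
    ∃ P : X → W →L[ℝ] W, ContDiffAt ℝ ∞ P y₀ ∧ ∀ᶠ y in nhds y₀,
      (∀ w, P y w ∈ LinearMap.range (D y).toLinearMap) ∧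
      ∀ w ∈ LinearMap.range (D y).toLinearMap, P y w = w := by
  obtain ⟨C, hC, hC'⟩ := exists_pseudoInverse (D y₀)
  -- This is chosen so that `B y ∘ D y₀ ∘ C = D y ∘ C`. Near `y₀`, where `B y` is invertible, `D y ∘
  -- C ∘ (B y)⁻¹` is thus the conjugate by `B y` of the projection `D y₀ ∘ C`.
  let B (y : X) : W →L[ℝ] W := ContinuousLinearMap.id ℝ W + (D y - D y₀).comp C
  have hB : ContDiffAt ℝ ∞ B y₀ :=
    contDiffAt_const.add ((hD.sub contDiffAt_const).clm_comp contDiffAt_const)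
  have hB0 : B y₀ = (ContinuousLinearEquiv.refl ℝ W : W →L[ℝ] W) := by
    ext w; simp [B]
  have hBinv : ∀ᶠ y in nhds y₀, ∃ e : W ≃L[ℝ] W, (e : W →L[ℝ] W) = B y := by
    have : CompleteSpace W := FiniteDimensional.complete ℝ W
    have h := ContinuousLinearEquiv.nhds (𝕜 := ℝ) (ContinuousLinearEquiv.refl ℝ W)
    rw [← hB0] at h
    exact hB.continuousAt.eventually h
  refine ⟨fun y => (D y).comp (C.comp (B y).inverse), hD.clm_comp (contDiffAt_const.clm_comp
    (contDiffAt_inverse hB ?_)), ?_⟩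
  · rw [hB0]; exact (ContinuousLinearEquiv.refl ℝ W).injective
  filter_upwards [hr, hBinv] with y hy ⟨e, he⟩
  have hBC (w : W) : B y (D y₀ (C w)) = D y (C w) := by
    simp [B, hC]
  have hP (w : W) : D y (C ((B y).inverse w)) = e (D y₀ (C (e.symm w))) := by
    rw [← he, ContinuousLinearMap.inverse_equiv, ← hBC, ← he]; rfl
  refine ⟨fun w => ⟨C ((B y).inverse w), rfl⟩, fun w hw => ?_⟩
  have hle : (LinearMap.range (D y₀).toLinearMap).map e.toLinearEquiv.toLinearMap ≤
      LinearMap.range (D y).toLinearMap := by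
    rintro _ ⟨_, ⟨v, rfl⟩, rfl⟩
    refine ⟨C (D y₀ v), ?_⟩
    have h1 : e (D y₀ (C (D y₀ v))) = D y (C (D y₀ v)) := by
      rw [← hBC, ← he]; rfl
    rw [hC'] at h1
    exact h1.symm
  -- Constancy of the rank is used here: `B y` maps the image of `D y₀` into that of `D y`, and the
  -- dimensions agree.
  have heq := Submodule.eq_of_le_of_finrank_eq hle (by
    rw [hy]; exact LinearEquiv.finrank_map_eq e.toLinearEquiv _)
  rw [← heq] at hw
  obtain ⟨_, ⟨v, rfl⟩, rfl⟩ := hw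
  change D y (C ((B y).inverse (e (D y₀ v)))) = e (D y₀ v)
  rw [hP, e.symm_apply_apply, hC']

/-- Smoothness of the solution of a linear equation in a bundle of images of constant rank. -/
theorem contDiffAt_of_apply_eq {D : X → V →L[ℝ] W} {T : X → W →L[ℝ] W} {β η : X → W} {y₀ : X}
    (hD : ContDiffAt ℝ ∞ D y₀) (hT : ContDiffAt ℝ ∞ T y₀) (hβ : ContDiffAt ℝ ∞ β y₀)
    (hr : ∀ᶠ y in nhds y₀, Module.finrank ℝ (LinearMap.range (D y).toLinearMap) =
      Module.finrank ℝ (LinearMap.range (D y₀).toLinearMap))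
    (hTD : ∀ᶠ y in nhds y₀, ∀ w ∈ LinearMap.range (D y).toLinearMap,
      T y w ∈ LinearMap.range (D y).toLinearMap ∧ (T y w = 0 → w = 0))
    (hη : ∀ᶠ y in nhds y₀, η y ∈ LinearMap.range (D y).toLinearMap ∧ T y (η y) = β y) :
    ContDiffAt ℝ ∞ η y₀ := by
  obtain ⟨P, hP, hPD⟩ := exists_contDiffAt_projection hD hr
  -- Extend `T y` from the image of `D y` to all of `W` by the identity on the kernel of `P y`. The
  -- extension is invertible and `A y (η y) = β y`, so `η = A⁻¹ β` inherits smoothness.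
  let A (y : X) : W →L[ℝ] W := (T y).comp (P y) + (ContinuousLinearMap.id ℝ W - P y)
  have hA : ContDiffAt ℝ ∞ A y₀ := (hT.clm_comp hP).add (contDiffAt_const.sub hP)
  have hAinj : ∀ᶠ y in nhds y₀, Function.Injective (A y) := by
    filter_upwards [hTD, hPD] with y hy ⟨hy1, hy2⟩
    rw [injective_iff_map_eq_zero]
    intro w hw
    have hw' : T y (P y w) + (w - P y w) = 0 := hw
    have h1 := congrArg (P y) hw'
    rw [map_add, map_sub, hy2 _ (hy1 w), sub_self, add_zero, map_zero,
      hy2 _ (hy _ (hy1 w)).1] at h1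
    have h2 := (hy _ (hy1 w)).2 h1
    rw [h2, map_zero, zero_add, sub_zero] at hw'
    exact hw'
  refine ((contDiffAt_inverse hA hAinj.self_of_nhds).clm_apply hβ).congr_of_eventuallyEq ?_
  filter_upwards [hAinj, hη, hPD] with y hy ⟨hy1, hy2⟩ ⟨hy3, hy4⟩
  obtain ⟨e, he⟩ := isInvertible_of_injective _ hy
  have h1 : A y (η y) = β y := by
    simp [A, hy4 _ hy1, hy2]
  rw [← h1, ← he, ContinuousLinearMap.inverse_equiv]
  simp

end ConstantRank

/-! ### Smoothness of `δ` and `d₀` in charts. -/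

section ChartOperators

variable {n : ℕ} {M : Type*} [TopologicalSpace M] [ChartedSpace (Model n) M]
  [IsManifold (𝓡 n) ∞ M]

theorem contDiffOn_wedge {k : ℕ} {s : Set (Model n)} {ξ : Model n → Model n →L[ℝ] ℝ}
    {α : Model n → AltForm n k} (hξ : ContDiffOn ℝ ∞ ξ s) (hα : ContDiffOn ℝ ∞ α s) :
    ContDiffOn ℝ ∞ (fun y => wedgeLM n k (ξ y) (α y)) s :=
  ((LinearMap.toContinuousBilinearMap (wedgeLM n k)).contDiff.comp_contDiffOn hξ).clm_apply hα

theorem contDiffOn_contract {k : ℕ} {s : Set (Model n)} {v : Model n → Model n}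
    {α : Model n → AltForm n (k + 1)} (hv : ContDiffOn ℝ ∞ v s) (hα : ContDiffOn ℝ ∞ α s) :
    ContDiffOn ℝ ∞ (fun y => contractLM n k (v y) (α y)) s :=
  ((LinearMap.toContinuousBilinearMap (contractLM n k)).contDiff.comp_contDiffOn hv).clm_apply hα

theorem contDiffOn_lieBoundary {s : Set (Model n)}
    {B : Model n → (Model n →L[ℝ] ℝ) →ₗ[ℝ] (Model n →L[ℝ] ℝ) →ₗ[ℝ] (Model n →L[ℝ] ℝ)}
    (hB : ∀ i j, ContDiffOn ℝ ∞ (fun y => B y (EuclideanSpace.proj i) (EuclideanSpace.proj j)) s)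
    {k : ℕ} {α : Model n → AltForm n (k + 1)} (hα : ContDiffOn ℝ ∞ α s) :
    ContDiffOn ℝ ∞ (fun y => lieBoundary (B y) k (α y)) s := by
  obtain _ | k := k
  · exact contDiffOn_const
  simp only [lieBoundary_apply]
  exact ContDiffOn.const_smul (1 / 2 : ℝ) (ContDiffOn.sum fun i _ => ContDiffOn.sum fun j _ =>
    contDiffOn_wedge (hB i j) (contDiffOn_contract contDiffOn_const
      (contDiffOn_contract contDiffOn_const hα)))

theorem contDiffOn_lieCoboundary {s : Set (Model n)}
    {b : Model n → Model n →ₗ[ℝ] Model n →ₗ[ℝ] Model n}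
    (hb : ∀ u v, ContDiffOn ℝ ∞ (fun y => b y u v) s)
    {k : ℕ} {α : Model n → AltForm n k} (hα : ContDiffOn ℝ ∞ α s) :
    ContDiffOn ℝ ∞ (fun y => lieCoboundary (b y) k (α y)) s := by
  obtain _ | k := k
  · exact contDiffOn_const
  simp only [lieCoboundary, LinearMap.smul_apply, LinearMap.sum_apply, LinearMap.comp_apply]
  exact ContDiffOn.const_smul (1 / 2 : ℝ) (ContDiffOn.sum fun i _ => ContDiffOn.sum fun j _ =>
    contDiffOn_wedge contDiffOn_const (contDiffOn_wedge contDiffOn_const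
      (contDiffOn_contract (hb _ _) hα)))

variable (γ : Metric n M) (E : Subbundle n M)

theorem Metric.isInvertible_inChart (c : M) {y : Model n}
    (hy : y ∈ (extChartAt (𝓡 n) c).target) : (γ.inChart c y).IsInvertible ∧
      ∀ ξ, (γ.inChart c y).inverse ξ = (chartEquiv c hy).symm
        ((γ.modelFlat ((extChartAt (𝓡 n) c).symm y)).symm
          (ξ.comp ((chartEquiv c hy).symm : Model n →L[ℝ] Model n))) := by
  have h1 (ξ) : γ.inChart c y ((chartEquiv c hy).symm
      ((γ.modelFlat ((extChartAt (𝓡 n) c).symm y)).symm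
        (ξ.comp ((chartEquiv c hy).symm : Model n →L[ℝ] Model n)))) = ξ := by
    ext v
    rw [γ.inChart_apply, ← coe_chartEquiv c hy, ← γ.modelFlat_apply]
    simp
  have h2 : Function.Injective (γ.inChart c y) := by
    rw [injective_iff_map_eq_zero]
    intro u hu
    have h3 := congrArg (fun ξ : Model n →L[ℝ] ℝ => ξ u) hu
    simp only [γ.inChart_apply, zero_apply] at h3
    have h4 : chartFrame c y u = 0 := by
      by_contra h0
      exact (γ.modelInner_pos _ h0).ne' h3
    rw [← inverse_chartFrame_apply c hy u, h4, map_zero]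
  have h5 : (γ.inChart c y).IsInvertible :=
    ⟨(LinearEquiv.ofBijective (γ.inChart c y).toLinearMap
      ⟨h2, fun ξ => ⟨_, h1 ξ⟩⟩).toContinuousLinearEquiv, by ext u v; rfl⟩
  refine ⟨h5, fun ξ => ?_⟩
  obtain ⟨e, he⟩ := h5
  have h6 := h1 ξ
  rw [← he] at h6 ⊢
  rw [ContinuousLinearMap.inverse_equiv]
  exact (e.symm_apply_eq.2 h6.symm)

/-- The bracket of `T*M` in the preferred chart at `c`. -/
def Metric.dualBracketInChart (c : M) (y : Model n) :
    (Model n →L[ℝ] ℝ) →ₗ[ℝ] (Model n →L[ℝ] ℝ) →ₗ[ℝ] (Model n →L[ℝ] ℝ) :=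
  ((γ.bracketInChart E c y).compl₁₂ (γ.inChart c y).inverse.toLinearMap
    (γ.inChart c y).inverse.toLinearMap).compr₂ (γ.inChart c y).toLinearMap

theorem Metric.dualBracketInChart_apply (c : M) (y : Model n) (ξ η : Model n →L[ℝ] ℝ) :
    γ.dualBracketInChart E c y ξ η = γ.inChart c y (γ.bracketInChart E c y
      ((γ.inChart c y).inverse ξ) ((γ.inChart c y).inverse η)) := rfl

theorem Metric.dualBracketInChart_eq_transportDual (c : M) {y : Model n}
    (hy : y ∈ (extChartAt (𝓡 n) c).target) : γ.dualBracketInChart E c y =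
      transportDual (dualBracket (γ.modelFlat ((extChartAt (𝓡 n) c).symm y))
        (γ.modelBracket E ((extChartAt (𝓡 n) c).symm y))) (chartEquiv c hy) := by
  refine LinearMap.ext fun ξ => LinearMap.ext fun η => ContinuousLinearMap.ext fun v => ?_
  rw [dualBracketInChart_apply, transportDual_apply, dualBracket_apply, γ.inChart_apply,
    (γ.isInvertible_inChart c hy).2, (γ.isInvertible_inChart c hy).2,
    bracketInChart_eq_transport γ E c hy, transport_apply, ← γ.modelFlat_apply,
    ← coe_chartEquiv c hy]
  simp

theorem Metric.contDiffOn_dualBracketInChart (c : M) (ξ η : Model n →L[ℝ] ℝ) :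
    ContDiffOn ℝ ∞ (fun y => γ.dualBracketInChart E c y ξ η) (extChartAt (𝓡 n) c).target := by
  have hinv : ContDiffOn ℝ ∞ (fun y => (γ.inChart c y).inverse) (extChartAt (𝓡 n) c).target := by
    intro y hy
    obtain ⟨e, he⟩ := (γ.isInvertible_inChart c hy).1
    have h1 : ContDiffAt ℝ ∞ ContinuousLinearMap.inverse (γ.inChart c y) := by
      rw [← he]
      exact contDiffAt_map_inverse e
    exact h1.comp_contDiffWithinAt y (γ.contDiffOn_inChart c y hy)
  have hb (u v : Model n → Model n) (hu : ContDiffOn ℝ ∞ u (extChartAt (𝓡 n) c).target)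
      (hv : ContDiffOn ℝ ∞ v (extChartAt (𝓡 n) c).target) :
      ContDiffOn ℝ ∞ (fun y => γ.bracketInChart E c y (u y) (v y))
        (extChartAt (𝓡 n) c).target := by
    have h1 (y) : γ.bracketInChart E c y (u y) (v y) = ∑ i, ∑ j, (u y i * v y j) •
        γ.bracketInChart E c y (EuclideanSpace.single i 1) (EuclideanSpace.single j 1) := by
      conv_lhs => rw [← sum_proj_smul_single (u y), ← sum_proj_smul_single (v y)]
      simp only [map_sum, map_smul, LinearMap.sum_apply, LinearMap.smul_apply, Finset.smul_sum]
      rw [Finset.sum_comm]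
      refine Finset.sum_congr rfl fun i _ => Finset.sum_congr rfl fun j _ => ?_
      rw [smul_smul, mul_comm]
    simp only [h1]
    have h2 (f : Model n → Model n) (hf : ContDiffOn ℝ ∞ f (extChartAt (𝓡 n) c).target) (i) :
        ContDiffOn ℝ ∞ (fun y => f y i) (extChartAt (𝓡 n) c).target :=
      (EuclideanSpace.proj i : Model n →L[ℝ] ℝ).contDiff.comp_contDiffOn hf
    exact ContDiffOn.sum fun i _ => ContDiffOn.sum fun j _ =>
      ((h2 u hu i).mul (h2 v hv j)).smul (γ.contDiffOn_bracketInChart E c _ _)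
  exact (γ.contDiffOn_inChart c).clm_apply (hb _ _ (hinv.clm_apply contDiffOn_const)
    (hinv.clm_apply contDiffOn_const))

end ChartOperators

/-! ### The operators `δ` and `d₀` on smooth forms, and smoothness of the inverse of `δ d₀`. -/

section SmoothFields

variable {n : ℕ} {M : Type*} [TopologicalSpace M] [ChartedSpace (Model n) M]

/-- The expression `inChart` of a form in the preferred chart at `c`, on the model space. -/
def pull {k : ℕ} (c : M) (α : M → AltForm n k) (y : Model n) : AltForm n k :=
  (α ((extChartAt (𝓡 n) c).symm y)).compContinuousLinearMap (chartFrame c y)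

/-- The predicate `IsSmoothForm`, for forms with values in the model space. -/
def IsSmoothField {k : ℕ} (α : M → AltForm n k) : Prop :=
  ∀ c : M, ContDiffOn ℝ ∞ (pull c α) (extChartAt (𝓡 n) c).target

theorem pull_apply {k : ℕ} (c : M) (α : M → AltForm n k) (y : Model n) (v : Fin k → Model n) :
    pull c α y v = α ((extChartAt (𝓡 n) c).symm y) (fun i => chartFrame c y (v i)) := rfl

theorem isSmoothField_iff_contDiffAt {k : ℕ} {α : M → AltForm n k} : IsSmoothField α ↔
    ∀ c : M, ∀ y ∈ (extChartAt (𝓡 n) c).target, ContDiffAt ℝ ∞ (pull c α) y :=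
  forall_congr' fun c => ⟨fun h y hy => h.contDiffAt ((isOpen_extChartAt_target c).mem_nhds hy),
    fun h y hy => (h y hy).contDiffWithinAt⟩

theorem IsSmoothField.add {k : ℕ} {α β : M → AltForm n k} (hα : IsSmoothField α)
    (hβ : IsSmoothField β) : IsSmoothField fun x => α x + β x :=
  fun c => (hα c).add (hβ c)

variable [IsManifold (𝓡 n) ∞ M]

theorem pull_eq {k : ℕ} (c : M) (α : M → AltForm n k) {y : Model n}
    (hy : y ∈ (extChartAt (𝓡 n) c).target) : pull c α y =
      (α ((extChartAt (𝓡 n) c).symm y)).compContinuousLinearMap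
        (chartEquiv c hy : Model n →L[ℝ] Model n) := by
  rw [coe_chartEquiv]; rfl

/-- Smoothness is a local property. -/
theorem isSmoothField_of_eventuallyEq {k : ℕ} {α : M → AltForm n k}
    (h : ∀ x : M, ∃ β : M → AltForm n k, IsSmoothField β ∧ α =ᶠ[nhds x] β) : IsSmoothField α := by
  rw [isSmoothField_iff_contDiffAt]
  intro c y hy
  obtain ⟨β, hβ, hαβ⟩ := h ((extChartAt (𝓡 n) c).symm y)
  refine (isSmoothField_iff_contDiffAt.1 hβ c y hy).congr_of_eventuallyEq ?_
  filter_upwards [(contMDiffAt_symm c hy).continuousAt.eventually hαβ] with z hz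
  rw [pull, pull, hz]

variable (γ : Metric n M) (E : Subbundle n M)

/-- The boundary map `δ` at `x`, on the model space. -/
def Metric.boundary (k : ℕ) (x : M) : AltForm n (k + 1) →ₗ[ℝ] AltForm n k :=
  lieBoundary (dualBracket (γ.modelFlat x) (γ.modelBracket E x)) k

/-- The coboundary map of the bracket of the tangent space at `x`, on the model space. -/
def Metric.coboundary (k : ℕ) (x : M) : AltForm n k →ₗ[ℝ] AltForm n (k + 1) :=
  lieCoboundary (γ.modelBracket E x) k

theorem Metric.pull_boundary (c : M) (k : ℕ) (α : M → AltForm n (k + 1)) {y : Model n}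
    (hy : y ∈ (extChartAt (𝓡 n) c).target) : pull c (fun x => γ.boundary E k x (α x)) y =
      lieBoundary (γ.dualBracketInChart E c y) k (pull c α y) := by
  rw [pull_eq c _ hy, pull_eq c _ hy, γ.dualBracketInChart_eq_transportDual E c hy]
  exact lieBoundary_compContinuousLinearMap _ _ _ _

theorem Metric.pull_coboundary (c : M) (k : ℕ) (α : M → AltForm n k) {y : Model n}
    (hy : y ∈ (extChartAt (𝓡 n) c).target) : pull c (fun x => γ.coboundary E k x (α x)) y =
      lieCoboundary (γ.bracketInChart E c y) k (pull c α y) := by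
  rw [pull_eq c _ hy, pull_eq c _ hy, γ.bracketInChart_eq_transport E c hy]
  exact lieCoboundary_compContinuousLinearMap _ _ _ _

theorem Metric.isSmoothField_boundary {k : ℕ} {α : M → AltForm n (k + 1)} (hα : IsSmoothField α) :
    IsSmoothField fun x => γ.boundary E k x (α x) := fun c =>
  (contDiffOn_lieBoundary (fun i j => γ.contDiffOn_dualBracketInChart E c _ _) (hα c)).congr
    fun _ hy => γ.pull_boundary E c k α hy

theorem Metric.isSmoothField_coboundary {k : ℕ} {α : M → AltForm n k} (hα : IsSmoothField α) :
    IsSmoothField fun x => γ.coboundary E k x (α x) := fun c =>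
  (contDiffOn_lieCoboundary (fun i j => γ.contDiffOn_bracketInChart E c _ _) (hα c)).congr
    fun _ hy => γ.pull_coboundary E c k α hy

/-- The pullback of alternating forms along a linear automorphism. -/
def pullEquiv (k : ℕ) (A : Model n ≃L[ℝ] Model n) : AltForm n k ≃ₗ[ℝ] AltForm n k where
  toFun α := α.compContinuousLinearMap (A : Model n →L[ℝ] Model n)
  invFun α := α.compContinuousLinearMap (A.symm : Model n →L[ℝ] Model n)
  map_add' _ _ := rfl
  map_smul' _ _ := rfl
  left_inv α := by ext v; simp [Function.comp_def]
  right_inv α := by ext v; simp [Function.comp_def]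

/-- Naturality of `δ` under the differential of the chart; it transfers the constancy of the rank
from `M` to the chart. -/
theorem Metric.range_lieBoundary_dualBracketInChart (c : M) (k : ℕ) {y : Model n}
    (hy : y ∈ (extChartAt (𝓡 n) c).target) :
    LinearMap.range (lieBoundary (γ.dualBracketInChart E c y) k) =
      (LinearMap.range (γ.boundary E k ((extChartAt (𝓡 n) c).symm y))).map
        (pullEquiv k (chartEquiv c hy)).toLinearMap := by
  have h (α : AltForm n (k + 1)) : pullEquiv k (chartEquiv c hy)
      (γ.boundary E k ((extChartAt (𝓡 n) c).symm y) α) =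
      lieBoundary (γ.dualBracketInChart E c y) k (pullEquiv (k + 1) (chartEquiv c hy) α) := by
    rw [γ.dualBracketInChart_eq_transportDual E c hy]
    exact lieBoundary_compContinuousLinearMap _ _ _ _
  apply le_antisymm
  · rintro _ ⟨α, rfl⟩
    refine ⟨_, ⟨(pullEquiv (k + 1) (chartEquiv c hy)).symm α, rfl⟩, ?_⟩
    rw [LinearEquiv.coe_coe, h, LinearEquiv.apply_symm_apply]
  · rintro _ ⟨_, ⟨α, rfl⟩, rfl⟩
    exact ⟨_, (h α).symm⟩

theorem Metric.boundary_coboundary_eq_zero {k : ℕ} {x : M} {α : AltForm n k}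
    (hα : α ∈ LinearMap.range (γ.boundary E k x))
    (h : γ.boundary E k x (γ.coboundary E k x α) = 0) : α = 0 := by
  obtain ⟨β, rfl⟩ := hα
  exact (γ.isHeisenbergBracket E x).lieBoundary_eq_zero h

/-- The inverse of `δ d₀` on sections of the image of `δ` preserves smoothness. -/
theorem Metric.isSmoothField_of_boundary_coboundary_eq {k : ℕ}
    (hr : IsLocallyConstant fun x : M => Module.finrank ℝ (LinearMap.range (γ.boundary E k x)))
    {η β : M → AltForm n k} (hη : ∀ x, η x ∈ LinearMap.range (γ.boundary E k x))
    (hβ : IsSmoothField β) (h : ∀ x, γ.boundary E k x (γ.coboundary E k x (η x)) = β x) :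
    IsSmoothField η := by
  rw [isSmoothField_iff_contDiffAt]
  intro c y₀ hy₀
  let D (y : Model n) : AltForm n (k + 1) →L[ℝ] AltForm n k :=
    LinearMap.toContinuousLinearMap (lieBoundary (γ.dualBracketInChart E c y) k)
  let C (y : Model n) : AltForm n k →L[ℝ] AltForm n (k + 1) :=
    LinearMap.toContinuousLinearMap (lieCoboundary (γ.bracketInChart E c y) k)
  have hnhds := (isOpen_extChartAt_target (I := 𝓡 n) c).mem_nhds hy₀
  have hD : ContDiffAt ℝ ∞ D y₀ := (contDiffOn_clm_apply.2 fun α => contDiffOn_lieBoundary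
    (fun i j => γ.contDiffOn_dualBracketInChart E c _ _) contDiffOn_const).contDiffAt hnhds
  have hC : ContDiffAt ℝ ∞ C y₀ := (contDiffOn_clm_apply.2 fun α => contDiffOn_lieCoboundary
    (fun i j => γ.contDiffOn_bracketInChart E c _ _) contDiffOn_const).contDiffAt hnhds
  have hrange {y : Model n} (hy : y ∈ (extChartAt (𝓡 n) c).target) :=
    γ.range_lieBoundary_dualBracketInChart E c k hy
  have hfin {y : Model n} (hy : y ∈ (extChartAt (𝓡 n) c).target) :
      Module.finrank ℝ (LinearMap.range (D y).toLinearMap) =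
        Module.finrank ℝ (LinearMap.range (γ.boundary E k ((extChartAt (𝓡 n) c).symm y))) := by
    change Module.finrank ℝ (LinearMap.range (lieBoundary (γ.dualBracketInChart E c y) k)) = _
    rw [hrange hy]
    exact LinearEquiv.finrank_map_eq _ _
  have hmem {y : Model n} (hy : y ∈ (extChartAt (𝓡 n) c).target) (w : AltForm n k) :
      pullEquiv k (chartEquiv c hy) w ∈ LinearMap.range (D y).toLinearMap ↔
        w ∈ LinearMap.range (γ.boundary E k ((extChartAt (𝓡 n) c).symm y)) := by
    change _ ∈ LinearMap.range (lieBoundary (γ.dualBracketInChart E c y) k) ↔ _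
    rw [hrange hy]
    refine ⟨?_, fun hw => ⟨w, hw, rfl⟩⟩
    rintro ⟨w', hw', h'⟩
    rwa [← (pullEquiv k (chartEquiv c hy)).injective h']
  have hDC {y : Model n} (hy : y ∈ (extChartAt (𝓡 n) c).target) (w : AltForm n k) :
      D y (C y (pullEquiv k (chartEquiv c hy) w)) = pullEquiv k (chartEquiv c hy)
        (γ.boundary E k ((extChartAt (𝓡 n) c).symm y)
          (γ.coboundary E k ((extChartAt (𝓡 n) c).symm y) w)) := by
    change lieBoundary _ k (lieCoboundary _ k _) = _
    rw [γ.dualBracketInChart_eq_transportDual E c hy, γ.bracketInChart_eq_transport E c hy]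
    symm
    refine (lieBoundary_compContinuousLinearMap _ _ _ _).trans (congrArg _ ?_)
    exact lieCoboundary_compContinuousLinearMap _ _ _ _
  -- In the chart, `D` represents `δ` and `D ∘ C` represents `δ d₀`, which preserves the image of
  -- `δ` and is injective on it.
  refine contDiffAt_of_apply_eq hD (hD.clm_comp hC)
    (isSmoothField_iff_contDiffAt.1 hβ c y₀ hy₀) ?_ ?_ ?_
  · filter_upwards [hnhds, (contMDiffAt_symm c hy₀).continuousAt.eventually
      (hr.eventually_eq _)] with y hy hy'
    rw [hfin hy, hfin hy₀]
    exact hy'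
  · filter_upwards [hnhds] with y hy w hw
    refine ⟨⟨_, rfl⟩, fun h0 => ?_⟩
    obtain ⟨w, rfl⟩ := (pullEquiv k (chartEquiv c hy)).surjective w
    rw [ContinuousLinearMap.comp_apply, hDC hy] at h0
    rw [γ.boundary_coboundary_eq_zero E ((hmem hy w).1 hw)
      ((pullEquiv k (chartEquiv c hy)).map_eq_zero_iff.1 h0), map_zero]
  · filter_upwards [hnhds] with y hy
    rw [pull_eq c _ hy, pull_eq c _ hy]
    refine ⟨(hmem hy _).2 (hη _), ?_⟩
    refine (hDC hy _).trans ?_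
    rw [h]
    rfl

end SmoothFields

/-! ### Weights and the exterior derivative: `d + d₀` raises weight. -/

section WeightRaising

variable {n : ℕ}

theorem countIn_mono {E F : Submodule ℝ (Model n)} {k : ℕ} {u v : Fin k → Model n}
    (h : ∀ i, u i ∈ E → v i ∈ F) : countIn E u ≤ countIn F v := by
  refine Finset.sum_le_sum fun i _ => ?_
  by_cases hi : u i ∈ E
  · rw [if_pos hi, if_pos (h i hi)]
  · rw [if_neg hi]; exact Nat.zero_le _

/-- Antisymmetry of `b` pairs equal terms and absorbs the factor ½. The index `j ≥ i` stands for the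
entry `j + 1 > i`, as in the bracket terms of Cartan's formula `extDeriv_apply_vectorField`. -/
theorem lieCoboundary_apply_apply_triangle {b : Model n →ₗ[ℝ] Model n →ₗ[ℝ] Model n}
    (hb : ∀ u v, b u v = -b v u) {k : ℕ} (α : AltForm n (k + 1)) (v : Fin (k + 2) → Model n) :
    lieCoboundary b (k + 1) α v = ∑ i : Fin (k + 1), ∑ j ≥ i, (-1) ^ (i + j : ℕ) *
      α (Matrix.vecCons (b (v i.castSucc) (v j.succ)) (j.removeNth (i.castSucc.removeNth v))) := by
  rw [lieCoboundary_apply_apply, Fin.sum_sum_eq_sum_triangle_add, Finset.mul_sum]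
  refine Finset.sum_congr rfl fun i _ => ?_
  rw [Finset.mul_sum]
  refine Finset.sum_congr rfl fun j hj => ?_
  rw [Finset.mem_Ici] at hj
  have h1 : i.castSucc.succAbove j = j.succ := by simp [Fin.succAbove_of_le_castSucc, hj]
  have h2 : j.predAbove i.castSucc = i := by simp [Fin.predAbove_of_le_castSucc, hj]
  have h3 : j.succ.succAbove i = i.castSucc := by simp [Fin.succAbove_of_castSucc_lt, hj]
  have h4 : j.removeNth (i.castSucc.removeNth v) = i.removeNth (j.succ.removeNth v) := by
    rw [Fin.removeNth_removeNth_eq_swap, h1, h2]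
  have h5 (w : Fin k → Model n) : α (Matrix.vecCons (b (v j.succ) (v i.castSucc)) w) =
      -α (Matrix.vecCons (b (v i.castSucc) (v j.succ)) w) := by
    rw [hb, ← contractLM_apply, map_neg]; rfl
  rw [h1, h3, ← h4, h5, Fin.val_castSucc, Fin.val_succ]
  ring

/-- The exterior derivative of a form of weight `w` is given up to terms of higher weight by the
brackets of sections of the distribution. -/
theorem extDeriv_add_lieCoboundary_mem {F : Model n → Submodule ℝ (Model n)} {y₀ : Model n}
    {b : Model n →ₗ[ℝ] Model n →ₗ[ℝ] Model n} (hb : ∀ u v, b u v = -b v u)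
    {X : Model n → Model n → Model n} (hX : ∀ u ∈ F y₀, X u y₀ = u)
    (hXd : ∀ u ∈ F y₀, DifferentiableAt ℝ (X u) y₀)
    (hXF : ∀ u ∈ F y₀, ∀ᶠ y in nhds y₀, X u y ∈ F y)
    (hXb : ∀ u ∈ F y₀, ∀ v ∈ F y₀, VectorField.lieBracket ℝ (X u) (X v) y₀ - b u v ∈ F y₀)
    {k w : ℕ} {β : Model n → AltForm n k} (hβ : DifferentiableAt ℝ β y₀)
    (hβF : ∀ᶠ y in nhds y₀, β y ∈ weightFiltration (F y) w k) :
    extDeriv β y₀ + lieCoboundary b k (β y₀) ∈ weightFiltration (F y₀) (w + 1) (k + 1) := by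
  classical
  intro v hv
  obtain _ | k := k
  -- For functions the hypothesis on `v` forces `w > 0`, since `countIn` is at most 1; a function of
  -- positive weight vanishes.
  · have hw : 0 < w := by
      have := countIn_le (F y₀) v
      omega
    have h0 : β =ᶠ[nhds y₀] fun _ => 0 := by
      filter_upwards [hβF] with y hy using eq_zero_of_mem_weightFiltration hy (by omega)
    have h1 : extDeriv β y₀ = 0 := by
      ext u
      simp [extDeriv, h0.fderiv_eq, ContinuousAlternatingMap.alternatizeUncurryFin_apply]
    rw [ContinuousAlternatingMap.add_apply, h1]
    exact add_zero (0 : ℝ)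
  -- Entries in the distribution are extended to sections of it, so that weights can be counted at
  -- nearby points; the others are extended as constants.
  let V (i : Fin (k + 2)) : Model n → Model n := if v i ∈ F y₀ then X (v i) else fun _ => v i
  have hV (i) : V i y₀ = v i := by
    simp only [V]; split_ifs with h
    · exact hX _ h
    · rfl
  have hVd (i) : DifferentiableAt ℝ (V i) y₀ := by
    simp only [V]; split_ifs with h
    · exact hXd _ h
    · exact differentiableAt_const _
  have hVF : ∀ᶠ y in nhds y₀, ∀ i, v i ∈ F y₀ → V i y ∈ F y := by
    refine Filter.eventually_all.2 fun i => ?_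
    by_cases h : v i ∈ F y₀
    · simp only [V, if_pos h]
      exact (hXF _ h).mono fun y hy _ => hy
    · exact Filter.Eventually.of_forall fun y h' => absurd h' h
  have h1 := extDeriv_apply_vectorField (x := y₀) hβ hVd
  have hVv : (fun i => V i y₀) = v := funext hV
  rw [hVv] at h1
  rw [ContinuousAlternatingMap.add_apply, h1, lieCoboundary_apply_apply_triangle hb]
  -- Deleting one entry lowers `countIn` by at most one, so `β` vanishes on the remaining fields
  -- throughout a neighbourhood, and its derivative is zero.
  have h2 (i : Fin (k + 2)) :
      fderiv ℝ (fun y => β y (i.removeNth fun j => V j y)) y₀ (v i) = 0 := by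
    have h3 : (fun y => β y (i.removeNth fun j => V j y)) =ᶠ[nhds y₀] fun _ => 0 := by
      filter_upwards [hβF, hVF] with y hy hy'
      refine hy _ ?_
      have h4 : countIn (F y₀) (i.removeNth v) ≤ countIn (F y) (i.removeNth fun j => V j y) :=
        countIn_mono fun j => hy' (i.succAbove j)
      rw [countIn_removeNth _ i] at hv
      split_ifs at hv <;> omega
    rw [h3.fderiv_eq, fderiv_fun_const]
    rfl
  simp only [hV, h2, smul_zero, Finset.sum_const_zero, zero_sub]
  rw [neg_add_eq_zero]
  refine Finset.sum_congr rfl fun i _ => Finset.sum_congr rfl fun j hj => ?_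
  rw [Finset.mem_Ici] at hj
  rw [zsmul_eq_mul]
  push_cast
  congr 1
  rw [← sub_eq_zero, ← contractLM_apply, ← contractLM_apply, ← ContinuousAlternatingMap.sub_apply,
    ← LinearMap.sub_apply, ← map_sub, contractLM_apply]
  refine hβF.self_of_nhds _ ?_
  rw [countIn_vecCons]
  have h5 : i.castSucc.removeNth v j = v j.succ := by
    simp [Fin.removeNth_apply, Fin.succAbove_of_le_castSucc, hj]
  rw [countIn_removeNth _ i.castSucc, countIn_removeNth _ j, h5] at hv
  -- If both entries lie in `F y₀`, two are lost, but the difference of Lie bracket and `b` lies in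
  -- `F y₀` and restores one. Otherwise at most one is lost. A loss of one is exactly what weight `w
  -- + 1` allows.
  by_cases hi : v i.castSucc ∈ F y₀
  · by_cases hj : v j.succ ∈ F y₀
    · have h6 := hXb _ hi _ hj
      simp only [V, if_pos hi, if_pos hj, if_pos h6] at hv ⊢
      omega
    · rw [if_pos hi, if_neg hj] at hv
      omega
  · rw [if_neg hi] at hv
    split_ifs at hv <;> omega

variable {M : Type*} [TopologicalSpace M] [ChartedSpace (Model n) M] [IsManifold (𝓡 n) ∞ M]

theorem mem_weightFiltration_pull_iff {k w : ℕ} (c : M) (α : M → AltForm n k) {y : Model n}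
    (hy : y ∈ (extChartAt (𝓡 n) c).target) (F : Submodule ℝ (Model n)) :
    pull c α y ∈ weightFiltration (F.comap (chartFrame c y).toLinearMap) w k ↔
      α ((extChartAt (𝓡 n) c).symm y) ∈ weightFiltration F w k := by
  have h (v : Fin k → Model n) : countIn (F.comap (chartFrame c y).toLinearMap) v =
      countIn F fun i => chartFrame c y (v i) := rfl
  refine ⟨fun hα v hv => ?_, fun hα v hv => hα _ hv⟩
  have h1 := hα (fun i => (chartFrame c y).inverse (v i))
  rw [h, pull_apply] at h1
  simp only [chartFrame_inverse_apply c hy] at h1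
  exact h1 hv

variable (E : Subbundle n M) (γ : Metric n M)

/-- Combinations of a local frame with constant coefficients serve as extensions; the last clause
says that their Lie bracket agrees with the tangent bracket modulo `E`. -/
theorem exists_extension (c : M) {y₀ : Model n} (hy₀ : y₀ ∈ (extChartAt (𝓡 n) c).target) :
    ∃ X : Model n → Model n → Model n, ∀ u ∈ (E.modelFiber ((extChartAt (𝓡 n) c).symm y₀)).comap
        (chartFrame c y₀).toLinearMap, X u y₀ = u ∧ DifferentiableAt ℝ (X u) y₀ ∧
      (∀ᶠ y in nhds y₀, X u y ∈ (E.modelFiber ((extChartAt (𝓡 n) c).symm y)).comap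
        (chartFrame c y).toLinearMap) ∧
      ∀ v ∈ (E.modelFiber ((extChartAt (𝓡 n) c).symm y₀)).comap (chartFrame c y₀).toLinearMap,
        VectorField.lieBracket ℝ (X u) (X v) y₀ - γ.bracketInChart E c y₀ u v ∈
          (E.modelFiber ((extChartAt (𝓡 n) c).symm y₀)).comap (chartFrame c y₀).toLinearMap := by
  let x₀ := (extChartAt (𝓡 n) c).symm y₀
  let Z (a : Fin (E.frameRank x₀) → ℝ) (x : M) : TangentSpace (𝓡 n) x := ∑ i, a i • E.frame x₀ i x
  obtain ⟨-, h1, h2, -, h4⟩ := (E.eventually_frame c hy₀).self_of_nhds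
  have hZ (a) : ContMDiffAt (𝓡 n) (𝓡 n).tangent ∞
      (fun x => (⟨x, Z a x⟩ : TangentBundle (𝓡 n) M)) x₀ :=
    ContMDiffAt.sum_section fun i _ => (h1 i).const_smul_section
  have hZE (a) : ∀ᶠ x in nhds x₀, Z a x ∈ E.fiber x := by
    filter_upwards [h2] with x hx
    exact Submodule.sum_mem _ fun i _ => Submodule.smul_mem _ _ (hx i)
  have hex (u : Model n) : ∃ a, u ∈ (E.modelFiber x₀).comap (chartFrame c y₀).toLinearMap →
      fieldInChart c (Z a) y₀ = u := by
    by_cases hu : u ∈ (E.modelFiber x₀).comap (chartFrame c y₀).toLinearMap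
    · rw [Submodule.mem_comap, ← h4] at hu
      obtain ⟨a, ha⟩ := (Submodule.mem_span_range_iff_exists_fun ℝ).1 hu
      refine ⟨a, fun _ => ?_⟩
      rw [fieldInChart_eq, ← inverse_chartFrame_apply c hy₀ u]
      exact congrArg _ ha
    · exact ⟨0, fun h => absurd h hu⟩
  choose a ha using hex
  refine ⟨fun u => fieldInChart c (Z (a u)), fun u hu => ⟨ha u hu, ?_, ?_, fun v hv => ?_⟩⟩
  · exact (contDiffAt_fieldInChart c hy₀ (hZ _)).differentiableAt (by simp)
  · filter_upwards [(contMDiffAt_symm c hy₀).continuousAt.eventually (hZE (a u)),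
      (isOpen_extChartAt_target c).mem_nhds hy₀] with y hy hy'
    rw [Submodule.mem_comap]
    have h5 := chartFrame_fieldInChart c (Z (a u)) hy'
    change chartFrame c y (fieldInChart c (Z (a u)) y) ∈ _
    rw [h5]
    exact hy
  · have h5 := γ.bracketInChart_fieldInChart E c hy₀ (hZ (a u)) (hZ (a v)) (hZE _) (hZE _)
    rw [ha u hu, ha v hv] at h5
    rw [h5, sub_sub_cancel, Submodule.mem_comap]
    change chartFrame c y₀ ((chartFrame c y₀).inverse _) ∈ _
    rw [chartFrame_inverse_apply c hy₀]
    exact γ.modelProj_mem E _ _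

/-- The exterior derivative of a form, with values in the model space. -/
def extDField {k : ℕ} (α : M → AltForm n k) (x : M) : AltForm n (k + 1) := extD (n := n) α x

theorem pull_extDField {k : ℕ} {α : M → AltForm n k} (hα : IsSmoothField α) (c : M) {y : Model n}
    (hy : y ∈ (extChartAt (𝓡 n) c).target) : pull c (extDField α) y = extDeriv (pull c α) y :=
  inChart_extD (n := n) (α := α) hα c hy

/-- The leading part of `d` for the weight filtration is `-d₀`. This is the only place where the Lie
bracket of vector fields meets the exterior derivative. -/
theorem extDField_add_coboundary_mem {k w : ℕ} {α : M → AltForm n k} (hα : IsSmoothField α)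
    (hw : ∀ x, α x ∈ weightFiltration (E.modelFiber x) w k) (x : M) :
    extDField α x + γ.coboundary E k x (α x) ∈
      weightFiltration (E.modelFiber x) (w + 1) (k + 1) := by
  have hy₀ := mem_extChartAt_target (I := 𝓡 n) x
  have hx : (extChartAt (𝓡 n) x).symm (extChartAt (𝓡 n) x x) = x := extChartAt_to_inv x
  obtain ⟨X, hX⟩ := exists_extension E γ x hy₀
  have h := mem_weightFiltration_pull_iff (w := w + 1) x
    (fun z => extDField α z + γ.coboundary E k z (α z)) hy₀
    (E.modelFiber ((extChartAt (𝓡 n) x).symm (extChartAt (𝓡 n) x x)))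
  have h1 : pull x (fun z => extDField α z + γ.coboundary E k z (α z)) (extChartAt (𝓡 n) x x) =
      extDeriv (pull x α) (extChartAt (𝓡 n) x x) + lieCoboundary
        (γ.bracketInChart E x (extChartAt (𝓡 n) x x)) k (pull x α (extChartAt (𝓡 n) x x)) := by
    rw [← pull_extDField hα x hy₀, ← γ.pull_coboundary E x k α hy₀]
    rfl
  rw [h1] at h
  have h2 := h.1 (extDeriv_add_lieCoboundary_mem
    (F := fun y => (E.modelFiber ((extChartAt (𝓡 n) x).symm y)).comap (chartFrame x y).toLinearMap)
    (fun u v => ?_) (fun u hu => (hX u hu).1)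
    (fun u hu => (hX u hu).2.1) (fun u hu => (hX u hu).2.2.1) (fun u hu => (hX u hu).2.2.2)
    ((isSmoothField_iff_contDiffAt.1 hα x _ hy₀).differentiableAt (by simp)) ?_)
  · rwa [hx] at h2
  · rw [γ.bracketInChart_apply, γ.bracketInChart_apply, ← map_neg]
    congr 1
    exact (γ.isHeisenbergBracket E _).swap _ _
  · filter_upwards [(isOpen_extChartAt_target x).mem_nhds hy₀] with y hy
    exact (mem_weightFiltration_pull_iff x α hy _).2 (hw _)

end WeightRaising

/-! ### Calculus of differential operators defined by commutators. -/

section DifferentialOperators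

variable {C P Q R : Type*} [AddCommGroup P] [Module ℝ P] [AddCommGroup Q] [Module ℝ Q]
  [AddCommGroup R] [Module ℝ R] {mP : C → P →ₗ[ℝ] P} {mQ : C → Q →ₗ[ℝ] Q} {mR : C → R →ₗ[ℝ] R}

theorem isDiffOpOfOrderLE_zero (r : ℕ) : IsDiffOpOfOrderLE mP mQ r (0 : P →ₗ[ℝ] Q) := by
  induction r with
  | zero => intro f; simp
  | succ r ih => intro f; simpa using ih

theorem IsDiffOpOfOrderLE.succ {r : ℕ} {T : P →ₗ[ℝ] Q} (h : IsDiffOpOfOrderLE mP mQ r T) :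
    IsDiffOpOfOrderLE mP mQ (r + 1) T := by
  induction r generalizing T with
  | zero => intro f; rw [h f]; exact isDiffOpOfOrderLE_zero 0
  | succ r ih => intro f; exact ih (h f)

theorem IsDiffOpOfOrderLE.mono {r s : ℕ} (hrs : r ≤ s) {T : P →ₗ[ℝ] Q}
    (h : IsDiffOpOfOrderLE mP mQ r T) : IsDiffOpOfOrderLE mP mQ s T := by
  induction hrs with
  | refl => exact h
  | step _ ih => exact ih.succ

theorem IsDiffOpOfOrderLE.sub {r : ℕ} {S T : P →ₗ[ℝ] Q} (hS : IsDiffOpOfOrderLE mP mQ r S)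
    (hT : IsDiffOpOfOrderLE mP mQ r T) : IsDiffOpOfOrderLE mP mQ r (S - T) := by
  have h (f) : (S - T) ∘ₗ mP f - mQ f ∘ₗ (S - T) =
      (S ∘ₗ mP f - mQ f ∘ₗ S) - (T ∘ₗ mP f - mQ f ∘ₗ T) := by
    rw [LinearMap.sub_comp, LinearMap.comp_sub]; abel
  induction r generalizing S T with
  | zero => intro f; rw [h, hS f, hT f, sub_zero]
  | succ r ih =>
    intro f
    rw [h]
    exact ih (hS f) (hT f) fun g => by rw [LinearMap.sub_comp, LinearMap.comp_sub]; abel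

/-- The commutator obeys `[S T, f] = S [T, f] + [S, f] T`, and both terms have lower total order;
hence an induction on both orders. The sum is written as a difference so that
`IsDiffOpOfOrderLE.sub` applies. -/
theorem IsDiffOpOfOrderLE.comp {r s : ℕ} {S : Q →ₗ[ℝ] R} {T : P →ₗ[ℝ] Q}
    (hS : IsDiffOpOfOrderLE mQ mR r S) (hT : IsDiffOpOfOrderLE mP mQ s T) :
    IsDiffOpOfOrderLE mP mR (r + s) (S ∘ₗ T) := by
  have h (S : Q →ₗ[ℝ] R) (T : P →ₗ[ℝ] Q) (f) : (S ∘ₗ T) ∘ₗ mP f - mR f ∘ₗ (S ∘ₗ T) =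
      S ∘ₗ (T ∘ₗ mP f - mQ f ∘ₗ T) - (-(S ∘ₗ mQ f - mR f ∘ₗ S)) ∘ₗ T := by
    ext x; simp
  have hneg {r : ℕ} {S : Q →ₗ[ℝ] R} (hS : IsDiffOpOfOrderLE mQ mR r S) :
      IsDiffOpOfOrderLE mQ mR r (-S) := by
    rw [← zero_sub]; exact (isDiffOpOfOrderLE_zero r).sub hS
  induction r generalizing S T s with
  | zero =>
    induction s generalizing T with
    | zero => intro f; rw [h, hS f, hT f]; simp
    | succ s ih =>
      intro f
      rw [h, hS f, neg_zero, LinearMap.zero_comp, sub_zero]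
      exact ih (hT f)
  | succ r ih =>
    induction s generalizing T with
    | zero =>
      intro f
      rw [h, hT f, LinearMap.comp_zero]
      exact (isDiffOpOfOrderLE_zero _).sub (ih (hneg (hS f)) hT)
    | succ s ih' =>
      intro f
      rw [h]
      refine (ih' (hT f)).sub ?_
      rw [add_right_comm]
      exact ih (hneg (hS f)) hT

/-- The operators of finite order. -/
def IsFiniteOrder (mP : C → P →ₗ[ℝ] P) (mQ : C → Q →ₗ[ℝ] Q) (T : P →ₗ[ℝ] Q) : Prop :=
  ∃ r, IsDiffOpOfOrderLE mP mQ r T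

theorem isFiniteOrder_of_commute {T : P →ₗ[ℝ] Q} (h : ∀ f x, T (mP f x) = mQ f (T x)) :
    IsFiniteOrder mP mQ T :=
  ⟨0, fun f => by ext x; simp [h]⟩

theorem isFiniteOrder_id : IsFiniteOrder mP mP LinearMap.id :=
  isFiniteOrder_of_commute fun _ _ => rfl

theorem IsFiniteOrder.sub {S T : P →ₗ[ℝ] Q} (hS : IsFiniteOrder mP mQ S)
    (hT : IsFiniteOrder mP mQ T) : IsFiniteOrder mP mQ (S - T) := by
  obtain ⟨r, hr⟩ := hS
  obtain ⟨s, hs⟩ := hT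
  exact ⟨max r s, (hr.mono (le_max_left r s)).sub (hs.mono (le_max_right r s))⟩

theorem IsFiniteOrder.neg {T : P →ₗ[ℝ] Q} (hT : IsFiniteOrder mP mQ T) :
    IsFiniteOrder mP mQ (-T) := by
  rw [← zero_sub]; exact IsFiniteOrder.sub ⟨0, isDiffOpOfOrderLE_zero 0⟩ hT

theorem IsFiniteOrder.add {S T : P →ₗ[ℝ] Q} (hS : IsFiniteOrder mP mQ S)
    (hT : IsFiniteOrder mP mQ T) : IsFiniteOrder mP mQ (S + T) := by
  rw [← sub_neg_eq_add]; exact hS.sub hT.neg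

theorem IsFiniteOrder.comp {S : Q →ₗ[ℝ] R} {T : P →ₗ[ℝ] Q}
    (hS : IsFiniteOrder mQ mR S) (hT : IsFiniteOrder mP mQ T) : IsFiniteOrder mP mR (S ∘ₗ T) := by
  obtain ⟨r, hr⟩ := hS
  obtain ⟨s, hs⟩ := hT
  exact ⟨r + s, hr.comp hs⟩

theorem IsFiniteOrder.geom_sum {T : Module.End ℝ P} (hT : IsFiniteOrder mP mP T) (m : ℕ) :
    IsFiniteOrder mP mP (∑ j ∈ Finset.range m, T ^ j) := by
  have h (j : ℕ) : IsFiniteOrder mP mP (T ^ j) := by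
    induction j with
    | zero => exact isFiniteOrder_id
    | succ j ih => rw [pow_succ]; exact ih.comp hT
  induction m with
  | zero => exact ⟨0, isDiffOpOfOrderLE_zero 0⟩
  | succ m ih => rw [Finset.sum_range_succ]; exact ih.add (h m)

/-- Composing with a map linear over the functions composes all commutators with it. An injection
after `T`, or a surjection before it as in `IsFiniteOrder.of_surjective`, therefore detects the
order of `T`. -/
theorem IsFiniteOrder.of_injective {i : Q →ₗ[ℝ] R} (hi : Function.Injective i)
    (h : ∀ f x, i (mQ f x) = mR f (i x)) {T : P →ₗ[ℝ] Q} (hT : IsFiniteOrder mP mR (i ∘ₗ T)) :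
    IsFiniteOrder mP mQ T := by
  obtain ⟨r, hr⟩ := hT
  refine ⟨r, ?_⟩
  have key (T : P →ₗ[ℝ] Q) (f) : (i ∘ₗ T) ∘ₗ mP f - mR f ∘ₗ (i ∘ₗ T) =
      i ∘ₗ (T ∘ₗ mP f - mQ f ∘ₗ T) := by
    ext x; simp [h]
  induction r generalizing T with
  | zero =>
    intro f
    ext x
    apply hi
    have h1 := LinearMap.congr_fun (hr f) x
    rw [key] at h1
    simpa using h1
  | succ r ih =>
    intro f
    refine ih ?_
    rw [← key]
    exact hr f

theorem IsFiniteOrder.of_surjective {p : P →ₗ[ℝ] Q} (hp : Function.Surjective p)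
    (h : ∀ f x, p (mP f x) = mQ f (p x)) {T : Q →ₗ[ℝ] R} (hT : IsFiniteOrder mP mR (T ∘ₗ p)) :
    IsFiniteOrder mQ mR T := by
  obtain ⟨r, hr⟩ := hT
  refine ⟨r, ?_⟩
  have key (T : Q →ₗ[ℝ] R) (f) : (T ∘ₗ p) ∘ₗ mP f - mR f ∘ₗ (T ∘ₗ p) =
      (T ∘ₗ mQ f - mR f ∘ₗ T) ∘ₗ p := by
    ext x; simp [h]
  induction r generalizing T with
  | zero =>
    intro f
    ext x
    obtain ⟨x, rfl⟩ := hp x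
    have h1 := LinearMap.congr_fun (hr f) x
    rw [key] at h1
    simpa using h1
  | succ r ih =>
    intro f
    refine ih ?_
    rw [← key]
    exact hr f

end DifferentialOperators

/-! ### The exterior derivative is an operator of order one. -/

section ExteriorDerivativeOrder

variable {n : ℕ}

theorem extDeriv_mul {k : ℕ} {f : Model n → ℝ} {β : Model n → AltForm n k} {y : Model n}
    (hf : DifferentiableAt ℝ f y) (hβ : DifferentiableAt ℝ β y) :
    extDeriv (fun z => f z • β z) y = f y • extDeriv β y + wedge (fderiv ℝ f y) (β y) := by
  ext v
  rw [extDeriv, fderiv_fun_smul hf hβ]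
  simp [extDeriv, wedge_apply, ContinuousAlternatingMap.alternatizeUncurryFin_apply,
    Finset.mul_sum]

variable {M : Type*} [TopologicalSpace M] [ChartedSpace (Model n) M] [IsManifold (𝓡 n) ∞ M]

/-- Leibniz rule, with `ξ` the differential of `f` at `x`. One `ξ` serves all forms, so the
commutator of `d` with `f` is visibly linear over the functions. -/
theorem exists_extDField_mul (f : C^∞⟮𝓡 n, M; ℝ⟯) (x : M) : ∃ ξ : Model n →L[ℝ] ℝ,
    ∀ {k : ℕ} {α : M → AltForm n k}, IsSmoothField α → IsSmoothField (fun x => f x • α x) →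
      extDField (fun x => f x • α x) x = f x • extDField α x + wedge ξ (α x) := by
  have hy := mem_extChartAt_target (I := 𝓡 n) x
  let y := extChartAt (𝓡 n) x x
  have hx : (extChartAt (𝓡 n) x).symm y = x := extChartAt_to_inv x
  refine ⟨(fderiv ℝ (fun z => f ((extChartAt (𝓡 n) x).symm z)) y).comp (chartFrame x y).inverse,
    fun {k α} hα hfα => ?_⟩
  have hf : DifferentiableAt ℝ (fun z => f ((extChartAt (𝓡 n) x).symm z)) y :=
    (contMDiffAt_iff_contDiffAt.1 (f.contMDiff.contMDiffAt.comp y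
      (contMDiffAt_symm x hy))).differentiableAt (by simp)
  have h1 := (pull_extDField hfα x hy).trans (extDeriv_mul hf
    ((isSmoothField_iff_contDiffAt.1 hα x y hy).differentiableAt (by simp)))
  rw [← pull_extDField hα x hy] at h1
  have h2 (v : Fin (k + 1) → Model n) := congrArg (fun A : AltForm n (k + 1) =>
    A fun i => (chartFrame x y).inverse (v i)) h1
  ext v
  have h3 := h2 v
  simp only [ContinuousAlternatingMap.add_apply, ContinuousAlternatingMap.smul_apply, wedge_apply,
    pull_apply, Fin.removeNth] at h3
  simp only [chartFrame_inverse_apply x hy, y, hx] at h3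
  simp only [ContinuousAlternatingMap.add_apply, ContinuousAlternatingMap.smul_apply, wedge_apply,
    ContinuousLinearMap.comp_apply]
  exact h3

theorem isFiniteOrder_d (k : ℕ) :
    IsFiniteOrder (Form.mul (n := n) (M := M) k) (Form.mul (k + 1)) (d k) := by
  refine ⟨1, fun f => ?_⟩
  have h (α : Form n M k) (x : M) (ξ : Model n →L[ℝ] ℝ) (hξ : ∀ {k : ℕ} {α : M → AltForm n k},
      IsSmoothField α → IsSmoothField (fun x => f x • α x) →
      extDField (fun x => f x • α x) x = f x • extDField α x + wedge ξ (α x)) :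
      ((d k ∘ₗ Form.mul k f - Form.mul (k + 1) f ∘ₗ d k) α).1 x = wedge ξ (α.1 x) :=
    sub_eq_iff_eq_add'.2 (hξ (α := α.1) α.2 (Form.mul k f α).2)
  intro g
  refine LinearMap.ext fun α => Subtype.ext (funext fun x => ?_)
  obtain ⟨ξ, hξ⟩ := exists_extDField_mul f x
  refine sub_eq_zero.2 ((h _ x ξ hξ).trans ?_)
  refine Eq.trans ?_ (congrArg (fun A : AltForm n (k + 1) => g x • A) (h α x ξ hξ)).symm
  exact wedge_smul_right _ _ _

end ExteriorDerivativeOrder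

/-! ### Inversion of `δ d` on the sections of `im δ`, and the homotopy `Q`. -/

section Homotopy

variable {n : ℕ} {M : Type*} [TopologicalSpace M] [ChartedSpace (Model n) M]
  [IsManifold (𝓡 n) ∞ M] (γ : Metric n M) (E : Subbundle n M)

theorem exists_apply_eq_of_injOn {V : Type*} [AddCommGroup V] [Module ℝ V]
    [FiniteDimensional ℝ V] {f : V →ₗ[ℝ] V} {W : Submodule ℝ V} (h : ∀ w ∈ W, f w ∈ W)
    (hf : ∀ w ∈ W, f w = 0 → w = 0) {v : V} (hv : v ∈ W) : ∃ w ∈ W, f w = v := by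
  have h1 : Function.Injective (f.restrict h) := by
    rw [injective_iff_map_eq_zero]
    intro w hw
    exact Subtype.ext (hf w w.2 (congrArg Subtype.val hw))
  obtain ⟨w, hw⟩ := LinearMap.injective_iff_surjective.1 h1 ⟨v, hv⟩
  exact ⟨w, w.2, congrArg Subtype.val hw⟩

theorem Metric.boundary_mem {k w : ℕ} {x : M} {α : AltForm n (k + 1)}
    (hα : α ∈ weightFiltration (E.modelFiber x) w (k + 1)) :
    γ.boundary E k x α ∈ weightFiltration (E.modelFiber x) w k :=
  (γ.isHeisenbergBracket E x).isAnnihilatorBracket.lieBoundary_mem hα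

/-- The map `δ d₀` preserves the intersection of `im δ` with each step of the filtration and is
injective there, hence surjective by finite dimension. So its inverse preserves weights too. -/
theorem Metric.exists_boundary_coboundary_eq {k w : ℕ} {x : M} {β : AltForm n k}
    (hβ : β ∈ LinearMap.range (γ.boundary E k x))
    (hw : β ∈ weightFiltration (E.modelFiber x) w k) :
    ∃ η ∈ LinearMap.range (γ.boundary E k x), η ∈ weightFiltration (E.modelFiber x) w k ∧
      γ.boundary E k x (γ.coboundary E k x η) = β := by
  obtain ⟨η, ⟨h1, h2⟩, h3⟩ := exists_apply_eq_of_injOn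
    (f := γ.boundary E k x ∘ₗ γ.coboundary E k x)
    (W := LinearMap.range (γ.boundary E k x) ⊓ weightFiltration (E.modelFiber x) w k)
    (fun η hη => ⟨⟨_, rfl⟩, γ.boundary_mem E (lieCoboundary_mem _ hη.2)⟩)
    (fun η hη h => γ.boundary_coboundary_eq_zero E hη.1 h) ⟨hβ, hw⟩
  exact ⟨η, h1, h2, h3⟩

theorem Metric.eq_of_boundary_coboundary_eq {k : ℕ} {x : M} {α β : AltForm n k}
    (hα : α ∈ LinearMap.range (γ.boundary E k x)) (hβ : β ∈ LinearMap.range (γ.boundary E k x))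
    (h : γ.boundary E k x (γ.coboundary E k x α) = γ.boundary E k x (γ.coboundary E k x β)) :
    α = β := by
  refine sub_eq_zero.1 (γ.boundary_coboundary_eq_zero E (Submodule.sub_mem _ hα hβ) ?_)
  rw [map_sub, map_sub, h, sub_self]

/-- With `K = R (L + L₀)` one has `L = -L₀ (1 - K)`, and the geometric sum inverts `1 - K` when `K`
is nilpotent. -/
theorem neg_geom_sum_mul_inverse {A : Type*} [Ring A] {L L₀ R : A} (h₁ : L₀ * R = 1)
    (h₂ : R * L₀ = 1) {m : ℕ} (hK : (R * (L + L₀)) ^ m = 0) :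
    -((∑ j ∈ Finset.range m, (R * (L + L₀)) ^ j) * R) * L = 1 ∧
      L * -((∑ j ∈ Finset.range m, (R * (L + L₀)) ^ j) * R) = 1 := by
  have hL : L = -(L₀ * (1 - R * (L + L₀))) := by
    rw [mul_sub, ← mul_assoc, h₁]; simp
  generalize hK' : R * (L + L₀) = K at *
  have hS₁ := mul_neg_geom_sum K m
  have hS₂ := geom_sum_mul_neg K m
  rw [hK, sub_zero] at hS₁ hS₂
  rw [hL]
  constructor
  · rw [neg_mul_neg, mul_assoc, ← mul_assoc R, h₂, one_mul, hS₂]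
  · rw [neg_mul_neg, mul_assoc, ← mul_assoc (1 - K), hS₁, one_mul, h₁]

namespace Metric

/-- The operator `δ` on forms. -/
def boundaryForm (k : ℕ) : Form n M (k + 1) →ₗ[ℝ] Form n M k where
  toFun α := ⟨fun x => γ.boundary E k x (α.1 x), γ.isSmoothField_boundary E α.2⟩
  map_add' α β := Subtype.ext (funext fun x => map_add (γ.boundary E k x) (α.1 x) (β.1 x))
  map_smul' t α := Subtype.ext (funext fun x => map_smul (γ.boundary E k x) t (α.1 x))

/-- The coboundary operator of the bracket of the tangent spaces on forms. -/
def coboundaryForm (k : ℕ) : Form n M k →ₗ[ℝ] Form n M (k + 1) where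
  toFun α := ⟨fun x => γ.coboundary E k x (α.1 x), γ.isSmoothField_coboundary E α.2⟩
  map_add' α β := Subtype.ext (funext fun x => map_add (γ.coboundary E k x) (α.1 x) (β.1 x))
  map_smul' t α := Subtype.ext (funext fun x => map_smul (γ.coboundary E k x) t (α.1 x))

/-- The sections of the image of `δ`. -/
def imForm (k : ℕ) : Submodule ℝ (Form n M k) where
  carrier := {α | ∀ x, α.1 x ∈ LinearMap.range (γ.boundary E k x)}
  zero_mem' _ := Submodule.zero_mem (LinearMap.range (γ.boundary E k _))
  add_mem' ha hb x := Submodule.add_mem (LinearMap.range (γ.boundary E k x)) (ha x) (hb x)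
  smul_mem' t _ ha x := Submodule.smul_mem (LinearMap.range (γ.boundary E k x)) t (ha x)

/-- Multiplication of a section of the image of `δ` by a smooth function. -/
def imForm.mul (k : ℕ) (f : C^∞⟮𝓡 n, M; ℝ⟯) : γ.imForm E k →ₗ[ℝ] γ.imForm E k :=
  (Form.mul k f).restrict fun _ hα x =>
    Submodule.smul_mem (LinearMap.range (γ.boundary E k x)) (f x) (hα x)

/-- The operator `δ`, with values in the sections of the image of `δ`. -/
def boundaryIm (k : ℕ) : Form n M (k + 1) →ₗ[ℝ] γ.imForm E k :=
  (γ.boundaryForm E k).codRestrict _ fun α x => ⟨α.1 x, rfl⟩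

theorem isFiniteOrder_boundaryIm (k : ℕ) :
    IsFiniteOrder (Form.mul (k + 1)) (imForm.mul γ E k) (γ.boundaryIm E k) :=
  isFiniteOrder_of_commute fun f α => Subtype.ext (Subtype.ext (funext fun x =>
    map_smul (γ.boundary E k x) (f x) (α.1 x)))

theorem isFiniteOrder_coboundaryForm (k : ℕ) :
    IsFiniteOrder (Form.mul k) (Form.mul (k + 1)) (γ.coboundaryForm E k) :=
  isFiniteOrder_of_commute fun f α => Subtype.ext (funext fun x =>
    map_smul (γ.coboundary E k x) (f x) (α.1 x))

theorem isFiniteOrder_subtype (k : ℕ) :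
    IsFiniteOrder (imForm.mul γ E k) (Form.mul k) (γ.imForm E k).subtype :=
  isFiniteOrder_of_commute fun _ _ => rfl

/-- The operator `δ d₀` on the sections of the image of `δ`. -/
def laplaceZero (k : ℕ) : γ.imForm E k →ₗ[ℝ] γ.imForm E k :=
  γ.boundaryIm E k ∘ₗ γ.coboundaryForm E k ∘ₗ (γ.imForm E k).subtype

/-- The operator `δ d` on the sections of the image of `δ`. -/
def laplace (k : ℕ) : γ.imForm E k →ₗ[ℝ] γ.imForm E k :=
  γ.boundaryIm E k ∘ₗ d k ∘ₗ (γ.imForm E k).subtype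

variable {γ E}

/-- The equation is solved fibre by fibre; constancy of the rank makes the unique solution smooth.
-/
theorem laplaceZero_bijective {k : ℕ}
    (hr : IsLocallyConstant fun x : M => Module.finrank ℝ (LinearMap.range (γ.boundary E k x))) :
    Function.Bijective (γ.laplaceZero E k) := by
  constructor
  · rw [injective_iff_map_eq_zero]
    intro α hα
    refine Subtype.ext (Subtype.ext (funext fun x => ?_))
    exact γ.boundary_coboundary_eq_zero E (α.2 x)
      (congrArg (fun β : γ.imForm E k => (β.1.1 x : AltForm n k)) hα)
  · intro β
    have h (x : M) := γ.exists_boundary_coboundary_eq E (β.2 x) (mem_weightFiltration_zero _)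
    choose η h1 h2 h3 using h
    exact ⟨⟨⟨η, γ.isSmoothField_of_boundary_coboundary_eq E hr h1 β.1.2 h3⟩, h1⟩,
      Subtype.ext (Subtype.ext (funext h3))⟩

/-- A solution of the given weight exists in each fibre, and solutions in `im δ` are unique. -/
theorem laplaceZero_weight {k w : ℕ} {α : γ.imForm E k}
    (h : ∀ x, (γ.laplaceZero E k α).1.1 x ∈ weightFiltration (E.modelFiber x) w k) (x : M) :
    α.1.1 x ∈ weightFiltration (E.modelFiber x) w k := by
  obtain ⟨η, h1, h2, h3⟩ := γ.exists_boundary_coboundary_eq E ((γ.laplaceZero E k α).2 x) (h x)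
  exact γ.eq_of_boundary_coboundary_eq E (α.2 x) h1 h3.symm ▸ h2

theorem laplace_add_laplaceZero_weight {k w : ℕ} {α : γ.imForm E k}
    (h : ∀ x, α.1.1 x ∈ weightFiltration (E.modelFiber x) w k) (x : M) :
    ((γ.laplace E k + γ.laplaceZero E k) α).1.1 x ∈
      weightFiltration (E.modelFiber x) (w + 1) k := by
  have h1 := γ.boundary_mem E (extDField_add_coboundary_mem E γ (α := α.1.1) α.1.2 h x)
  rw [map_add] at h1
  exact h1

/-- The operator `δ d` is invertible on the sections of the image of `δ`, and its inverse is a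
differential operator. -/
theorem exists_laplace_inverse {k : ℕ}
    (hr : IsLocallyConstant fun x : M => Module.finrank ℝ (LinearMap.range (γ.boundary E k x))) :
    ∃ G : Module.End ℝ (γ.imForm E k), (∀ α, G (γ.laplace E k α) = α) ∧
      (∀ α, γ.laplace E k (G α) = α) ∧ IsFiniteOrder (imForm.mul γ E k) (imForm.mul γ E k) G := by
  let L₀ : Module.End ℝ (γ.imForm E k) := γ.laplaceZero E k
  let L : Module.End ℝ (γ.imForm E k) := γ.laplace E k
  let e : γ.imForm E k ≃ₗ[ℝ] γ.imForm E k := LinearEquiv.ofBijective _ (laplaceZero_bijective hr)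
  let R : Module.End ℝ (γ.imForm E k) := e.symm.toLinearMap
  have hR1 : L₀ * R = 1 := LinearMap.ext fun α => e.apply_symm_apply α
  have hR2 : R * L₀ = 1 := LinearMap.ext fun α => e.symm_apply_apply α
  let K : Module.End ℝ (γ.imForm E k) := R * (L + L₀)
  -- `L + L₀` raises the weight by one and `R` preserves it, so `K` raises it by one.
  have hK (j : ℕ) (α : γ.imForm E k) (x : M) :
      ((K ^ j) α).1.1 x ∈ weightFiltration (E.modelFiber x) j k := by
    induction j generalizing x with
    | zero => exact mem_weightFiltration_zero _
    | succ j ih =>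
      rw [pow_succ']
      refine laplaceZero_weight (fun x => ?_) x
      have h1 : γ.laplaceZero E k ((K * K ^ j) α) = (L + L₀) ((K ^ j) α) :=
        e.apply_symm_apply _
      rw [h1]
      exact laplace_add_laplaceZero_weight ih x
  -- A `k`-form of weight greater than `2k` is zero.
  have hK0 : K ^ (2 * k + 1) = 0 := by
    refine LinearMap.ext fun α => Subtype.ext (Subtype.ext (funext fun x => ?_))
    exact eq_zero_of_mem_weightFiltration (hK _ α x) (by omega)
  obtain ⟨h1, h2⟩ := neg_geom_sum_mul_inverse (L := L) (m := 2 * k + 1) hR1 hR2 hK0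
  refine ⟨-((∑ j ∈ Finset.range (2 * k + 1), K ^ j) * R), fun α => LinearMap.congr_fun h1 α,
    fun α => LinearMap.congr_fun h2 α, ?_⟩
  · have hL₀ : IsFiniteOrder (imForm.mul γ E k) (imForm.mul γ E k) L₀ :=
      (γ.isFiniteOrder_boundaryIm E k).comp
        ((γ.isFiniteOrder_coboundaryForm E k).comp (γ.isFiniteOrder_subtype E k))
    have hLd : IsFiniteOrder (imForm.mul γ E k) (imForm.mul γ E k) L :=
      (γ.isFiniteOrder_boundaryIm E k).comp
        ((isFiniteOrder_d k).comp (γ.isFiniteOrder_subtype E k))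
    -- `R` inverts an operator that is linear over the functions, so it has order zero.
    have hRd : IsFiniteOrder (imForm.mul γ E k) (imForm.mul γ E k) R := by
      refine isFiniteOrder_of_commute fun f α => ?_
      refine e.symm_apply_eq.2 ?_
      refine Subtype.ext (Subtype.ext (funext fun x => ?_))
      have h3 (a b : AltForm n k) (h : γ.boundary E k x (γ.coboundary E k x a) = b) :
          f x • b = γ.boundary E k x (γ.coboundary E k x (f x • a)) := by
        rw [map_smul, map_smul, h]
      exact h3 _ _ (congrArg (fun β : γ.imForm E k => (β.1.1 x : AltForm n k))
        (e.apply_symm_apply α))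
    exact (IsFiniteOrder.comp ((hRd.comp (hLd.add hL₀)).geom_sum _) hRd).neg

theorem boundary_boundary {k : ℕ} (x : M) (α : AltForm n (k + 2)) :
    γ.boundary E k x (γ.boundary E (k + 1) x α) = 0 :=
  (γ.isHeisenbergBracket E x).isAnnihilatorBracket.lieBoundary_lieBoundary k α

/-- The homotopy `Q = (δ d)⁻¹ δ`. -/
theorem exists_homotopy {k : ℕ}
    (hr : IsLocallyConstant fun x : M => Module.finrank ℝ (LinearMap.range (γ.boundary E k x))) :
    ∃ Q : Form n M (k + 1) →ₗ[ℝ] Form n M k, (∀ α, Q α ∈ γ.imForm E k) ∧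
      (∀ α, γ.boundaryForm E k (d k (Q α)) = γ.boundaryForm E k α) ∧
      (∀ α ∈ γ.imForm E k, Q (d k α) = α) ∧ (∀ α, γ.boundaryForm E k α = 0 → Q α = 0) ∧
      IsFiniteOrder (Form.mul (k + 1)) (Form.mul k) Q := by
  obtain ⟨G, hG1, hG2, hG3⟩ := exists_laplace_inverse hr
  refine ⟨(γ.imForm E k).subtype ∘ₗ G ∘ₗ γ.boundaryIm E k, fun α => (G (γ.boundaryIm E k α)).2,
    fun α => ?_, fun α hα => ?_, fun α hα => ?_,
    (γ.isFiniteOrder_subtype E k).comp (hG3.comp (γ.isFiniteOrder_boundaryIm E k))⟩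
  · exact congrArg Subtype.val (hG2 (γ.boundaryIm E k α))
  · exact congrArg Subtype.val (hG1 ⟨α, hα⟩)
  · have h : γ.boundaryIm E k α = 0 := Subtype.ext hα
    rw [LinearMap.comp_apply, LinearMap.comp_apply, h, map_zero, map_zero]

end Metric

end Homotopy

/-! ### The map `ι` and the operator `D`. -/

section RuminComplex

variable {n : ℕ} {M : Type*} [TopologicalSpace M] [ChartedSpace (Model n) M]
  [IsManifold (𝓡 n) ∞ M] {E : Subbundle n M}

theorem Metric.delta_mk (γ : Metric n M) (k : ℕ) (x : M) :
    QuasiConformalStructure.delta (Quotient.mk (quasiConformalSetoid E) γ) k x =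
      γ.boundary E k x := by
  have h : QuasiConformalStructure.bracket (Quotient.mk (quasiConformalSetoid E) γ) x =
      dualBracket (γ.modelFlat x) (γ.modelBracket E x) := γ.bracket_eq_dualBracket E x
  exact congrArg (fun B => lieBoundary B k) h

namespace QuasiConformalStructure

variable (c : QuasiConformalStructure E)

theorem delta_delta (k : ℕ) (x : M) (α : FormFiber n (k + 2) x) :
    c.delta k x (c.delta (k + 1) x α) = 0 := by
  induction c using Quotient.ind with | _ γ
  exact (congrArg₂ (fun (f : AltForm n (k + 1) →ₗ[ℝ] AltForm n k)
    (g : AltForm n (k + 2) →ₗ[ℝ] AltForm n (k + 1)) => f (g α)) (γ.delta_mk (E := E) k x)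
      (γ.delta_mk (E := E) (k + 1) x)).trans (Metric.boundary_boundary x _)

theorem imDelta_le_kerDelta (k : ℕ) (x : M) : c.imDelta k x ≤ c.kerDelta k x := by
  rintro _ ⟨α, rfl⟩
  cases k with
  | zero => exact Submodule.mem_top
  | succ k => exact c.delta_delta k x α

variable {c}

/-- The properties of `Q` are stated through `δ` alone, so that the choice of a metric in the class
can be forgotten from here on. -/
theorem exists_homotopy (hc : c.IsRegular) (k : ℕ) :
    ∃ Q : Form n M (k + 1) →ₗ[ℝ] Form n M k, (∀ α x, (Q α).1 x ∈ c.imDelta k x) ∧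
      (∀ α x, c.delta k x ((d k (Q α)).1 x) = c.delta k x (α.1 x)) ∧
      (∀ α, (∀ x, α.1 x ∈ c.imDelta k x) → Q (d k α) = α) ∧
      (∀ α, (∀ x, c.delta k x (α.1 x) = 0) → Q α = 0) ∧
      IsFiniteOrder (Form.mul (k + 1)) (Form.mul k) Q := by
  induction c using Quotient.ind with | _ γ
  have h1 (x : M) : imDelta (Quotient.mk (quasiConformalSetoid E) γ) k x =
      LinearMap.range (γ.boundary E k x) :=
    congrArg (fun f : AltForm n (k + 1) →ₗ[ℝ] AltForm n k => LinearMap.range f) (γ.delta_mk k x)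
  have h2 (x : M) (α : FormFiber n (k + 1) x) :
      delta (Quotient.mk (quasiConformalSetoid E) γ) k x α = γ.boundary E k x α :=
    congrArg (fun f : AltForm n (k + 1) →ₗ[ℝ] AltForm n k => f α) (γ.delta_mk k x)
  have hr : IsLocallyConstant fun x : M =>
      Module.finrank ℝ (LinearMap.range (γ.boundary E k x)) := by
    convert hc k using 2 with x
    exact congrArg (fun W : Submodule ℝ (AltForm n k) => Module.finrank ℝ W) (h1 x).symm
  obtain ⟨Q, hQ1, hQ2, hQ3, hQ4, hQ5⟩ := Metric.exists_homotopy hr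
  refine ⟨Q, fun α x => ?_, fun α x => ?_, fun α hα => hQ3 α fun x => ?_,
    fun α hα => hQ4 α (Subtype.ext (funext fun x => ?_)), hQ5⟩
  · exact (h1 x).symm ▸ hQ1 α x
  · refine (h2 x _).trans (Eq.trans ?_ (h2 x _).symm)
    exact congrArg (fun β : Form n M k => (β.1 x : AltForm n k)) (hQ2 α)
  · exact h1 x ▸ hα x
  · exact (h2 x _).symm.trans (hα x)

/-- Each class modulo `im δ` has exactly one representative `a` with `δ d₀ a = 0`. Uniqueness makes
the fibrewise choices agree with the smooth local normalisation of any local representative, so the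
resulting form is smooth. -/
theorem exists_lift (hc : c.IsRegular) (k : ℕ) (σ : c.HomologySection k) :
    ∃ α : Form n M k, ∃ h : ∀ x, α.1 x ∈ c.kerDelta k x,
      ∀ x, σ.1 x = Submodule.Quotient.mk ⟨α.1 x, h x⟩ := by
  induction c using Quotient.ind with | _ γ
  have h1 (x : M) : imDelta (Quotient.mk (quasiConformalSetoid E) γ) k x =
      LinearMap.range (γ.boundary E k x) :=
    congrArg (fun f : AltForm n (k + 1) →ₗ[ℝ] AltForm n k => LinearMap.range f) (γ.delta_mk k x)
  have hr : IsLocallyConstant fun x : M =>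
      Module.finrank ℝ (LinearMap.range (γ.boundary E k x)) := by
    convert hc k using 2 with x
    exact congrArg (fun W : Submodule ℝ (AltForm n k) => Module.finrank ℝ W) (h1 x).symm
  have hker (x : M) (η : AltForm n k) (hη : η ∈ LinearMap.range (γ.boundary E k x)) :
      η ∈ kerDelta (Quotient.mk (quasiConformalSetoid E) γ) k x :=
    imDelta_le_kerDelta _ k x (h1 x ▸ hη)
  have hex (x : M) : ∃ a : AltForm n k, γ.boundary E k x (γ.coboundary E k x a) = 0 ∧
      ∃ h : a ∈ kerDelta (Quotient.mk (quasiConformalSetoid E) γ) k x,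
        σ.1 x = Submodule.Quotient.mk ⟨a, h⟩ := by
    obtain ⟨⟨a, ha⟩, hσ⟩ := Submodule.Quotient.mk_surjective _ (σ.1 x)
    let a' : AltForm n k := a
    obtain ⟨η, hη, -, hη'⟩ := γ.exists_boundary_coboundary_eq E
      (β := γ.boundary E k x (γ.coboundary E k x a')) ⟨_, rfl⟩ (mem_weightFiltration_zero _)
    refine ⟨a' - η, by rw [map_sub, map_sub, hη', sub_self],
      Submodule.sub_mem _ ha (hker x η hη), ?_⟩
    rw [← hσ]
    refine (Submodule.Quotient.eq _).2 ?_
    change a' - (a' - η) ∈ imDelta (Quotient.mk (quasiConformalSetoid E) γ) k x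
    rw [sub_sub_cancel]
    exact (h1 x).symm ▸ hη
  choose a ha ha' haσ using hex
  refine ⟨⟨a, isSmoothField_of_eventuallyEq fun x => ?_⟩, ha', haσ⟩
  -- Near `x` the form `α - η` represents `σ`, where the section `η` of `im δ` solves `δ d₀ η = δ d₀
  -- α`; it is thus the normalised representative.
  obtain ⟨α, hα⟩ := σ.2 x
  obtain ⟨η, hη⟩ := (Metric.laplaceZero_bijective hr).2
    (γ.boundaryIm E k (γ.coboundaryForm E k α))
  refine ⟨(α - η.1).1, (α - η.1).2, ?_⟩
  filter_upwards [hα] with y ⟨hy, hσy⟩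
  let α' : AltForm n k := α.1 y
  let η' : AltForm n k := η.1.1 y
  change a y = α' - η'
  have hη1 : γ.boundary E k y (γ.coboundary E k y η') = γ.boundary E k y (γ.coboundary E k y α') :=
    congrArg (fun β : γ.imForm E k => (β.1.1 y : AltForm n k)) hη
  have hη2 : η' ∈ LinearMap.range (γ.boundary E k y) := η.2 y
  have h3 : a y - α' ∈ LinearMap.range (γ.boundary E k y) := by
    have h4 := (Submodule.Quotient.eq _).1 ((haσ y).symm.trans hσy)
    exact h1 y ▸ (show a y - α' ∈ imDelta (Quotient.mk (quasiConformalSetoid E) γ) k y from h4)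
  have h5 : a y - α' = -η' := by
    refine γ.eq_of_boundary_coboundary_eq E h3 (Submodule.neg_mem _ hη2) ?_
    rw [map_sub, map_sub, ha, map_neg, map_neg, hη1, zero_sub]
  rw [sub_eq_iff_eq_add'.1 h5, sub_eq_add_neg]

/-- If the class of `α` is zero, then `α` lies in `im δ` and `Q d α = α`; but `δ d α = 0` gives `Q d
α = 0`. -/
theorem iota_injective (hc : c.IsRegular) (k : ℕ) : Function.Injective (c.iota k) := by
  obtain ⟨Q, -, -, hQ3, hQ4, -⟩ := exists_homotopy hc k
  rw [injective_iff_map_eq_zero]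
  intro α hα
  refine Subtype.ext ?_
  rw [← hQ3 α.1 fun x => ?_]
  · exact hQ4 _ α.2.2
  · have h : (Submodule.Quotient.mk ⟨α.1.1 x, α.2.1 x⟩ : c.HomologyFiber k x) = 0 :=
      congrArg (fun σ : c.HomologySection k => σ.1 x) hα
    have h' := (Submodule.Quotient.mk_eq_zero _).1 h
    exact h'

/-- The smooth sections of `ker δ`. -/
def kerForm (c : QuasiConformalStructure E) (k : ℕ) : Submodule ℝ (Form n M k) where
  carrier := {α | ∀ x, α.1 x ∈ c.kerDelta k x}
  zero_mem' _ := Submodule.zero_mem _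
  add_mem' ha hb x := Submodule.add_mem _ (ha x) (hb x)
  smul_mem' t _ ha x := Submodule.smul_mem _ t (ha x)

/-- Multiplication of a section of `ker δ` by a smooth function. -/
def kerForm.mul (c : QuasiConformalStructure E) (k : ℕ) (f : C^∞⟮𝓡 n, M; ℝ⟯) :
    c.kerForm k →ₗ[ℝ] c.kerForm k :=
  (Form.mul k f).restrict fun _ hα x => Submodule.smul_mem _ (f x) (hα x)

/-- The class modulo `im δ` of a section of `ker δ`. -/
def homologyClass (c : QuasiConformalStructure E) (k : ℕ) :
    c.kerForm k →ₗ[ℝ] c.HomologySection k where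
  toFun α := ⟨fun x => Submodule.Quotient.mk ⟨α.1.1 x, α.2 x⟩,
    fun _ => ⟨α.1, Filter.Eventually.of_forall fun y => ⟨α.2 y, rfl⟩⟩⟩
  map_add' _ _ := rfl
  map_smul' _ _ := rfl

theorem homologyClass_surjective (hc : c.IsRegular) (k : ℕ) :
    Function.Surjective (c.homologyClass k) := by
  intro σ
  obtain ⟨α, h, hσ⟩ := exists_lift hc k σ
  exact ⟨⟨α, h⟩, Subtype.ext (funext fun x => (hσ x).symm)⟩

theorem homologyClass_eq {k : ℕ} {α β : c.kerForm k}
    (h : ∀ x, α.1.1 x - β.1.1 x ∈ c.imDelta k x) : c.homologyClass k α = c.homologyClass k β :=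
  Subtype.ext (funext fun x => (Submodule.Quotient.eq _).2 (h x))

/-- Subtracting `Q d α`, a section of `im δ`, keeps `α` in `ker δ` and in its class, and `δ d Q = δ`
cancels `δ d α`. -/
theorem sub_homotopy_mem {k : ℕ} {Q : Form n M (k + 1) →ₗ[ℝ] Form n M k}
    (hQ1 : ∀ α x, (Q α).1 x ∈ c.imDelta k x)
    (hQ2 : ∀ α x, c.delta k x ((d k (Q α)).1 x) = c.delta k x (α.1 x))
    {α : Form n M k} (hα : α ∈ c.kerForm k) : α - Q (d k α) ∈ c.HarmonicForm k := by
  refine ⟨fun x => Submodule.sub_mem _ (hα x) (c.imDelta_le_kerDelta k x (hQ1 _ x)), fun x => ?_⟩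
  have h : c.delta k x ((d k α).1 x - (d k (Q (d k α))).1 x) = 0 := by
    rw [map_sub, hQ2, sub_self]
  rw [map_sub]
  exact h

theorem iota_bijective (hc : c.IsRegular) (k : ℕ) : Function.Bijective (c.iota k) := by
  refine ⟨iota_injective hc k, fun σ => ?_⟩
  obtain ⟨Q, hQ1, hQ2, -, -, -⟩ := exists_homotopy hc k
  obtain ⟨α, rfl⟩ := homologyClass_surjective hc k σ
  let β : c.HarmonicForm k := ⟨_, sub_homotopy_mem hQ1 hQ2 α.2⟩
  refine ⟨β, homologyClass_eq (α := ⟨β.1, β.2.1⟩) fun x => ?_⟩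
  have h : (Q (d k α.1)).1 x ∈ c.imDelta k x := hQ1 _ x
  rw [← neg_mem_iff] at h
  convert h using 1
  exact sub_sub_cancel_left _ _

/-- The representatives of the values of `D`. -/
theorem ruminD_homologyClass (hι : ∀ k, Function.Bijective (c.iota k)) {k : ℕ}
    {Q : Form n M (k + 1) →ₗ[ℝ] Form n M k} (hQ1 : ∀ α x, (Q α).1 x ∈ c.imDelta k x)
    (hQ2 : ∀ α x, c.delta k x ((d k (Q α)).1 x) = c.delta k x (α.1 x)) (α : c.kerForm k) :
    c.ruminD hι k (c.homologyClass k α) = c.homologyClass (k + 1)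
      ⟨d k (α.1 - Q (d k α.1)), (sub_homotopy_mem hQ1 hQ2 α.2).2⟩ := by
  let β : c.HarmonicForm k := ⟨_, sub_homotopy_mem hQ1 hQ2 α.2⟩
  have h1 : c.homologyClass k α = c.iota k β := by
    refine homologyClass_eq (β := ⟨β.1, β.2.1⟩) fun x => ?_
    have h : (Q (d k α.1)).1 x ∈ c.imDelta k x := hQ1 _ x
    convert h using 1
    exact sub_sub_cancel _ _
  have h2 : (c.iotaEquiv hι k).symm (c.iota k β) = β := (c.iotaEquiv hι k).symm_apply_apply β
  rw [h1, ruminD, LinearMap.comp_apply, LinearMap.comp_apply, LinearEquiv.coe_coe, h2]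
  rfl

theorem isFiniteOrder_homologyClass (k : ℕ) :
    IsFiniteOrder (P := c.kerForm k) (Q := c.HomologySection k) (kerForm.mul c k)
      (HomologySection.mul c k) (c.homologyClass k) :=
  isFiniteOrder_of_commute fun _ _ => rfl

theorem isFiniteOrder_kerForm_subtype (k : ℕ) :
    IsFiniteOrder (kerForm.mul c k) (Form.mul k) (c.kerForm k).subtype :=
  isFiniteOrder_of_commute fun _ _ => rfl

/-- On representatives `D` is `d (1 - Q d)`, of finite order because `Q` is. The finite order passes
to `D` because the class map from sections of `ker δ` is surjective and linear over the functions.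
-/
theorem exists_isDiffOp_ruminD (hc : c.IsRegular) (hι : ∀ k, Function.Bijective (c.iota k))
    (k : ℕ) : ∃ r : ℕ, c.IsDiffOp r (c.ruminD hι k) := by
  obtain ⟨Q, hQ1, hQ2, -, -, hQ5⟩ := exists_homotopy hc k
  let A : Form n M k →ₗ[ℝ] Form n M (k + 1) := d k ∘ₗ (LinearMap.id - Q ∘ₗ d k)
  have hA : IsFiniteOrder (Form.mul k) (Form.mul (k + 1)) A :=
    (isFiniteOrder_d k).comp (isFiniteOrder_id.sub (hQ5.comp (isFiniteOrder_d k)))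
  obtain ⟨B, hB⟩ : ∃ B : c.kerForm k →ₗ[ℝ] c.kerForm (k + 1), ∀ α, (B α).1 = A α.1 :=
    ⟨(A ∘ₗ (c.kerForm k).subtype).codRestrict _ fun α => (sub_homotopy_mem hQ1 hQ2 α.2).2,
      fun _ => rfl⟩
  have hBA : (c.kerForm (k + 1)).subtype ∘ₗ B = A ∘ₗ (c.kerForm k).subtype :=
    LinearMap.ext hB
  have hBo : IsFiniteOrder (kerForm.mul c k) (kerForm.mul c (k + 1)) B := by
    refine IsFiniteOrder.of_injective (mR := Form.mul (k + 1)) (i := (c.kerForm (k + 1)).subtype)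
      (Submodule.subtype_injective _) (fun _ _ => rfl) ?_
    rw [hBA]
    exact hA.comp (isFiniteOrder_kerForm_subtype k)
  have hD : c.ruminD hι k ∘ₗ c.homologyClass k = c.homologyClass (k + 1) ∘ₗ B := by
    refine LinearMap.ext fun α => (ruminD_homologyClass hι hQ1 hQ2 α).trans ?_
    exact congrArg (c.homologyClass (k + 1)) (Subtype.ext (hB α).symm)
  have h := (isFiniteOrder_homologyClass (c := c) (k + 1)).comp hBo
  rw [← hD] at h
  exact IsFiniteOrder.of_surjective (P := c.kerForm k) (Q := c.HomologySection k)
    (R := c.HomologySection (k + 1)) (mQ := HomologySection.mul c k) (p := c.homologyClass k)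
    (homologyClass_surjective hc k) (fun _ _ => rfl) h

end QuasiConformalStructure

end RuminComplex

/-! ### The homotopy equivalence between `𝓔` and the de Rham complex. -/

section QuasiIsomorphism

open CategoryTheory

variable {n : ℕ} {M : Type*} [TopologicalSpace M] [ChartedSpace (Model n) M]
  [IsManifold (𝓡 n) ∞ M] {E : Subbundle n M} {c : QuasiConformalStructure E}

namespace QuasiConformalStructure

/-- The operator `1 - (dQ + Qd)`. -/
def projection (Q : ∀ k, Form n M (k + 1) →ₗ[ℝ] Form n M k) : ∀ k, Form n M k →ₗ[ℝ] Form n M k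
  | 0 => LinearMap.id - Q 0 ∘ₗ d 0
  | k + 1 => LinearMap.id - (Q (k + 1) ∘ₗ d (k + 1) + d k ∘ₗ Q k)

/-- Since `d² = 0`, in positive degree `1 - dQ - Qd` is `1 - Qd` applied to `α - d Q α`, and the
latter lies in `ker δ` by `δ d Q = δ`. -/
theorem projection_mem {Q : ∀ k, Form n M (k + 1) →ₗ[ℝ] Form n M k}
    (hQ1 : ∀ k α x, (Q k α).1 x ∈ c.imDelta k x)
    (hQ2 : ∀ k α x, c.delta k x ((d k (Q k α)).1 x) = c.delta k x (α.1 x)) (k : ℕ)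
    (α : Form n M k) : projection Q k α ∈ c.HarmonicForm k := by
  obtain _ | k := k
  · exact sub_homotopy_mem (hQ1 0) (hQ2 0) fun _ => Submodule.mem_top
  · have h1 : projection Q (k + 1) α =
        (α - d k (Q k α)) - Q (k + 1) (d (k + 1) (α - d k (Q k α))) := by
      rw [map_sub (d (k + 1)), d_d, sub_zero, sub_sub, add_comm (d k (Q k α))]
      rfl
    rw [h1]
    refine sub_homotopy_mem (hQ1 (k + 1)) (hQ2 (k + 1)) fun x => ?_
    have h2 : c.delta k x (α.1 x - (d k (Q k α)).1 x) = 0 := by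
      rw [map_sub, hQ2, sub_self]
    exact h2

theorem d_projection (Q : ∀ k, Form n M (k + 1) →ₗ[ℝ] Form n M k) (k : ℕ) (α : Form n M k) :
    d k (projection Q k α) = projection Q (k + 1) (d k α) := by
  have h : projection Q (k + 1) (d k α) = d k α - d k (Q k (d k α)) := by
    change d k α - (Q (k + 1) (d (k + 1) (d k α)) + d k (Q k (d k α))) = _
    rw [d_d, map_zero, zero_add]
  rw [h, ← map_sub]
  obtain _ | k := k
  · rfl
  · change d (k + 1) (α - (Q (k + 1) (d (k + 1) α) + d k (Q k α))) = _
    rw [← sub_sub, map_sub _ (_ - _), d_d, sub_zero]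

/-- Both `α` and `d α` lie in `ker δ`, on which `Q` vanishes. -/
theorem projection_of_mem {Q : ∀ k, Form n M (k + 1) →ₗ[ℝ] Form n M k}
    (hQ4 : ∀ k α, (∀ x, c.delta k x (α.1 x) = 0) → Q k α = 0) {k : ℕ} {α : Form n M k}
    (hα : α ∈ c.HarmonicForm k) : projection Q k α = α := by
  obtain _ | k := k
  · change α - Q 0 (d 0 α) = α
    rw [hQ4 0 _ hα.2, sub_zero]
  · change α - (Q (k + 1) (d (k + 1) α) + d k (Q k α)) = α
    rw [hQ4 (k + 1) _ hα.2, hQ4 k _ hα.1, map_zero, add_zero, sub_zero]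

/-- The projection `1 - dQ - Qd` is a strict left inverse of the inclusion, and `Q` is the homotopy
for the composite in the other order. -/
theorem quasiIso_inclusion (hc : c.IsRegular) : QuasiIso c.inclusion := by
  choose Q hQ1 hQ2 hQ3 hQ4 hQ5 using exists_homotopy hc
  let P : deRham n M ⟶ c.harmonicComplex := CochainComplex.ofHom
    (fun k => ModuleCat.ofHom ((projection Q k).codRestrict (c.HarmonicForm k)
      (projection_mem hQ1 hQ2 k)))
    (fun k => by
      rw [deRham_d, harmonicComplex_d]
      ext α : 2
      exact Subtype.ext (d_projection Q k α))
  let h (i j : ℕ) (hij : (ComplexShape.up ℕ).Rel j i) : (deRham n M).X i ⟶ (deRham n M).X j := by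
    obtain rfl : j + 1 = i := hij
    exact ModuleCat.ofHom (Q j)
  have h1 : c.inclusion ≫ P = 𝟙 _ := by
    ext k α : 3
    exact Subtype.ext (projection_of_mem hQ4 α.2)
  have h2 : 𝟙 (deRham n M) - P ≫ c.inclusion = Homotopy.nullHomotopicMap' h := by
    ext k : 1
    obtain _ | k := k
    · rw [Homotopy.nullHomotopicMap'_f_of_not_rel_right (k₀ := 0 + 1) (k₁ := 0) rfl (by simp) h,
        deRham_d]
      ext α : 2
      exact sub_sub_cancel α _
    · rw [Homotopy.nullHomotopicMap'_f (k₂ := k) (k₁ := k + 1) (k₀ := k + 1 + 1) rfl rfl h,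
        deRham_d, deRham_d]
      ext α : 2
      exact sub_sub_cancel α _
  let e : HomotopyEquiv c.harmonicComplex (deRham n M) :=
    { hom := c.inclusion
      inv := P
      homotopyHomInvId := Homotopy.ofEq h1
      homotopyInvHomId := (Homotopy.equivSubZero.symm
        ((Homotopy.ofEq h2).trans (Homotopy.nullHomotopy' h))).symm }
  exact e.quasiIso_hom

/-- The maps `ι` form an isomorphism of complexes whose composite with `ι⁻¹` is the inclusion of
`𝓔`, so the previous result and two-out-of-three apply. -/
theorem quasiIso_ruminToDeRham (hc : c.IsRegular) (hι : ∀ k, Function.Bijective (c.iota k)) :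
    QuasiIso (c.ruminToDeRham hι) := by
  let F : c.harmonicComplex ⟶ c.ruminComplex hι := CochainComplex.ofHom
    (fun k => ModuleCat.ofHom (c.iota k))
    (fun k => by
      rw [ruminComplex_d, harmonicComplex_d]
      ext α : 2
      exact congrArg (fun β => c.iota (k + 1) (c.dHarmonic k β))
        ((c.iotaEquiv hι k).symm_apply_apply α))
  have hF (k : ℕ) : IsIso (F.f k) :=
    ⟨ModuleCat.ofHom (c.iotaEquiv hι k).symm.toLinearMap,
      by ext α : 2; exact (c.iotaEquiv hι k).symm_apply_apply α,
      by ext α : 2; exact (c.iotaEquiv hι k).apply_symm_apply α⟩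
  have : IsIso F := HomologicalComplex.Hom.isIso_of_components F
  have h : F ≫ c.ruminToDeRham hι = c.inclusion := by
    ext k α : 3
    exact congrArg Subtype.val ((c.iotaEquiv hι k).symm_apply_apply α)
  have := quasiIso_inclusion hc
  rw [← h] at this
  exact quasiIso_of_comp_left F _

end QuasiConformalStructure

end QuasiIsomorphism

end Heisenberg

end

theorem mainTheorem8 {n : ℕ} {M : Type*} [TopologicalSpace M]
    [ChartedSpace (EuclideanSpace ℝ (Fin n)) M] [IsManifold (𝓡 n) ∞ M] [T2Space M]
    [SigmaCompactSpace M] (E : Heisenberg.Subbundle n M)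
    (c : Heisenberg.QuasiConformalStructure E) (hc : c.IsRegular) :
    QuasiIso c.inclusion ∧
    ∃ hι : ∀ k : ℕ, Function.Bijective (c.iota k),
      (∀ k : ℕ, c.ruminD hι (k + 1) ∘ₗ c.ruminD hι k = 0) ∧
      (∀ k : ℕ, ∃ r : ℕ, c.IsDiffOp r (c.ruminD hι k)) ∧
      QuasiIso (c.ruminToDeRham hι) := by
  exact ⟨Heisenberg.QuasiConformalStructure.quasiIso_inclusion hc,
    Heisenberg.QuasiConformalStructure.iota_bijective hc, c.ruminD_ruminD _,
    Heisenberg.QuasiConformalStructure.exists_isDiffOp_ruminD hc _,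
    Heisenberg.QuasiConformalStructure.quasiIso_ruminToDeRham hc _⟩
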